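/- Let $\mathbb T^3=[0,2\pi]^3$ (periodic), let $\Omega,\beta,\eta>0$ and $r>3$ be fixed constants, and let $\mathbf M$ be the vector Fourier multiplier on $\mathbb T^3$ whose symbol is $\widehat{\mathbf M}(k)=0$ if $k_3=0$, and, for $k\in\mathbb Z^3$ with $k_3\ne0$, $$\widehat{\mathbf M}(k)=\frac{\Big(2\Omega k_2k_3|k|^2-\tfrac{\beta^2}{\eta}k_1k_2^2k_3,\;\;-2\Omega k_1k_3|k|^2-\tfrac{\beta^2}{\eta}k_2^3k_3,\;\;\tfrac{\beta^2}{\eta}k_2^2(k_1^2+k_2^2)\Big)}{4\Omega^2k_3^2|k|^2+(\beta^2/\eta)^2k_2^4}.$$ For $\alpha\in[-1,0]$ consider, for a real scalar $\theta$ of zero mean, the initial value problem $$\partial_t\theta+u\cdot\nabla\theta=0,\qquad u=(-\Delta)^{\alpha/2}\mathbf M\theta,\qquad \theta(\cdot,0)=\theta_0,\tag{$*$}$$ where $(-\Delta)^{\alpha/2}\mathbf M$ has symbol $|k|^\alpha\widehat{\mathbf M}(k)$ for $k\neq 0$ and $0$ for $k=0$. For $s\ge1$ and $\tau>0$ put $$\|\theta\|_{G^s_\tau}^2=\sum_{k\in\mathbb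 Z^3\setminus\{0\}}|k|^{2r}e^{2\tau|k|^{1/s}}|\widehat\theta(k)|^2,$$ where $\widehat\theta(k)=(2\pi)^{-3}\int_{\mathbb T^3}\theta(x)e^{-ik\cdot x}\,dx$; the Gevrey class $G^s$ consists of the smooth mean-zero real functions on $\mathbb T^3$ for which this norm is finite for some $\tau>0$. A solution in $G^s$ on $[0,T)$ is a function $\theta$ with $\theta(\cdot,0)=\theta_0$ and $\theta(\cdot,t)\in G^s$ for all $t\in[0,T)$ that satisfies $(*)$ pointwise on $[0,T)\times\mathbb T^3$ (with the one-sided time derivative at $t=0$) and that, for each $T'<T$, is bounded on $[0,T']$ in $G^s_\tau$ for some $\tau>0$ (which may depend on $T'$). 1. Let $\alpha\in(-1,0]$, $s\in[1,\frac1{\alpha+1}]$, $\tau_0>0$ and $K_0>0$. There is a time $T_*=T_*(\tau_0,K_0)>0$ (depending otherwise only on $\alpha,s,r,\Omega,\beta,\eta$) such that for every smooth mean-zero $\theta_0$ with $\|\theta_0\|_{G^s_{\tau_0}}\le K_0$, problem $(*)$ has a unique solution in $G^s$ on $[0,T_*)$. 2. For $\alpha=-1$ the same holds for every $s\ge1$.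 3. In particular, for $\alpha=0$ the non-diffusive magnetogeostrophic equation ($u=\mathbf M\theta$) is locally well-posed in the analytic class: for every real-analytic mean-zero $\theta_0$ on $\mathbb T^3$ there are $T>0$ and a unique solution in $G^1$ on $[0,T)$, and this solution is real-analytic in $x$ at every time $t\in[0,T)$. -/

import Mathlib

open scoped ContDiff ENNReal

noncomputable section

namespace MG

/-- The Euclidean length `|k|` of a wave vector `k ∈ ℤ³`. -/
def waveNorm (k : Fin 3 → ℤ) : ℝ := Real.sqrt (∑ i, (k i : ℝ) ^ 2)

/-- The phase `k · x`. -/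
def phase (k : Fin 3 → ℤ) (x : Fin 3 → ℝ) : ℝ := ∑ i, (k i : ℝ) * x i

/-- Functions on the torus `𝕋³ = [0,2π]³` are functions on `ℝ³` that are `2π`-periodic in each
variable. -/
def TorusPeriodic (f : (Fin 3 → ℝ) → ℝ) : Prop :=
  ∀ (x : Fin 3 → ℝ) (i : Fin 3), f (x + Pi.single i (2 * Real.pi)) = f x

/-- Fourier coefficient `(2π)⁻³ ∫_{[0,2π]³} f(x) e^{-i k·x} dx`. -/
def fourierCoeffT3 (f : (Fin 3 → ℝ) → ℝ) (k : Fin 3 → ℤ) : ℂ :=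
  ((2 * Real.pi : ℝ) : ℂ)⁻¹ ^ 3 *
    ∫ x in Set.Icc (0 : Fin 3 → ℝ) (fun _ => 2 * Real.pi),
      (f x : ℂ) * Complex.exp (-(Complex.I * (phase k x : ℂ)))

/-- Zero mean over the torus. -/
def MeanZero (f : (Fin 3 → ℝ) → ℝ) : Prop :=
  ∫ x in Set.Icc (0 : Fin 3 → ℝ) (fun _ => 2 * Real.pi), f x = 0

/-- The `G^s_τ`-norm
`(∑_{k ≠ 0} |k|^{2r} e^{2τ|k|^{1/s}} |f̂(k)|²)^{1/2}`, with values in `[0,∞]`. -/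
def gevreyNorm (r s τ : ℝ) (f : (Fin 3 → ℝ) → ℝ) : ℝ≥0∞ :=
  (∑' k : {k : Fin 3 → ℤ // k ≠ 0},
    ENNReal.ofReal (waveNorm k.1 ^ (2 * r) * Real.exp (2 * τ * waveNorm k.1 ^ (1 / s))
      * ‖fourierCoeffT3 f k.1‖ ^ 2)) ^ (1 / 2 : ℝ)

/-- Smooth, mean-zero scalar functions on the torus: the functions among which the Gevrey
classes are singled out by finiteness of the Gevrey norm. -/
structure SmoothMeanZero (f : (Fin 3 → ℝ) → ℝ) : Prop where
  smooth : ContDiff ℝ ∞ f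
  periodic : TorusPeriodic f
  mean_zero : MeanZero f

/-- The Fourier multiplier with scalar symbol `m` applied to `f`, as the Fourier series
`∑_k m(k) f̂(k) e^{i k·x}`. -/
def multiplierSeries (m : (Fin 3 → ℤ) → ℝ) (f : (Fin 3 → ℝ) → ℝ) (x : Fin 3 → ℝ) : ℂ :=
  ∑' k : Fin 3 → ℤ,
    (m k : ℂ) * fourierCoeffT3 f k * Complex.exp (Complex.I * (phase k x : ℂ))

/-- For a real even symbol the series is real (see `multiplierSeries_im`), so that taking the
real part only changes the type. -/
def multiplier (m : (Fin 3 → ℤ) → ℝ) (f : (Fin 3 → ℝ) → ℝ) (x : Fin 3 → ℝ) : ℝ :=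
  (multiplierSeries m f x).re

/-- The vector symbol of `𝐌`, zero on `{k₃ = 0}`. -/
def symbolM (Ω β η : ℝ) (k : Fin 3 → ℤ) : Fin 3 → ℝ :=
  let k₁ : ℝ := k 0
  let k₂ : ℝ := k 1
  let k₃ : ℝ := k 2
  let D : ℝ := 4 * Ω ^ 2 * k₃ ^ 2 * waveNorm k ^ 2 + (β ^ 2 / η) ^ 2 * k₂ ^ 4
  if k 2 = 0 then 0 else
    ![(2 * Ω * k₂ * k₃ * waveNorm k ^ 2 - (β ^ 2 / η) * k₁ * k₂ ^ 2 * k₃) / D,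
      (-2 * Ω * k₁ * k₃ * waveNorm k ^ 2 - (β ^ 2 / η) * k₂ ^ 3 * k₃) / D,
      ((β ^ 2 / η) * k₂ ^ 2 * (k₁ ^ 2 + k₂ ^ 2)) / D]

/-- The vector symbol `|k|^α 𝐌̂(k)` of `(-Δ)^{α/2} 𝐌`. -/
def symbolFracM (α Ω β η : ℝ) (k : Fin 3 → ℤ) : Fin 3 → ℝ :=
  fun j => waveNorm k ^ α * symbolM Ω β η k j

/-- The `j`-th partial derivative. -/
def partialDeriv (j : Fin 3) (f : (Fin 3 → ℝ) → ℝ) (x : Fin 3 → ℝ) : ℝ :=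
  fderiv ℝ f x (Pi.single j 1)

/-- `θ` is a solution in `G^s` on `[0,T)` of
`∂ₜθ + u·∇θ = 0`, `u = 𝐓θ`, `θ(·,0) = θ₀`, where `𝐓` has the vector symbol `m`:
on every `[0,T'] ⊆ [0,T)` it is bounded in `G^s_τ` for one radius `τ > 0`, and the equation holds
pointwise (with the one-sided time derivative at `t = 0`). -/
structure IsGevreySolution (m : (Fin 3 → ℤ) → Fin 3 → ℝ) (r s T : ℝ)
    (θ₀ : (Fin 3 → ℝ) → ℝ) (θ : ℝ → (Fin 3 → ℝ) → ℝ) : Prop where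
  initial : θ 0 = θ₀
  smooth : ∀ t ∈ Set.Ico 0 T, SmoothMeanZero (θ t)
  gevrey : ∀ T' ∈ Set.Ico 0 T, ∃ τ > 0, ∃ K : ℝ, ∀ t ∈ Set.Icc 0 T',
    gevreyNorm r s τ (θ t) ≤ ENNReal.ofReal K
  equation : ∀ t ∈ Set.Ico 0 T, ∀ x : Fin 3 → ℝ,
    HasDerivWithinAt (fun t' => θ t' x)
      (-∑ j, multiplier (fun k => m k j) (θ t) x * partialDeriv j (θ t) x) (Set.Ici 0) t

/-- There is a solution in `G^s` on `[0,T)` with initial datum `θ₀`, and it is the only one. -/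
def HasUniqueGevreySolution (m : (Fin 3 → ℤ) → Fin 3 → ℝ) (r s T : ℝ)
    (θ₀ : (Fin 3 → ℝ) → ℝ) : Prop :=
  ∃ θ : ℝ → (Fin 3 → ℝ) → ℝ, IsGevreySolution m r s T θ₀ θ ∧
    ∀ θ' : ℝ → (Fin 3 → ℝ) → ℝ, IsGevreySolution m r s T θ₀ θ' → Set.EqOn θ' θ (Set.Ico 0 T)

theorem waveNorm_neg (k : Fin 3 → ℤ) : waveNorm (-k) = waveNorm k := by
  simp [waveNorm]

theorem phase_neg (k : Fin 3 → ℤ) (x : Fin 3 → ℝ) : phase (-k) x = -phase k x := by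
  simp [phase, Finset.sum_neg_distrib]

theorem fourierCoeffT3_neg (f : (Fin 3 → ℝ) → ℝ) (k : Fin 3 → ℤ) :
    fourierCoeffT3 f (-k) = (starRingEnd ℂ) (fourierCoeffT3 f k) := by
  unfold fourierCoeffT3
  rw [map_mul, ← integral_conj]
  congr 1
  · rw [map_pow, map_inv₀, Complex.conj_ofReal]
  · congr 1
    funext x
    simp [phase_neg, ← Complex.exp_conj, Complex.conj_ofReal]

theorem symbolFracM_neg (α Ω β η : ℝ) (k : Fin 3 → ℤ) :
    symbolFracM α Ω β η (-k) = symbolFracM α Ω β η k := by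
  funext j
  unfold symbolFracM symbolM
  by_cases h : k 2 = 0
  · simp [h]
  · fin_cases j <;> simp [h, waveNorm_neg] <;> ring_nf <;> simp

theorem multiplierSeries_im (m : (Fin 3 → ℤ) → ℝ) (hm : ∀ k, m (-k) = m k)
    (f : (Fin 3 → ℝ) → ℝ) (x : Fin 3 → ℝ) : (multiplierSeries m f x).im = 0 := by
  rw [← Complex.conj_eq_iff_im]
  unfold multiplierSeries
  rw [Complex.conj_tsum, ← (Equiv.neg (Fin 3 → ℤ)).tsum_eq]
  congr 1
  funext k
  simp [hm, fourierCoeffT3_neg, phase_neg, ← Complex.exp_conj, Complex.conj_ofReal]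

end MG

end

/-!
On the Fourier side the equation reads `∂ₜ a = -B(a, a)`, where `B(a, b)` has the coefficients
`i ∑ⱼ (m(j) · (k - j)) aⱼ b_{k-j}`. The symbol `m` is even and divergence-free, and of order
`α + 1 ≤ σ`, where `σ = 1 / s`. Evenness and the absence of divergence make the transport operator
skew, so that in the energy `∑ |k|^{2p} e^{2τ|k|^σ} |a_k|²` only the commutator of the transport
operator with the weight survives. The commutator costs `|k|^{σ/2}` on each of two factors, that is,
a multiple of the energy with exponent `p + σ/2`. Letting the radius `τ` shrink linearly in time
produces a negative multiple of the same quantity, which absorbs it. The Galerkin truncations to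
boxes of wave vectors are therefore bounded uniformly on a time interval that depends only on the
size of the datum, and a pointwise limit of them along an ultrafilter solves the equation. The same
estimate, applied to the difference of two solutions, gives uniqueness.

The exponent `r` and the choice between `ℓ²` and `ℓ^∞` norms are immaterial: polynomial factors are
absorbed by an arbitrarily small loss of radius, so that a Gevrey bound amounts to decay
`|a_k| ≤ K e^{-ρ|k|^σ}`. For `σ = 1` this decay is equivalent to real-analyticity, by the Cauchy
estimates in one direction and by summing the power series of the modes in the other.
-/

noncomputable section

namespace MG

open Filter Topology ComplexConjugate MeasureTheory

local notation "ℤ³" => Fin 3 → ℤ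
local notation "ℝ³" => Fin 3 → ℝ

section Convolution

variable {G : Type*} [AddCommGroup G]

/-- The change of variables `(k, j) ↦ (j, k - j)`, which turns the index set of a convolution into
that of a product. -/
def convEquiv (G : Type*) [AddCommGroup G] : G × G ≃ G × G where
  toFun p := (p.2, p.1 - p.2)
  invFun q := (q.1 + q.2, q.1)
  left_inv p := by simp
  right_inv q := by simp

theorem summable_mul_conv {X Y : G → ℝ} (hX : Summable X) (hY : Summable Y)
    (hX0 : ∀ k, 0 ≤ X k) (hY0 : ∀ k, 0 ≤ Y k) :
    Summable fun p : G × G => X p.2 * Y (p.1 - p.2) :=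
  (convEquiv G).summable_iff.2 (hX.mul_of_nonneg hY hX0 hY0)

theorem tsum_mul_conv {X Y : G → ℝ} (hX : Summable X) (hY : Summable Y)
    (hX0 : ∀ k, 0 ≤ X k) (hY0 : ∀ k, 0 ≤ Y k) :
    ∑' p : G × G, X p.2 * Y (p.1 - p.2) = (∑' k, X k) * ∑' k, Y k := by
  rw [hX.tsum_mul_tsum hY (hX.mul_of_nonneg hY hX0 hY0)]
  exact (convEquiv G).tsum_eq fun q : G × G => X q.1 * Y q.2

theorem mul_mul_le_half_add_sq {p q x : ℝ} (hx : 0 ≤ x) :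
    p * q * x ≤ (p ^ 2 * x + x * q ^ 2) / 2 := by
  nlinarith [mul_nonneg hx (sq_nonneg (p - q))]

variable {X P Q : G → ℝ}

theorem summable_mul_mul_conv (hX : Summable X) (hP : Summable fun k => P k ^ 2)
    (hQ : Summable fun k => Q k ^ 2) (hX0 : ∀ k, 0 ≤ X k) (hP0 : ∀ k, 0 ≤ P k)
    (hQ0 : ∀ k, 0 ≤ Q k) :
    Summable fun p : G × G => P p.1 * Q (p.1 - p.2) * X p.2 :=
  (((hP.mul_of_nonneg hX (fun _ => sq_nonneg _) hX0).add
    (summable_mul_conv hX hQ hX0 fun _ => sq_nonneg _)).div_const 2).of_nonneg_of_le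
      (fun _ => mul_nonneg (mul_nonneg (hP0 _) (hQ0 _)) (hX0 _))
      fun p => mul_mul_le_half_add_sq (hX0 p.2)

theorem tsum_mul_mul_conv_le (hX : Summable X) (hP : Summable fun k => P k ^ 2)
    (hQ : Summable fun k => Q k ^ 2) (hX0 : ∀ k, 0 ≤ X k) (hP0 : ∀ k, 0 ≤ P k)
    (hQ0 : ∀ k, 0 ≤ Q k) :
    ∑' p : G × G, P p.1 * Q (p.1 - p.2) * X p.2 ≤
      (∑' k, X k) * ((∑' k, P k ^ 2) + ∑' k, Q k ^ 2) / 2 := by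
  have hPX : Summable fun p : G × G => P p.1 ^ 2 * X p.2 :=
    hP.mul_of_nonneg hX (fun _ => sq_nonneg _) hX0
  have hXQ := summable_mul_conv hX hQ hX0 fun _ => sq_nonneg _
  calc ∑' p : G × G, P p.1 * Q (p.1 - p.2) * X p.2
      ≤ ∑' p : G × G, (P p.1 ^ 2 * X p.2 + X p.2 * Q (p.1 - p.2) ^ 2) / 2 :=
        (summable_mul_mul_conv hX hP hQ hX0 hP0 hQ0).tsum_le_tsum
          (fun p => mul_mul_le_half_add_sq (hX0 p.2)) ((hPX.add hXQ).div_const 2)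
    _ = (∑' k, X k) * ((∑' k, P k ^ 2) + ∑' k, Q k ^ 2) / 2 := by
        rw [tsum_div_const, hPX.tsum_add hXQ, ← hP.tsum_mul_tsum hX hPX,
          tsum_mul_conv hX hQ hX0 fun _ => sq_nonneg _]
        ring

/-- The involution `(k, j) ↦ (k, k - j)`, which exchanges the two factors of a convolution. -/
def swapEquiv (G : Type*) [AddCommGroup G] : G × G ≃ G × G where
  toFun p := (p.1, p.1 - p.2)
  invFun p := (p.1, p.1 - p.2)
  left_inv p := by simp
  right_inv p := by simp

theorem mul_mul_conv_comp_swapEquiv (P Q X : G → ℝ) :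
    (fun p : G × G => P p.1 * Q (p.1 - p.2) * X p.2) ∘ swapEquiv G =
      fun p => P p.1 * X (p.1 - p.2) * Q p.2 := by
  funext p
  simp only [swapEquiv, Equiv.coe_fn_mk, Function.comp, sub_sub_cancel]
  ring

theorem summable_mul_mul_conv_swap (P Q X : G → ℝ) :
    (Summable fun p : G × G => P p.1 * X (p.1 - p.2) * Q p.2) ↔
      Summable fun p : G × G => P p.1 * Q (p.1 - p.2) * X p.2 := by
  rw [← mul_mul_conv_comp_swapEquiv, (swapEquiv G).summable_iff]

theorem tsum_mul_mul_conv_swap (P Q X : G → ℝ) :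
    ∑' p : G × G, P p.1 * X (p.1 - p.2) * Q p.2 = ∑' p : G × G, P p.1 * Q (p.1 - p.2) * X p.2 := by
  rw [← mul_mul_conv_comp_swapEquiv]
  exact (swapEquiv G).tsum_eq fun p : G × G => P p.1 * Q (p.1 - p.2) * X p.2

end Convolution

theorem waveNorm_nonneg (k : ℤ³) : 0 ≤ waveNorm k := Real.sqrt_nonneg _

theorem waveNorm_zero : waveNorm 0 = 0 := by simp [waveNorm]

theorem waveNorm_eq_norm (k : ℤ³) :
    waveNorm k = ‖WithLp.toLp 2 fun i => (k i : ℝ)‖ := by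
  simp [waveNorm, EuclideanSpace.norm_eq]

theorem waveNorm_add_le (j k : ℤ³) : waveNorm (j + k) ≤ waveNorm j + waveNorm k := by
  simp only [waveNorm_eq_norm]
  refine le_of_eq_of_le (congrArg norm ?_) (norm_add_le _ _)
  ext i
  simp

theorem waveNorm_sub_comm (j k : ℤ³) : waveNorm (j - k) = waveNorm (k - j) := by
  rw [← waveNorm_neg, neg_sub]

theorem waveNorm_sq (k : ℤ³) : waveNorm k ^ 2 = ∑ i, (k i : ℝ) ^ 2 :=
  Real.sq_sqrt (Finset.sum_nonneg fun _ _ => sq_nonneg _)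

theorem abs_coord_le_waveNorm (k : ℤ³) (i : Fin 3) : |(k i : ℝ)| ≤ waveNorm k :=
  Real.abs_le_sqrt <| Finset.single_le_sum (f := fun i => (k i : ℝ) ^ 2)
    (fun _ _ => sq_nonneg _) (Finset.mem_univ i)

theorem waveNorm_le_sum_abs (k : ℤ³) : waveNorm k ≤ ∑ i, |(k i : ℝ)| :=
  Real.sqrt_le_iff.2 ⟨Finset.sum_nonneg fun _ _ => abs_nonneg _, by
    simpa only [sq_abs] using
      Finset.sum_sq_le_sq_sum_of_nonneg fun i (_ : i ∈ Finset.univ) => abs_nonneg (k i : ℝ)⟩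

theorem one_le_waveNorm {k : ℤ³} (hk : k ≠ 0) : 1 ≤ waveNorm k := by
  obtain ⟨i, hi⟩ := Function.ne_iff.mp hk
  exact le_trans (mod_cast Int.one_le_abs hi) (abs_coord_le_waveNorm k i)

theorem summable_inv_waveNorm_pow {n : ℕ} (hn : 3 < n) :
    Summable fun k : ℤ³ => (waveNorm k ^ n)⁻¹ := by
  let b := (EuclideanSpace.basisFun (Fin 3) ℝ).toBasis
  let L := Submodule.span ℤ (Set.range b)
  let toLattice (k : ℤ³) : L := ⟨WithLp.toLp 2 fun i => (k i : ℝ), b.mem_span_iff_repr_mem ℤ _ |>.2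
    fun i => ⟨k i, by simp [b]⟩⟩
  have hinj : Function.Injective toLattice := fun j k h => by
    ext i
    simpa [toLattice] using congrArg (fun z : L => (z : EuclideanSpace ℝ (Fin 3)) i) h
  have hrank : Module.finrank ℤ L = 3 := by simp [ZLattice.rank ℝ L]
  have h := (ZLattice.summable_norm_zpow L (-n) (by rw [hrank]; lia)).comp_injective hinj
  exact h.congr fun k => by simp [toLattice, waveNorm_eq_norm]

theorem waveNorm_rpow_le_add {σ : ℝ} (hσ : 0 ≤ σ) (hσ1 : σ ≤ 1) (j k : ℤ³) :
    waveNorm k ^ σ ≤ waveNorm j ^ σ + waveNorm (k - j) ^ σ :=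
  calc waveNorm k ^ σ ≤ (waveNorm j + waveNorm (k - j)) ^ σ :=
        Real.rpow_le_rpow (waveNorm_nonneg k) (by simpa using waveNorm_add_le j (k - j)) hσ
    _ ≤ _ := Real.rpow_add_le_add_rpow (waveNorm_nonneg j) (waveNorm_nonneg _) hσ hσ1

theorem exists_pow_le_exp {σ ρ : ℝ} (hσ : 0 < σ) (hρ : 0 < ρ) (n : ℕ) :
    ∃ C : ℝ, 0 < C ∧ ∀ x : ℝ, 0 ≤ x → x ^ n ≤ C * Real.exp (ρ * x ^ σ) := by
  rcases n.eq_zero_or_pos with rfl | hn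
  · refine ⟨1, one_pos, fun x hx => ?_⟩
    simpa using mul_nonneg hρ.le (Real.rpow_nonneg hx σ)
  let c := ρ * σ / n
  have hc : 0 < c := by positivity
  refine ⟨(c ^ (n / σ))⁻¹, by positivity, fun x hx => ?_⟩
  have hxσ : 0 ≤ x ^ σ := Real.rpow_nonneg hx σ
  -- Raise `c x^σ ≤ e^{c x^σ}` to the power `n / σ`.
  have h : (c * x ^ σ) ^ (n / σ) ≤ Real.exp (c * x ^ σ) ^ (n / σ) := by
    refine Real.rpow_le_rpow (by positivity) ?_ (by positivity)
    linarith [Real.add_one_le_exp (c * x ^ σ)]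
  rw [Real.mul_rpow hc.le hxσ, ← Real.rpow_mul hx, ← Real.exp_mul,
    show σ * (n / σ) = n by field_simp, Real.rpow_natCast,
    show c * x ^ σ * (n / σ) = ρ * x ^ σ by simp only [c]; field_simp] at h
  rwa [inv_mul_eq_div, le_div_iff₀' (by positivity)]

/-- The exponential profile `e^{-ρ|k|^σ}` by which the decay of the Fourier coefficients of a
Gevrey function is measured. -/
def expDecay (σ ρ : ℝ) (k : ℤ³) : ℝ := Real.exp (-(ρ * waveNorm k ^ σ))

theorem expDecay_pos (σ ρ : ℝ) (k : ℤ³) : 0 < expDecay σ ρ k := Real.exp_pos _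

theorem expDecay_add (σ ρ ρ' : ℝ) (k : ℤ³) :
    expDecay σ (ρ + ρ') k = expDecay σ ρ k * expDecay σ ρ' k := by
  simp only [expDecay, ← Real.exp_add]
  ring_nf

theorem expDecay_anti {σ ρ ρ' : ℝ} (h : ρ ≤ ρ') (k : ℤ³) : expDecay σ ρ' k ≤ expDecay σ ρ k :=
  Real.exp_le_exp.2 <| neg_le_neg <|
    mul_le_mul_of_nonneg_right h (Real.rpow_nonneg (waveNorm_nonneg k) _)

theorem expDecay_mul_le {σ ρ : ℝ} (hσ : 0 ≤ σ) (hσ1 : σ ≤ 1) (hρ : 0 ≤ ρ) (j k : ℤ³) :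
    expDecay σ ρ j * expDecay σ ρ (k - j) ≤ expDecay σ ρ k := by
  simp only [expDecay, ← Real.exp_add]
  refine Real.exp_le_exp.2 ?_
  linarith [mul_le_mul_of_nonneg_left (waveNorm_rpow_le_add hσ hσ1 j k) hρ]

theorem exists_pow_mul_expDecay_le {σ ρ : ℝ} (hσ : 0 < σ) (hρ : 0 < ρ) (n : ℕ) :
    ∃ C : ℝ, 0 < C ∧ ∀ k, waveNorm k ^ n * expDecay σ ρ k ≤ C := by
  obtain ⟨C, hC, h⟩ := exists_pow_le_exp hσ hρ n
  refine ⟨C, hC, fun k => ?_⟩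
  rw [expDecay, Real.exp_neg, ← div_eq_mul_inv, div_le_iff₀ (Real.exp_pos _)]
  exact h _ (waveNorm_nonneg k)

theorem summable_pow_mul_expDecay {σ ρ : ℝ} (hσ : 0 < σ) (hρ : 0 < ρ) (n : ℕ) :
    Summable fun k : ℤ³ => waveNorm k ^ n * expDecay σ ρ k := by
  obtain ⟨C, -, hC⟩ := exists_pow_mul_expDecay_le hσ hρ (n + 4)
  refine .of_norm_bounded_eventually ((summable_inv_waveNorm_pow (by simp : 3 < 4)).mul_left C) ?_
  filter_upwards [(Set.finite_singleton (0 : ℤ³)).compl_mem_cofinite] with k hk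
  have hk0 : 0 < waveNorm k := one_pos.trans_le (one_le_waveNorm hk)
  rw [Real.norm_of_nonneg (mul_nonneg (pow_nonneg hk0.le _) (expDecay_pos _ _ _).le),
    ← div_eq_mul_inv, le_div_iff₀ (by positivity)]
  exact (by ring : _ = _).trans_le (hC k)

theorem summable_expDecay {σ ρ : ℝ} (hσ : 0 < σ) (hρ : 0 < ρ) : Summable (expDecay σ ρ) := by
  simpa using summable_pow_mul_expDecay hσ hρ 0

section RadialWeight

/-- The radial weight `x ^ n e^{τ x^σ}` of a Gevrey energy: evaluated at the length of a wave vector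
and multiplied by a Fourier coefficient, it measures Gevrey regularity of radius `τ`. -/
def radialWeight (n : ℕ) (σ τ x : ℝ) : ℝ := x ^ n * Real.exp (τ * x ^ σ)

variable {n p : ℕ} {σ τ x y v z b : ℝ}

theorem radialWeight_nonneg (hx : 0 ≤ x) : 0 ≤ radialWeight n σ τ x :=
  mul_nonneg (pow_nonneg hx _) (Real.exp_pos _).le

theorem radialWeight_mono (hσ : 0 ≤ σ) (hτ : 0 ≤ τ) (hx : 0 ≤ x) (hxy : x ≤ y) :
    radialWeight n σ τ x ≤ radialWeight n σ τ y := by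
  have hy : 0 ≤ y := hx.trans hxy
  unfold radialWeight
  gcongr

theorem radialWeight_add_exponent (n p : ℕ) (σ τ x : ℝ) :
    radialWeight (n + p) σ τ x = x ^ p * radialWeight n σ τ x := by
  rw [radialWeight, radialWeight, pow_add]
  ring

theorem hasDerivAt_radialWeight_succ (n : ℕ) (σ τ : ℝ) (hx : 0 < x) :
    HasDerivAt (radialWeight (n + 1) σ τ)
      ((n + 1 + τ * (σ * x ^ σ)) * radialWeight n σ τ x) x := by
  have hexp := ((Real.hasDerivAt_rpow_const (p := σ) (Or.inl hx.ne')).const_mul τ).exp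
  refine ((hasDerivAt_pow (n + 1) x).mul hexp).congr_deriv ?_
  rw [Real.rpow_sub_one hx.ne', radialWeight]
  simp only [Nat.cast_add, Nat.cast_one, Nat.add_sub_cancel]
  field_simp
  ring

theorem abs_radialWeight_succ_sub_le (hσ : 0 ≤ σ) (hσ1 : σ ≤ 1) (hτ : 0 ≤ τ) (hx : 1 ≤ x)
    (hxb : x ≤ b) (hy : 1 ≤ y) (hyb : y ≤ b) :
    |radialWeight (n + 1) σ τ x - radialWeight (n + 1) σ τ y| ≤
      (n + 1 + τ) * (b ^ σ * radialWeight n σ τ b) * |x - y| := by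
  refine (convex_Icc 1 b).norm_image_sub_le_of_norm_hasDerivWithin_le
    (fun z hz => (hasDerivAt_radialWeight_succ n σ τ (by linarith [hz.1])).hasDerivWithinAt)
    (fun z hz => ?_) ⟨hy, hyb⟩ ⟨hx, hxb⟩
  obtain ⟨hz1, hzb⟩ := hz
  have hz : 0 < z := by linarith
  have hb : 0 < b := by linarith
  have hzσ : 1 ≤ z ^ σ := Real.one_le_rpow hz1 hσ
  have hweight := radialWeight_mono (n := n) hσ hτ hz.le hzb
  have hweight0 : 0 ≤ radialWeight n σ τ z := radialWeight_nonneg hz.le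
  rw [Real.norm_of_nonneg (by positivity)]
  calc (n + 1 + τ * (σ * z ^ σ)) * radialWeight n σ τ z
      ≤ ((n + 1) * z ^ σ + τ * (1 * z ^ σ)) * radialWeight n σ τ z := by
        gcongr
        exact le_mul_of_one_le_right (by positivity) hzσ
    _ = (n + 1 + τ) * (z ^ σ * radialWeight n σ τ z) := by ring
    _ ≤ (n + 1 + τ) * (b ^ σ * radialWeight n σ τ b) := by gcongr

theorem rpow_le_rpow_add_rpow (hσ : 0 ≤ σ) (hσ1 : σ ≤ 1) (hx : 0 ≤ x) (hy : 0 ≤ y) (hz : 0 ≤ z)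
    (h : z ≤ x + y) : z ^ σ ≤ x ^ σ + y ^ σ :=
  (Real.rpow_le_rpow hz h hσ).trans (Real.rpow_add_le_add_rpow hx hy hσ hσ1)

theorem rpow_le_two_mul_rpow_mul_rpow (hσ : 0 ≤ σ) (hσ1 : σ ≤ 1) (hx : 1 ≤ x) (hy : 1 ≤ y)
    (hz : 0 ≤ z) (h : z ≤ x + y) : z ^ σ ≤ 2 * x ^ σ * y ^ σ := by
  have hxσ := Real.one_le_rpow hx hσ
  have hyσ := Real.one_le_rpow hy hσ
  nlinarith [rpow_le_rpow_add_rpow hσ hσ1 (by linarith) (by linarith) hz h]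

theorem rpow_half_mul_self (hx : 0 < x) : x ^ (σ / 2) * x ^ (σ / 2) = x ^ σ := by
  rw [← Real.rpow_add hx, add_halves]

theorem rpow_le_self (hσ1 : σ ≤ 1) (hx : 1 ≤ x) : x ^ σ ≤ x := by
  simpa using Real.rpow_le_rpow_of_exponent_le hx hσ1

theorem exp_mul_rpow_le_of_le_add (hσ : 0 ≤ σ) (hσ1 : σ ≤ 1) (hτ : 0 ≤ τ) (hx : 0 ≤ x) (hy : 0 ≤ y)
    (hz : 0 ≤ z) (h : z ≤ x + y) :
    Real.exp (τ * z ^ σ) ≤ Real.exp (τ * x ^ σ) * Real.exp (τ * y ^ σ) := by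
  rw [← Real.exp_add, ← mul_add]
  gcongr
  exact rpow_le_rpow_add_rpow hσ hσ1 hx hy hz h

theorem radialWeight_le_of_le_add (hσ : 0 ≤ σ) (hσ1 : σ ≤ 1) (hτ : 0 ≤ τ) (hx : 0 ≤ x)
    (hxy : x ≤ y) (hz : 0 ≤ z) (h : z ≤ x + y) :
    radialWeight n σ τ z ≤ 2 ^ n * (radialWeight 0 σ τ x * radialWeight n σ τ y) := by
  have hy : 0 ≤ y := hx.trans hxy
  unfold radialWeight
  calc z ^ n * Real.exp (τ * z ^ σ)
      ≤ (2 * y) ^ n * (Real.exp (τ * x ^ σ) * Real.exp (τ * y ^ σ)) := by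
        gcongr
        · linarith
        · exact exp_mul_rpow_le_of_le_add hσ hσ1 hτ hx hy hz h
    _ = _ := by ring

theorem radialWeight_le_mul (hσ : 0 ≤ σ) (hσ1 : σ ≤ 1) (hτ : 0 ≤ τ) (hx : 1 ≤ x) (hy : 1 ≤ y)
    (hz : 0 ≤ z) (h : z ≤ x + y) :
    radialWeight n σ τ z ≤ 2 ^ n * (radialWeight n σ τ x * radialWeight n σ τ y) := by
  have hzxy : z ≤ 2 * (x * y) := by nlinarith
  unfold radialWeight
  calc z ^ n * Real.exp (τ * z ^ σ)
      ≤ (2 * (x * y)) ^ n * (Real.exp (τ * x ^ σ) * Real.exp (τ * y ^ σ)) := by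
        gcongr
        exact exp_mul_rpow_le_of_le_add hσ hσ1 hτ (by linarith) (by linarith) hz h
    _ = _ := by ring

theorem mul_rpow_mul_rpow_half_le (hσ : 0 ≤ σ) (hσ1 : σ ≤ 1) (hx : 1 ≤ x) (hv : 1 ≤ v)
    (hy : 0 ≤ y) (hyxv : y ≤ x + v) :
    x * x ^ σ * y ^ (σ / 2) ≤ 2 * x ^ 3 * v ^ (σ / 2) :=
  calc x * x ^ σ * y ^ (σ / 2)
      ≤ x * x * (2 * x ^ (σ / 2) * v ^ (σ / 2)) := by
        gcongr
        · exact rpow_le_self hσ1 hx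
        · exact rpow_le_two_mul_rpow_mul_rpow (by linarith) (by linarith) hx hv hy hyxv
    _ ≤ x * x * (2 * x * v ^ (σ / 2)) := by
        gcongr
        exact rpow_le_self (by linarith) hx
    _ = 2 * x ^ 3 * v ^ (σ / 2) := by ring

theorem radialWeight_commutator_le_of_le (hσ : 0 ≤ σ) (hσ1 : σ ≤ 1) (hτ : 0 ≤ τ) (hx : 1 ≤ x)
    (hv : 1 ≤ v) (hvxy : v ≤ x + y) (hyxv : y ≤ x + v) (hxy : x ≤ y) :
    y * x ^ σ * |radialWeight (p + 3) σ τ v - radialWeight (p + 3) σ τ y| ≤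
      2 ^ (p + 4) * (p + 3 + τ) * (radialWeight (p + 3) σ τ x * radialWeight (p + 3) σ τ y) *
        v ^ (σ / 2) * (y ^ (σ / 2) * (x ^ p)⁻¹) := by
  have hx0 : 0 < x := by linarith
  have hy0 : 0 < y := by linarith
  have hdiff := abs_radialWeight_succ_sub_le (n := p + 2) hσ hσ1 hτ hv hvxy (hx.trans hxy)
    (by linarith : y ≤ x + y)
  have hdist : |v - y| ≤ x := abs_le.2 ⟨by linarith, by linarith⟩
  have hsum : (x + y) ^ σ ≤ 2 * y ^ σ := by
    linarith [Real.rpow_add_le_add_rpow hx0.le hy0.le hσ hσ1, Real.rpow_le_rpow hx0.le hxy hσ]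
  have hweight := radialWeight_le_of_le_add (n := p + 2) hσ hσ1 hτ hx0.le hxy (by linarith)
    (le_refl (x + y))
  have hcoef := mul_rpow_mul_rpow_half_le hσ hσ1 hx hv hy0.le hyxv
  have hW0 : 0 ≤ radialWeight 0 σ τ x := radialWeight_nonneg hx0.le
  have hWy : 0 ≤ radialWeight (p + 2) σ τ y := radialWeight_nonneg hy0.le
  have hWb : 0 ≤ radialWeight (p + 2) σ τ (x + y) := radialWeight_nonneg (by linarith)
  push_cast at hdiff
  calc y * x ^ σ * |radialWeight (p + 3) σ τ v - radialWeight (p + 3) σ τ y|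
      ≤ y * x ^ σ * ((p + 2 + 1 + τ) * ((x + y) ^ σ * radialWeight (p + 2) σ τ (x + y)) *
          |v - y|) := by gcongr
    _ ≤ y * x ^ σ * ((p + 2 + 1 + τ) * (2 * y ^ σ *
          (2 ^ (p + 2) * (radialWeight 0 σ τ x * radialWeight (p + 2) σ τ y))) * x) := by gcongr
    _ = 2 ^ (p + 3) * (p + 3 + τ) * (radialWeight 0 σ τ x * (y * radialWeight (p + 2) σ τ y)) *
          y ^ (σ / 2) * (x * x ^ σ * y ^ (σ / 2)) := by
        rw [← rpow_half_mul_self (σ := σ) hy0]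
        ring
    _ ≤ 2 ^ (p + 3) * (p + 3 + τ) * (radialWeight 0 σ τ x * (y * radialWeight (p + 2) σ τ y)) *
          y ^ (σ / 2) * (2 * x ^ 3 * v ^ (σ / 2)) := by gcongr
    _ = _ := by
        rw [radialWeight_add_exponent (p + 2) 1 σ τ y, add_comm p 3,
          radialWeight_add_exponent 3 p σ τ x, ← zero_add 3, radialWeight_add_exponent 0 3 σ τ x]
        field_simp
        ring

theorem radialWeight_commutator_le_of_ge (hσ : 0 ≤ σ) (hσ1 : σ ≤ 1) (hτ : 0 ≤ τ) (hy : 1 ≤ y)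
    (hv : 1 ≤ v) (hvxy : v ≤ x + y) (hxvy : x ≤ v + y) (hyx : y ≤ x) :
    y * x ^ σ * |radialWeight (p + 3) σ τ v - radialWeight (p + 3) σ τ y| ≤
      2 ^ (p + 4) * (radialWeight (p + 3) σ τ x * radialWeight (p + 3) σ τ y) *
        v ^ (σ / 2) * (x ^ (σ / 2) * (y ^ p)⁻¹) := by
  have hx0 : 0 < x := by linarith
  have hy0 : 0 < y := by linarith
  have hv0 : 0 < v := by linarith
  have hbound {z : ℝ} (hz : 0 ≤ z) (h : z ≤ x + y) : radialWeight (p + 3) σ τ z ≤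
      2 ^ (p + 3) * (radialWeight 0 σ τ y * radialWeight (p + 3) σ τ x) :=
    radialWeight_le_of_le_add hσ hσ1 hτ hy0.le hyx hz (by linarith)
  have hdiff := abs_sub_le_of_nonneg_of_le (radialWeight_nonneg hv0.le) (hbound hv0.le hvxy)
    (radialWeight_nonneg hy0.le) (hbound hy0.le (by linarith))
  have hcoef : y * x ^ (σ / 2) ≤ 2 * y ^ 3 * v ^ (σ / 2) :=
    calc y * x ^ (σ / 2)
        ≤ y * (2 * v ^ (σ / 2) * y ^ (σ / 2)) := by
          gcongr
          exact rpow_le_two_mul_rpow_mul_rpow (by linarith) (by linarith) hv hy hx0.le hxvy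
      _ ≤ y * (2 * v ^ (σ / 2) * y ^ 2) := by
          gcongr
          exact (rpow_le_self (by linarith) hy).trans (by nlinarith)
      _ = 2 * y ^ 3 * v ^ (σ / 2) := by ring
  have hW0 : 0 ≤ radialWeight 0 σ τ y := radialWeight_nonneg hy0.le
  have hWx : 0 ≤ radialWeight (p + 3) σ τ x := radialWeight_nonneg hx0.le
  calc y * x ^ σ * |radialWeight (p + 3) σ τ v - radialWeight (p + 3) σ τ y|
      ≤ y * x ^ σ * (2 ^ (p + 3) * (radialWeight 0 σ τ y * radialWeight (p + 3) σ τ x)) := by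
        gcongr
    _ = 2 ^ (p + 3) * (radialWeight 0 σ τ y * radialWeight (p + 3) σ τ x) * x ^ (σ / 2) *
          (y * x ^ (σ / 2)) := by
        rw [← rpow_half_mul_self (σ := σ) hx0]
        ring
    _ ≤ 2 ^ (p + 3) * (radialWeight 0 σ τ y * radialWeight (p + 3) σ τ x) * x ^ (σ / 2) *
          (2 * y ^ 3 * v ^ (σ / 2)) := by gcongr
    _ = _ := by
        rw [add_comm p 3, radialWeight_add_exponent 3 p σ τ y, ← zero_add 3,
          radialWeight_add_exponent 0 3 σ τ y]
        field_simp
        ring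

theorem radialWeight_commutator_le (hσ : 0 ≤ σ) (hσ1 : σ ≤ 1) (hτ : 0 ≤ τ) (hx : 1 ≤ x)
    (hy : 1 ≤ y) (hv : 1 ≤ v) (hvxy : v ≤ x + y) (hxvy : x ≤ v + y) (hyxv : y ≤ x + v) :
    y * x ^ σ * |radialWeight (p + 3) σ τ v - radialWeight (p + 3) σ τ y| ≤
      2 ^ (p + 4) * (p + 3 + τ) * (radialWeight (p + 3) σ τ x * radialWeight (p + 3) σ τ y) *
        v ^ (σ / 2) * (y ^ (σ / 2) * (x ^ p)⁻¹ + x ^ (σ / 2) * (y ^ p)⁻¹) := by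
  have hx0 : 0 < x := by linarith
  have hy0 : 0 < y := by linarith
  have hWx : 0 ≤ radialWeight (p + 3) σ τ x := radialWeight_nonneg hx0.le
  have hWy : 0 ≤ radialWeight (p + 3) σ τ y := radialWeight_nonneg hy0.le
  rcases le_total x y with hxy | hyx
  · refine (radialWeight_commutator_le_of_le hσ hσ1 hτ hx hv hvxy hyxv hxy).trans ?_
    gcongr
    exact le_add_of_nonneg_right (by positivity)
  · refine (radialWeight_commutator_le_of_ge hσ hσ1 hτ hy hv hvxy hxvy hyx).trans ?_
    gcongr
    · exact le_mul_of_one_le_right (by positivity) (by linarith [p.cast_nonneg (α := ℝ)])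
    · exact le_add_of_nonneg_left (by positivity)

end RadialWeight

theorem waveNorm_le_add_sub (j k : ℤ³) : waveNorm k ≤ waveNorm j + waveNorm (k - j) := by
  simpa using waveNorm_add_le j (k - j)

theorem waveNorm_le_add_sub' (j k : ℤ³) : waveNorm j ≤ waveNorm k + waveNorm (k - j) := by
  simpa only [waveNorm_sub_comm j k] using waveNorm_le_add_sub k j

theorem waveNorm_sub_le (j k : ℤ³) : waveNorm (k - j) ≤ waveNorm j + waveNorm k := by
  simpa [waveNorm_neg, sub_eq_neg_add] using waveNorm_add_le (-j) k

theorem waveNorm_rpow_le_self {σ : ℝ} (hσ : 0 < σ) (hσ1 : σ ≤ 1) (k : ℤ³) :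
    waveNorm k ^ σ ≤ waveNorm k := by
  rcases eq_or_ne k 0 with rfl | hk
  · simp [waveNorm_zero, Real.zero_rpow hσ.ne']
  · exact rpow_le_self hσ1 (one_le_waveNorm hk)

theorem summable_mul_of_nonneg {ι : Type*} {f g : ι → ℝ} (hf : Summable f) (hg : Summable g)
    (hf0 : ∀ i, 0 ≤ f i) (hg0 : ∀ i, 0 ≤ g i) : Summable fun i => f i * g i :=
  (hf.mul_of_nonneg hg hf0 hg0).comp_injective
    (i := fun i => (i, i)) fun _ _ h => congrArg Prod.fst h

section GevreyWeight

/-- The weight `|k|^p e^{τ|k|^σ}` on wave vectors. With `σ = 1 / s` and `p = r` its square is the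
weight of the norm of `G^s_τ`. -/
def gevreyWeight (p σ τ : ℝ) (k : ℤ³) : ℝ := waveNorm k ^ p * Real.exp (τ * waveNorm k ^ σ)

variable {p q σ τ : ℝ} {j k : ℤ³}

theorem gevreyWeight_nonneg (p σ τ : ℝ) (k : ℤ³) : 0 ≤ gevreyWeight p σ τ k :=
  mul_nonneg (Real.rpow_nonneg (waveNorm_nonneg k) _) (Real.exp_pos _).le

theorem gevreyWeight_zero (hp : p ≠ 0) : gevreyWeight p σ τ 0 = 0 := by
  simp [gevreyWeight, waveNorm_zero, Real.zero_rpow hp]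

theorem gevreyWeight_ofNat (n : ℕ) [n.AtLeastTwo] (σ τ : ℝ) (k : ℤ³) :
    gevreyWeight ofNat(n) σ τ k = radialWeight ofNat(n) σ τ (waveNorm k) := by
  rw [gevreyWeight, radialWeight, Real.rpow_ofNat]

theorem gevreyWeight_add (hk : k ≠ 0) (p q σ τ : ℝ) :
    gevreyWeight (p + q) σ τ k = waveNorm k ^ q * gevreyWeight p σ τ k := by
  rw [gevreyWeight, gevreyWeight, Real.rpow_add (one_pos.trans_le (one_le_waveNorm hk))]
  ring

theorem gevreyWeight_mono (hp : 0 < p) (hpq : p ≤ q) :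
    gevreyWeight p σ τ k ≤ gevreyWeight q σ τ k := by
  rcases eq_or_ne k 0 with rfl | hk
  · rw [gevreyWeight_zero hp.ne', gevreyWeight_zero (hp.trans_le hpq).ne']
  · exact mul_le_mul_of_nonneg_right
      (Real.rpow_le_rpow_of_exponent_le (one_le_waveNorm hk) hpq) (Real.exp_pos _).le

theorem gevreyWeight_mul_expDecay (p σ τ ρ : ℝ) (k : ℤ³) :
    gevreyWeight p σ τ k * expDecay σ ρ k = waveNorm k ^ p * expDecay σ (ρ - τ) k := by
  rw [gevreyWeight, expDecay, expDecay, mul_assoc, ← Real.exp_add]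
  ring_nf

theorem one_le_gevreyWeight_mul_expDecay {ρ : ℝ} (hp : 0 ≤ p) (h : ρ ≤ τ) (hk : k ≠ 0) :
    1 ≤ gevreyWeight p σ τ k * expDecay σ ρ k := by
  rw [gevreyWeight_mul_expDecay]
  refine one_le_mul_of_one_le_of_one_le (Real.one_le_rpow (one_le_waveNorm hk) hp) ?_
  refine Real.one_le_exp (neg_nonneg.2 ?_)
  exact mul_nonpos_of_nonpos_of_nonneg (sub_nonpos.2 h) (Real.rpow_nonneg (waveNorm_nonneg k) _)

theorem sq_gevreyWeight_add_half (hp : 0 < p) (hpσ : p + σ / 2 ≠ 0) (k : ℤ³) :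
    gevreyWeight (p + σ / 2) σ τ k ^ 2 = waveNorm k ^ σ * gevreyWeight p σ τ k ^ 2 := by
  rcases eq_or_ne k 0 with rfl | hk
  · simp [gevreyWeight_zero, hpσ, hp.ne']
  · rw [gevreyWeight_add hk, mul_pow, sq (_ ^ _),
      rpow_half_mul_self (one_pos.trans_le (one_le_waveNorm hk))]

theorem gevreyWeight_three (σ τ : ℝ) (k : ℤ³) :
    gevreyWeight 3 σ τ k = (waveNorm k ^ 4)⁻¹ * gevreyWeight 7 σ τ k := by
  rcases eq_or_ne k 0 with rfl | hk
  · simp [gevreyWeight_zero]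
  · have := one_pos.trans_le (one_le_waveNorm hk)
    rw [(by norm_num : (7 : ℝ) = 3 + 4), gevreyWeight_add hk, Real.rpow_ofNat,
      inv_mul_cancel_left₀ (by positivity)]

theorem gevreyWeight_commutator_le (hσ : 0 ≤ σ) (hσ1 : σ ≤ 1) (hτ : 0 ≤ τ) (hj : j ≠ 0)
    (hk : k ≠ 0) (hkj : k - j ≠ 0) :
    waveNorm (k - j) * waveNorm j ^ σ * |gevreyWeight 7 σ τ k - gevreyWeight 7 σ τ (k - j)| ≤
      2 ^ 8 * (7 + τ) * waveNorm k ^ (σ / 2) *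
        (gevreyWeight 3 σ τ j * gevreyWeight (7 + σ / 2) σ τ (k - j) +
          gevreyWeight (7 + σ / 2) σ τ j * gevreyWeight 3 σ τ (k - j)) := by
  have h := radialWeight_commutator_le (p := 4) hσ hσ1 hτ (one_le_waveNorm hj)
    (one_le_waveNorm hkj) (one_le_waveNorm hk) (waveNorm_le_add_sub j k)
    (waveNorm_le_add_sub' j k) (waveNorm_sub_le j k)
  simp only [Nat.reduceAdd, ← gevreyWeight_ofNat] at h
  refine h.trans_eq ?_
  rw [gevreyWeight_three, gevreyWeight_three, gevreyWeight_add hj, gevreyWeight_add hkj]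
  push_cast
  ring

theorem gevreyWeight_le_mul (hσ : 0 ≤ σ) (hσ1 : σ ≤ 1) (hτ : 0 ≤ τ) (hj : j ≠ 0)
    (hkj : k - j ≠ 0) :
    gevreyWeight 7 σ τ k ≤ 2 ^ 7 * (gevreyWeight 7 σ τ j * gevreyWeight 7 σ τ (k - j)) := by
  simpa only [gevreyWeight_ofNat] using radialWeight_le_mul (n := 7) hσ hσ1 hτ
    (one_le_waveNorm hj) (one_le_waveNorm hkj) (waveNorm_nonneg k) (waveNorm_le_add_sub j k)

end GevreyWeight

section HasDecay

/-- Exponential decay `|a_k| ≤ K e^{-ρ|k|^σ}` of a sequence of Fourier coefficients. -/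
def HasDecay (σ ρ K : ℝ) (a : ℤ³ → ℂ) : Prop := ∀ k, ‖a k‖ ≤ K * expDecay σ ρ k

/-- The size `|k|^p e^{τ|k|^σ} |a_k|` of a weighted Fourier coefficient. -/
def weightedCoeff (p σ τ : ℝ) (a : ℤ³ → ℂ) (k : ℤ³) : ℝ := gevreyWeight p σ τ k * ‖a k‖

variable {p q σ ρ ρ' τ K K' : ℝ} {a b : ℤ³ → ℂ}

theorem HasDecay.nonneg (h : HasDecay σ ρ K a) : 0 ≤ K :=
  nonneg_of_mul_nonneg_left ((norm_nonneg _).trans (h 0)) (expDecay_pos σ ρ 0)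

theorem HasDecay.mono (h : HasDecay σ ρ K a) (hρ : ρ' ≤ ρ) (hK : K ≤ K') : HasDecay σ ρ' K' a :=
  fun k => (h k).trans
    (mul_le_mul hK (expDecay_anti hρ k) (expDecay_pos _ _ _).le (h.nonneg.trans hK))

theorem HasDecay.add (ha : HasDecay σ ρ K a) (hb : HasDecay σ ρ K' b) :
    HasDecay σ ρ (K + K') (a + b) := fun k => by
  rw [add_mul]
  exact (norm_add_le _ _).trans (add_le_add (ha k) (hb k))

theorem HasDecay.sub (ha : HasDecay σ ρ K a) (hb : HasDecay σ ρ K' b) :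
    HasDecay σ ρ (K + K') (a - b) := fun k => by
  rw [add_mul]
  exact (norm_sub_le _ _).trans (add_le_add (ha k) (hb k))

theorem HasDecay.summable_pow_mul (h : HasDecay σ ρ K a) (hσ : 0 < σ) (hρ : 0 < ρ) (n : ℕ) :
    Summable fun k => waveNorm k ^ n * ‖a k‖ :=
  ((summable_pow_mul_expDecay hσ hρ n).mul_left K).of_nonneg_of_le
    (fun k => mul_nonneg (pow_nonneg (waveNorm_nonneg k) _) (norm_nonneg _)) fun k => by
      rw [mul_left_comm]
      exact mul_le_mul_of_nonneg_left (h k) (pow_nonneg (waveNorm_nonneg k) _)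

theorem exists_hasDecay_of_finite (σ ρ : ℝ) {F : Finset ℤ³} (ha : ∀ k ∉ F, a k = 0) :
    ∃ K, HasDecay σ ρ K a := by
  have h0 : ∀ k ∈ F, 0 ≤ ‖a k‖ / expDecay σ ρ k :=
    fun k _ => div_nonneg (norm_nonneg _) (expDecay_pos _ _ _).le
  refine ⟨∑ k ∈ F, ‖a k‖ / expDecay σ ρ k, fun k => ?_⟩
  by_cases hk : k ∈ F
  · rw [← div_le_iff₀ (expDecay_pos _ _ _)]
    exact Finset.single_le_sum h0 hk
  · rw [ha k hk, norm_zero]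
    exact mul_nonneg (Finset.sum_nonneg h0) (expDecay_pos _ _ _).le

theorem weightedCoeff_nonneg (p σ τ : ℝ) (a : ℤ³ → ℂ) (k : ℤ³) : 0 ≤ weightedCoeff p σ τ a k :=
  mul_nonneg (gevreyWeight_nonneg _ _ _ _) (norm_nonneg _)

theorem weightedCoeff_mono (hp : 0 < p) (hpq : p ≤ q) (a : ℤ³ → ℂ) (k : ℤ³) :
    weightedCoeff p σ τ a k ≤ weightedCoeff q σ τ a k :=
  mul_le_mul_of_nonneg_right (gevreyWeight_mono hp hpq) (norm_nonneg _)

theorem HasDecay.weightedCoeff_le (h : HasDecay σ ρ K a) (p τ : ℝ) (k : ℤ³) :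
    weightedCoeff p σ τ a k ≤ K * (waveNorm k ^ p * expDecay σ (ρ - τ) k) := by
  rw [weightedCoeff, ← gevreyWeight_mul_expDecay, mul_left_comm]
  exact mul_le_mul_of_nonneg_left (h k) (gevreyWeight_nonneg _ _ _ _)

theorem summable_rpow_mul_expDecay (hσ : 0 < σ) (hρ : 0 < ρ) (hp : 0 < p) :
    Summable fun k : ℤ³ => waveNorm k ^ p * expDecay σ ρ k := by
  refine (summable_pow_mul_expDecay hσ hρ ⌈p⌉₊).of_nonneg_of_le (fun k => mul_nonneg
    (Real.rpow_nonneg (waveNorm_nonneg k) _) (expDecay_pos _ _ _).le) fun k => ?_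
  refine mul_le_mul_of_nonneg_right ?_ (expDecay_pos _ _ _).le
  rcases eq_or_ne k 0 with rfl | hk
  · simp [waveNorm_zero, Real.zero_rpow hp.ne']
  · rw [← Real.rpow_natCast]
    exact Real.rpow_le_rpow_of_exponent_le (one_le_waveNorm hk) (Nat.le_ceil p)

theorem HasDecay.summable_weightedCoeff (h : HasDecay σ ρ K a) (hσ : 0 < σ) (hp : 0 < p)
    (hτ : τ < ρ) : Summable (weightedCoeff p σ τ a) :=
  ((summable_rpow_mul_expDecay hσ (sub_pos.2 hτ) hp).mul_left K).of_nonneg_of_le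
    (weightedCoeff_nonneg _ _ _ _) (h.weightedCoeff_le p τ)

theorem HasDecay.summable_sq_weightedCoeff (h : HasDecay σ ρ K a) (hσ : 0 < σ) (hp : 0 < p)
    (hτ : τ < ρ) : Summable fun k => weightedCoeff p σ τ a k ^ 2 := by
  have hcoeff := h.summable_weightedCoeff hσ hp hτ
  have hnonneg := weightedCoeff_nonneg p σ τ a
  simpa only [sq] using summable_mul_of_nonneg hcoeff hcoeff hnonneg hnonneg

theorem HasDecay.tsum_weightedCoeff_le {τ₁ : ℝ} (h : HasDecay σ ρ K a) (hσ : 0 < σ) (hp : 0 < p)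
    (hτ : τ ≤ τ₁) (hτ₁ : τ₁ < ρ) :
    ∑' k, weightedCoeff p σ τ a k ≤ K * ∑' k, waveNorm k ^ p * expDecay σ (ρ - τ₁) k := by
  rw [← tsum_mul_left]
  refine (h.summable_weightedCoeff hσ hp (hτ.trans_lt hτ₁)).tsum_le_tsum (fun k => ?_)
    ((summable_rpow_mul_expDecay hσ (sub_pos.2 hτ₁) hp).mul_left K)
  refine (h.weightedCoeff_le p τ k).trans (mul_le_mul_of_nonneg_left ?_ h.nonneg)
  exact mul_le_mul_of_nonneg_left (expDecay_anti (by linarith) k)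
    (Real.rpow_nonneg (waveNorm_nonneg k) _)

end HasDecay

section Pairing

/-- The pairing `m(j) · l` of a vector symbol with a wave vector. -/
def symDot (m : ℤ³ → Fin 3 → ℝ) (j l : ℤ³) : ℝ := ∑ i, m j i * (l i : ℝ)

/-- A real, even, divergence-free vector symbol of order `σ ∈ (0, 1]`: the velocity field with
coefficients `m(j) a_j` of a real function is real, has zero divergence and costs at most `σ`
derivatives. -/
structure IsTransportSymbol (σ M : ℝ) (m : ℤ³ → Fin 3 → ℝ) : Prop where
  pos : 0 < σ
  le_one : σ ≤ 1
  nonneg : 0 ≤ M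
  even : ∀ k, m (-k) = m k
  div_free : ∀ k, symDot m k k = 0
  bound : ∀ k l, |symDot m k l| ≤ M * waveNorm k ^ σ * waveNorm l

/-- The `(k, j)` term of the Fourier coefficients of `u · ∇b`, where `u` is the velocity of `a`. -/
def transportTerm (m : ℤ³ → Fin 3 → ℝ) (a b : ℤ³ → ℂ) (k j : ℤ³) : ℂ :=
  Complex.I * (symDot m j k : ℂ) * a j * b (k - j)

/-- The terms of the real `ℓ²` pairing of `u · ∇b` with `c`, where `u` is the velocity of `a`. -/
def pairingTerm (m : ℤ³ → Fin 3 → ℝ) (a b c : ℤ³ → ℂ) (p : ℤ³ × ℤ³) : ℝ :=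
  (conj (c p.1) * transportTerm m a b p.1 p.2).re

/-- Sequences of Fourier coefficients of real functions. -/
def Hermitian (a : ℤ³ → ℂ) : Prop := ∀ k, a (-k) = conj (a k)

variable {σ M τ ρ K K' : ℝ} {m : ℤ³ → Fin 3 → ℝ} {a b : ℤ³ → ℂ} {j k : ℤ³}

theorem symDot_sub (m : ℤ³ → Fin 3 → ℝ) (j k l : ℤ³) :
    symDot m j (k - l) = symDot m j k - symDot m j l := by
  simp [symDot, mul_sub, Finset.sum_sub_distrib]

theorem IsTransportSymbol.symDot_sub_self (hm : IsTransportSymbol σ M m) (j k : ℤ³) :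
    symDot m j (k - j) = symDot m j k := by
  rw [symDot_sub, hm.div_free, sub_zero]

theorem IsTransportSymbol.abs_symDot_le (hm : IsTransportSymbol σ M m) (j k : ℤ³) :
    |symDot m j k| ≤ M * waveNorm j ^ σ * waveNorm (k - j) := by
  rw [← hm.symDot_sub_self]
  exact hm.bound _ _

theorem IsTransportSymbol.symDot_eq_zero (hm : IsTransportSymbol σ M m)
    (h : j = 0 ∨ k - j = 0) : symDot m j k = 0 := by
  refine abs_nonpos_iff.1 ((hm.abs_symDot_le j k).trans_eq ?_)
  rcases h with h | h <;> simp [h, waveNorm_zero, Real.zero_rpow hm.pos.ne']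

theorem norm_transportTerm (m : ℤ³ → Fin 3 → ℝ) (a b : ℤ³ → ℂ) (k j : ℤ³) :
    ‖transportTerm m a b k j‖ = |symDot m j k| * ‖a j‖ * ‖b (k - j)‖ := by
  simp [transportTerm]

theorem abs_pairingTerm_le (m : ℤ³ → Fin 3 → ℝ) (a b c : ℤ³ → ℂ) (p : ℤ³ × ℤ³) :
    |pairingTerm m a b c p| ≤ |symDot m p.2 p.1| * (‖c p.1‖ * ‖b (p.1 - p.2)‖ * ‖a p.2‖) := by
  refine (Complex.abs_re_le_norm _).trans (le_of_eq ?_)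
  rw [norm_mul, norm_transportTerm, RCLike.norm_conj]
  ring

theorem IsTransportSymbol.abs_pairingTerm_le (hm : IsTransportSymbol σ M m) (a b c : ℤ³ → ℂ)
    (p : ℤ³ × ℤ³) :
    |pairingTerm m a b c p| ≤ M * waveNorm p.2 ^ σ * waveNorm (p.1 - p.2) *
      (‖c p.1‖ * ‖b (p.1 - p.2)‖ * ‖a p.2‖) :=
  (MG.abs_pairingTerm_le m a b c p).trans
    (mul_le_mul_of_nonneg_right (hm.abs_symDot_le _ _) (by positivity))

/-- The involution `(k, j) ↦ (k - j, -j)`, which exchanges the wave vectors of the two factors `b`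
in the pairing of `u · ∇b` with `b`. -/
def flipEquiv (G : Type*) [AddCommGroup G] : G × G ≃ G × G where
  toFun p := (p.1 - p.2, -p.2)
  invFun p := (p.1 - p.2, -p.2)
  left_inv p := by simp
  right_inv p := by simp

theorem IsTransportSymbol.pairingTerm_flip (hm : IsTransportSymbol σ M m) (ha : Hermitian a)
    (b : ℤ³ → ℂ) (p : ℤ³ × ℤ³) :
    pairingTerm m a b b (flipEquiv ℤ³ p) = -pairingTerm m a b b p := by
  have hsymDot : symDot m (-p.2) (p.1 - p.2) = symDot m p.2 p.1 := by
    rw [← hm.symDot_sub_self p.2 p.1, symDot, symDot, hm.even]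
  have hterm : conj (b (p.1 - p.2)) * transportTerm m a b (p.1 - p.2) (-p.2) =
      -conj (conj (b p.1) * transportTerm m a b p.1 p.2) := by
    simp only [transportTerm, map_mul, Complex.conj_I, Complex.conj_ofReal,
      Complex.conj_conj, ha p.2, hsymDot, sub_neg_eq_add, sub_add_cancel]
    ring
  simp only [flipEquiv, Equiv.coe_fn_mk, pairingTerm, hterm, Complex.neg_re,
    Complex.conj_re]

theorem IsTransportSymbol.tsum_pairingTerm_eq_zero (hm : IsTransportSymbol σ M m)
    (ha : Hermitian a) (b : ℤ³ → ℂ) (w : ℤ³ → ℝ) :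
    ∑' p : ℤ³ × ℤ³, w p.1 * w (p.1 - p.2) * pairingTerm m a b b p = 0 := by
  have hflip := (flipEquiv ℤ³).tsum_eq fun p => w p.1 * w (p.1 - p.2) * pairingTerm m a b b p
  have hneg (p : ℤ³ × ℤ³) : w (flipEquiv ℤ³ p).1 * w ((flipEquiv ℤ³ p).1 - (flipEquiv ℤ³ p).2) *
      pairingTerm m a b b (flipEquiv ℤ³ p) =
        -(w p.1 * w (p.1 - p.2) * pairingTerm m a b b p) := by
    rw [hm.pairingTerm_flip ha]
    simp only [flipEquiv, Equiv.coe_fn_mk, sub_neg_eq_add, sub_add_cancel]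
    ring
  rw [tsum_congr hneg, tsum_neg] at hflip
  linarith

/-- The terms that control the commutator of the energy weight with the transport operator. The
extra `σ` derivatives are shared evenly by two of the three factors, and the third one has four
derivatives to spare. -/
def commutatorMajorant (σ τ : ℝ) (a b : ℤ³ → ℂ) (p : ℤ³ × ℤ³) : ℝ :=
  weightedCoeff (7 + σ / 2) σ τ b p.1 * weightedCoeff (7 + σ / 2) σ τ b (p.1 - p.2) *
      weightedCoeff 3 σ τ a p.2 +
    weightedCoeff (7 + σ / 2) σ τ b p.1 * weightedCoeff 3 σ τ b (p.1 - p.2) *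
      weightedCoeff (7 + σ / 2) σ τ a p.2

theorem commutatorMajorant_nonneg (σ τ : ℝ) (a b : ℤ³ → ℂ) (p : ℤ³ × ℤ³) :
    0 ≤ commutatorMajorant σ τ a b p := by
  have h (p : ℝ) (a : ℤ³ → ℂ) (k : ℤ³) := weightedCoeff_nonneg p σ τ a k
  exact add_nonneg (mul_nonneg (mul_nonneg (h _ _ _) (h _ _ _)) (h _ _ _))
    (mul_nonneg (mul_nonneg (h _ _ _) (h _ _ _)) (h _ _ _))

theorem IsTransportSymbol.abs_weight_commutator_le (hm : IsTransportSymbol σ M m) (hτ : 0 ≤ τ)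
    (a b : ℤ³ → ℂ) (p : ℤ³ × ℤ³) :
    |gevreyWeight 7 σ τ p.1 ^ 2 * pairingTerm m a b b p -
        gevreyWeight 7 σ τ p.1 * gevreyWeight 7 σ τ (p.1 - p.2) * pairingTerm m a b b p| ≤
      M * (2 ^ 8 * (7 + τ)) * commutatorMajorant σ τ a b p := by
  obtain ⟨k, j⟩ := p
  have hrhs : 0 ≤ M * (2 ^ 8 * (7 + τ)) * commutatorMajorant σ τ a b (k, j) :=
    mul_nonneg (mul_nonneg hm.nonneg (by positivity)) (commutatorMajorant_nonneg ..)
  by_cases h : k = 0 ∨ j = 0 ∨ k - j = 0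
  · rcases h with rfl | h
    · simpa [gevreyWeight_zero] using hrhs
    · simpa [pairingTerm, transportTerm, hm.symDot_eq_zero h] using hrhs
  obtain ⟨hk, hj, hkj⟩ : k ≠ 0 ∧ j ≠ 0 ∧ k - j ≠ 0 := by tauto
  have hM := hm.nonneg
  have hw := gevreyWeight_nonneg 7 σ τ k
  calc |gevreyWeight 7 σ τ k ^ 2 * pairingTerm m a b b (k, j) -
          gevreyWeight 7 σ τ k * gevreyWeight 7 σ τ (k - j) * pairingTerm m a b b (k, j)|
      = gevreyWeight 7 σ τ k * |gevreyWeight 7 σ τ k - gevreyWeight 7 σ τ (k - j)| *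
          |pairingTerm m a b b (k, j)| := by
        rw [sq, mul_assoc, mul_assoc, ← mul_sub, ← sub_mul, abs_mul, abs_mul, abs_of_nonneg hw,
          mul_assoc]
    _ ≤ gevreyWeight 7 σ τ k * |gevreyWeight 7 σ τ k - gevreyWeight 7 σ τ (k - j)| *
          (M * waveNorm j ^ σ * waveNorm (k - j) * (‖b k‖ * ‖b (k - j)‖ * ‖a j‖)) :=
        mul_le_mul_of_nonneg_left (hm.abs_pairingTerm_le a b b (k, j)) (by positivity)
    _ = M * (gevreyWeight 7 σ τ k * (‖b k‖ * ‖b (k - j)‖ * ‖a j‖)) *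
          (waveNorm (k - j) * waveNorm j ^ σ *
            |gevreyWeight 7 σ τ k - gevreyWeight 7 σ τ (k - j)|) := by ring
    _ ≤ M * (gevreyWeight 7 σ τ k * (‖b k‖ * ‖b (k - j)‖ * ‖a j‖)) * _ :=
        mul_le_mul_of_nonneg_left
          (gevreyWeight_commutator_le hm.pos.le hm.le_one hτ hj hk hkj) (by positivity)
    _ = M * (2 ^ 8 * (7 + τ)) * commutatorMajorant σ τ a b (k, j) := by
        simp only [commutatorMajorant, weightedCoeff, gevreyWeight_add hk 7 (σ / 2)]
        ring

theorem IsTransportSymbol.summable_antisymm_pairing (hm : IsTransportSymbol σ M m) (hρ : 0 < ρ)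
    (hτ : τ < ρ) (ha : HasDecay σ ρ K a) (hb : HasDecay σ ρ K' b) :
    Summable fun p : ℤ³ × ℤ³ =>
      gevreyWeight 7 σ τ p.1 * gevreyWeight 7 σ τ (p.1 - p.2) * pairingTerm m a b b p := by
  have hσ := hm.pos
  have hM := hm.nonneg
  have hX := ha.summable_pow_mul hσ hρ 1
  have hP := hb.summable_sq_weightedCoeff hσ (by norm_num : (0 : ℝ) < 7) hτ
  have hQ := hb.summable_sq_weightedCoeff hσ (by norm_num : (0 : ℝ) < 8) hτ
  refine Summable.of_norm_bounded ((summable_mul_mul_conv hX hP hQ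
    (fun k => mul_nonneg (pow_nonneg (waveNorm_nonneg k) _) (norm_nonneg _))
    (weightedCoeff_nonneg _ _ _ _) (weightedCoeff_nonneg _ _ _ _)).mul_left M) fun p => ?_
  have hw (k : ℤ³) := gevreyWeight_nonneg 7 σ τ k
  have h8 (k : ℤ³) : gevreyWeight 8 σ τ k = waveNorm k * gevreyWeight 7 σ τ k := by
    simp only [gevreyWeight, Real.rpow_ofNat]
    ring
  rw [Real.norm_eq_abs, abs_mul, abs_of_nonneg (mul_nonneg (hw _) (hw _))]
  calc gevreyWeight 7 σ τ p.1 * gevreyWeight 7 σ τ (p.1 - p.2) * |pairingTerm m a b b p|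
      ≤ gevreyWeight 7 σ τ p.1 * gevreyWeight 7 σ τ (p.1 - p.2) *
          (M * waveNorm p.2 * waveNorm (p.1 - p.2) *
            (‖b p.1‖ * ‖b (p.1 - p.2)‖ * ‖a p.2‖)) := by
        refine mul_le_mul_of_nonneg_left ((hm.abs_pairingTerm_le a b b p).trans ?_)
          (mul_nonneg (hw _) (hw _))
        have := waveNorm_nonneg (p.1 - p.2)
        gcongr
        exact waveNorm_rpow_le_self hσ hm.le_one _
    _ = _ := by
        simp only [weightedCoeff, h8]
        ring

theorem HasDecay.summable_commutatorMajorant (ha : HasDecay σ ρ K a) (hb : HasDecay σ ρ K' b)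
    (hσ : 0 < σ) (hτ : τ < ρ) : Summable (commutatorMajorant σ τ a b) := by
  have hsq (p : ℝ) (hp : 0 < p) := hb.summable_sq_weightedCoeff hσ hp hτ
  have hhalf : 0 < 7 + σ / 2 := by positivity
  refine (summable_mul_mul_conv (ha.summable_weightedCoeff hσ three_pos hτ) (hsq _ hhalf)
    (hsq _ hhalf) ?_ ?_ ?_).add (summable_mul_mul_conv (ha.summable_weightedCoeff hσ hhalf hτ)
      (hsq _ hhalf) (hsq _ three_pos) ?_ ?_ ?_) <;> exact weightedCoeff_nonneg _ _ _ _

theorem IsTransportSymbol.summable_pairing (hm : IsTransportSymbol σ M m) (hτ : 0 ≤ τ)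
    (hρ : τ < ρ) (ha : HasDecay σ ρ K a) (hb : HasDecay σ ρ K' b) :
    Summable fun p : ℤ³ × ℤ³ => gevreyWeight 7 σ τ p.1 ^ 2 * pairingTerm m a b b p := by
  have hmaj := ha.summable_commutatorMajorant hb hm.pos hρ
  simpa using (Summable.of_norm_bounded (hmaj.mul_left _) (hm.abs_weight_commutator_le hτ a b)).add
    (hm.summable_antisymm_pairing (hτ.trans_lt hρ) hρ ha hb)

theorem IsTransportSymbol.abs_tsum_pairing_le (hm : IsTransportSymbol σ M m) (hτ : 0 ≤ τ)
    (hρ : τ < ρ) (ha : HasDecay σ ρ K a) (hb : HasDecay σ ρ K' b) (hHa : Hermitian a) :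
    |∑' p : ℤ³ × ℤ³, gevreyWeight 7 σ τ p.1 ^ 2 * pairingTerm m a b b p| ≤
      M * (2 ^ 8 * (7 + τ)) * ∑' p, commutatorMajorant σ τ a b p := by
  have hmaj := ha.summable_commutatorMajorant hb hm.pos hρ
  have hcancel := (hm.summable_pairing hτ hρ ha hb).tsum_sub
    (hm.summable_antisymm_pairing (hτ.trans_lt hρ) hρ ha hb)
  rw [hm.tsum_pairingTerm_eq_zero hHa, sub_zero] at hcancel
  rw [← hcancel, ← tsum_mul_left, ← Real.norm_eq_abs]
  exact tsum_of_norm_bounded (hmaj.mul_left _).hasSum (hm.abs_weight_commutator_le hτ a b)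

end Pairing

section EnergyEstimates

/-- The energy `∑ |k|^{2p} e^{2τ|k|^σ} |a_k|²` of a sequence of Fourier coefficients. -/
def gevreyEnergy (p σ τ : ℝ) (a : ℤ³ → ℂ) : ℝ := ∑' k, weightedCoeff p σ τ a k ^ 2

variable {σ M τ ρ K K' : ℝ} {m : ℤ³ → Fin 3 → ℝ} {a b d : ℤ³ → ℂ}

theorem gevreyEnergy_nonneg (p σ τ : ℝ) (a : ℤ³ → ℂ) : 0 ≤ gevreyEnergy p σ τ a :=
  tsum_nonneg fun _ => sq_nonneg _

theorem HasDecay.tsum_commutatorMajorant_self_le {y : ℝ} (ha : HasDecay σ ρ K a) (hσ : 0 < σ)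
    (hτ : τ < ρ) (hy : ∀ k, weightedCoeff 7 σ τ a k ≤ y) :
    ∑' p, commutatorMajorant σ τ a a p ≤
      2 * (∑' k : ℤ³, (waveNorm k ^ 4)⁻¹) * y * gevreyEnergy (7 + σ / 2) σ τ a := by
  have hhalf : 0 < 7 + σ / 2 := by positivity
  have hlow := ha.summable_weightedCoeff hσ three_pos hτ
  have hsq := ha.summable_sq_weightedCoeff hσ hhalf hτ
  have h0 (p : ℝ) := weightedCoeff_nonneg p σ τ a
  have hlow_le : ∑' k, weightedCoeff 3 σ τ a k ≤ (∑' k : ℤ³, (waveNorm k ^ 4)⁻¹) * y := by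
    rw [← tsum_mul_right]
    refine hlow.tsum_le_tsum (fun k => ?_)
      ((summable_inv_waveNorm_pow (by simp : 3 < 4)).mul_right y)
    rw [weightedCoeff, gevreyWeight_three, mul_assoc]
    exact mul_le_mul_of_nonneg_left (hy k) (inv_nonneg.2 (pow_nonneg (waveNorm_nonneg k) _))
  have hsum := summable_mul_mul_conv hlow hsq hsq (h0 _) (h0 _) (h0 _)
  have hconv := tsum_mul_mul_conv_le hlow hsq hsq (h0 _) (h0 _) (h0 _)
  simp only [commutatorMajorant]
  rw [hsum.tsum_add ((summable_mul_mul_conv_swap _ _ _).2 hsum),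
    tsum_mul_mul_conv_swap (weightedCoeff (7 + σ / 2) σ τ a) (weightedCoeff (7 + σ / 2) σ τ a)
      (weightedCoeff 3 σ τ a)]
  calc _ ≤ 2 * ((∑' k, weightedCoeff 3 σ τ a k) * gevreyEnergy (7 + σ / 2) σ τ a) := by
        rw [gevreyEnergy]
        linarith
    _ ≤ 2 * ((∑' k : ℤ³, (waveNorm k ^ 4)⁻¹) * y * gevreyEnergy (7 + σ / 2) σ τ a) := by
        gcongr
        exact gevreyEnergy_nonneg ..
    _ = _ := by ring

theorem HasDecay.tsum_commutatorMajorant_le (ha : HasDecay σ ρ K a) (hb : HasDecay σ ρ K' b)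
    (hσ : 0 < σ) (hτ : τ < ρ) :
    ∑' p, commutatorMajorant σ τ a b p ≤
      2 * (∑' k, weightedCoeff (7 + σ / 2) σ τ a k) * gevreyEnergy (7 + σ / 2) σ τ b := by
  have hhalf : 0 < 7 + σ / 2 := by positivity
  have h3 : (3 : ℝ) ≤ 7 + σ / 2 := by linarith
  have hlow := ha.summable_weightedCoeff hσ three_pos hτ
  have hhigh := ha.summable_weightedCoeff hσ hhalf hτ
  have hlow_sq := hb.summable_sq_weightedCoeff hσ three_pos hτ
  have hsq := hb.summable_sq_weightedCoeff hσ hhalf hτ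
  have h0 (p : ℝ) (a : ℤ³ → ℂ) := weightedCoeff_nonneg p σ τ a
  have hlow_le : ∑' k, weightedCoeff 3 σ τ a k ≤ ∑' k, weightedCoeff (7 + σ / 2) σ τ a k :=
    hlow.tsum_le_tsum (weightedCoeff_mono three_pos h3 a) hhigh
  have hlow_sq_le : ∑' k, weightedCoeff 3 σ τ b k ^ 2 ≤ gevreyEnergy (7 + σ / 2) σ τ b :=
    hlow_sq.tsum_le_tsum
      (fun k => pow_le_pow_left₀ (h0 _ _ _) (weightedCoeff_mono three_pos h3 b k) 2) hsq
  simp only [commutatorMajorant]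
  rw [(summable_mul_mul_conv hlow hsq hsq (h0 _ _) (h0 _ _) (h0 _ _)).tsum_add
    (summable_mul_mul_conv hhigh hsq hlow_sq (h0 _ _) (h0 _ _) (h0 _ _))]
  have h₁ := tsum_mul_mul_conv_le hlow hsq hsq (h0 _ _) (h0 _ _) (h0 _ _)
  have h₂ := tsum_mul_mul_conv_le hhigh hsq hlow_sq (h0 _ _) (h0 _ _) (h0 _ _)
  rw [← gevreyEnergy] at h₁ h₂
  have hhigh_nonneg : 0 ≤ ∑' k, weightedCoeff (7 + σ / 2) σ τ a k := tsum_nonneg (h0 _ _)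
  nlinarith [mul_le_mul_of_nonneg_right hlow_le (gevreyEnergy_nonneg (7 + σ / 2) σ τ b),
    mul_le_mul_of_nonneg_left hlow_sq_le hhigh_nonneg]

theorem IsTransportSymbol.abs_tsum_pairing_self_le {y : ℝ} (hm : IsTransportSymbol σ M m)
    (hτ : 0 ≤ τ) (hρ : τ < ρ) (ha : HasDecay σ ρ K a) (hHa : Hermitian a)
    (hy : ∀ k, weightedCoeff 7 σ τ a k ≤ y) :
    |∑' p : ℤ³ × ℤ³, gevreyWeight 7 σ τ p.1 ^ 2 * pairingTerm m a a a p| ≤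
      M * (2 ^ 8 * (7 + τ)) * (2 * ∑' k : ℤ³, (waveNorm k ^ 4)⁻¹) * y *
        gevreyEnergy (7 + σ / 2) σ τ a := by
  refine (hm.abs_tsum_pairing_le hτ hρ ha ha hHa).trans ?_
  rw [mul_assoc _ _ y, mul_assoc _ (_ * y)]
  exact mul_le_mul_of_nonneg_left (ha.tsum_commutatorMajorant_self_le hm.pos hρ hy)
    (mul_nonneg hm.nonneg (by positivity))

theorem IsTransportSymbol.abs_tsum_pairing_transport_le (hm : IsTransportSymbol σ M m)
    (hτ : 0 ≤ τ) (hρ : τ < ρ) (ha : HasDecay σ ρ K a) (hb : HasDecay σ ρ K' b)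
    (hHa : Hermitian a) :
    |∑' p : ℤ³ × ℤ³, gevreyWeight 7 σ τ p.1 ^ 2 * pairingTerm m a b b p| ≤
      M * (2 ^ 8 * (7 + τ)) * (2 * ∑' k, weightedCoeff (7 + σ / 2) σ τ a k) *
        gevreyEnergy (7 + σ / 2) σ τ b := by
  refine (hm.abs_tsum_pairing_le hτ hρ ha hb hHa).trans ?_
  rw [mul_assoc _ (2 * _)]
  exact mul_le_mul_of_nonneg_left (ha.tsum_commutatorMajorant_le hb hm.pos hρ)
    (mul_nonneg hm.nonneg (by positivity))

theorem waveNorm_rpow_half_le (hσ : 0 ≤ σ) (hσ1 : σ ≤ 1) {k j : ℤ³} (hk : k ≠ 0)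
    (hkj : k - j ≠ 0) :
    waveNorm j ^ (σ / 2) ≤ 2 * waveNorm k ^ (σ / 2) * waveNorm (k - j) :=
  (rpow_le_two_mul_rpow_mul_rpow (by linarith) (by linarith) (one_le_waveNorm hk)
    (one_le_waveNorm hkj) (waveNorm_nonneg j) (waveNorm_le_add_sub' j k)).trans
    (mul_le_mul_of_nonneg_left (rpow_le_self (by linarith) (one_le_waveNorm hkj))
      (mul_nonneg zero_le_two (Real.rpow_nonneg (waveNorm_nonneg k) _)))

theorem IsTransportSymbol.abs_pairing_coupling_le (hm : IsTransportSymbol σ M m) (hτ : 0 ≤ τ)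
    (b d : ℤ³ → ℂ) (p : ℤ³ × ℤ³) :
    |gevreyWeight 7 σ τ p.1 ^ 2 * pairingTerm m d b d p| ≤
      M * 2 ^ 8 * (weightedCoeff (7 + σ / 2) σ τ d p.1 * weightedCoeff 9 σ τ b (p.1 - p.2) *
        weightedCoeff (7 + σ / 2) σ τ d p.2) := by
  obtain ⟨k, j⟩ := p
  have hM := hm.nonneg
  have hrhs : 0 ≤ M * 2 ^ 8 * (weightedCoeff (7 + σ / 2) σ τ d k *
      weightedCoeff 9 σ τ b (k - j) * weightedCoeff (7 + σ / 2) σ τ d j) := by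
    have h (p : ℝ) (a : ℤ³ → ℂ) (k : ℤ³) := weightedCoeff_nonneg p σ τ a k
    exact mul_nonneg (by positivity) (mul_nonneg (mul_nonneg (h _ _ _) (h _ _ _)) (h _ _ _))
  by_cases h : k = 0 ∨ j = 0 ∨ k - j = 0
  · rcases h with rfl | h
    · simpa [gevreyWeight_zero] using hrhs
    · simpa [pairingTerm, transportTerm, hm.symDot_eq_zero h] using hrhs
  obtain ⟨hk, hj, hkj⟩ : k ≠ 0 ∧ j ≠ 0 ∧ k - j ≠ 0 := by tauto
  have hσ := hm.pos.le
  have hl := waveNorm_nonneg (k - j)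
  have hw (k : ℤ³) := gevreyWeight_nonneg 7 σ τ k
  have hpow (k : ℤ³) := Real.rpow_nonneg (waveNorm_nonneg k) (σ / 2)
  have hhalf := waveNorm_rpow_half_le hσ hm.le_one hk hkj
  have hweight := gevreyWeight_le_mul hσ hm.le_one hτ hj hkj
  rw [abs_mul, abs_of_nonneg (sq_nonneg _), sq]
  calc gevreyWeight 7 σ τ k * gevreyWeight 7 σ τ k * |pairingTerm m d b d (k, j)|
      ≤ gevreyWeight 7 σ τ k * gevreyWeight 7 σ τ k *
          (M * waveNorm j ^ σ * waveNorm (k - j) * (‖d k‖ * ‖b (k - j)‖ * ‖d j‖)) :=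
        mul_le_mul_of_nonneg_left (hm.abs_pairingTerm_le d b d (k, j)) (mul_nonneg (hw k) (hw k))
    _ = gevreyWeight 7 σ τ k * gevreyWeight 7 σ τ k * (M * (waveNorm j ^ (σ / 2) *
          waveNorm j ^ (σ / 2)) * waveNorm (k - j) * (‖d k‖ * ‖b (k - j)‖ * ‖d j‖)) := by
        rw [rpow_half_mul_self (one_pos.trans_le (one_le_waveNorm hj))]
    _ ≤ gevreyWeight 7 σ τ k * (2 ^ 7 * (gevreyWeight 7 σ τ j * gevreyWeight 7 σ τ (k - j))) *
          (M * (waveNorm j ^ (σ / 2) * (2 * waveNorm k ^ (σ / 2) * waveNorm (k - j))) *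
            waveNorm (k - j) * (‖d k‖ * ‖b (k - j)‖ * ‖d j‖)) := by
        have := hw k
        have := hw j
        have := hw (k - j)
        have := hpow j
        gcongr
    _ = _ := by
        rw [(by norm_num : (9 : ℝ) = 7 + 2)]
        simp only [weightedCoeff, gevreyWeight_add hk 7 (σ / 2), gevreyWeight_add hj 7 (σ / 2),
          gevreyWeight_add hkj 7 2, Real.rpow_ofNat]
        ring

theorem HasDecay.summable_coupling (hb : HasDecay σ ρ K b) (hd : HasDecay σ ρ K' d) (hσ : 0 < σ)
    (hρ : τ < ρ) : Summable fun p : ℤ³ × ℤ³ => weightedCoeff (7 + σ / 2) σ τ d p.1 *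
      weightedCoeff 9 σ τ b (p.1 - p.2) * weightedCoeff (7 + σ / 2) σ τ d p.2 := by
  have hsq := hd.summable_sq_weightedCoeff hσ (by positivity : 0 < 7 + σ / 2) hρ
  refine (summable_mul_mul_conv_swap _ _ _).2 (summable_mul_mul_conv
    (hb.summable_weightedCoeff hσ (by norm_num) hρ) hsq hsq ?_ ?_ ?_) <;>
      exact weightedCoeff_nonneg _ _ _ _

theorem IsTransportSymbol.summable_pairing_coupling (hm : IsTransportSymbol σ M m) (hτ : 0 ≤ τ)
    (hρ : τ < ρ) (hb : HasDecay σ ρ K b) (hd : HasDecay σ ρ K' d) :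
    Summable fun p : ℤ³ × ℤ³ => gevreyWeight 7 σ τ p.1 ^ 2 * pairingTerm m d b d p :=
  .of_norm_bounded ((hb.summable_coupling hd hm.pos hρ).mul_left _)
    (hm.abs_pairing_coupling_le hτ b d)

theorem IsTransportSymbol.abs_tsum_pairing_coupling_le (hm : IsTransportSymbol σ M m)
    (hτ : 0 ≤ τ) (hρ : τ < ρ) (hb : HasDecay σ ρ K b) (hd : HasDecay σ ρ K' d) :
    |∑' p : ℤ³ × ℤ³, gevreyWeight 7 σ τ p.1 ^ 2 * pairingTerm m d b d p| ≤
      M * 2 ^ 8 * (∑' k, weightedCoeff 9 σ τ b k) * gevreyEnergy (7 + σ / 2) σ τ d := by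
  have hσ := hm.pos
  have hM := hm.nonneg
  have hY := hb.summable_weightedCoeff hσ (by norm_num : (0 : ℝ) < 9) hρ
  have hsq := hd.summable_sq_weightedCoeff hσ (by positivity : 0 < 7 + σ / 2) hρ
  have h0 (p : ℝ) (a : ℤ³ → ℂ) := weightedCoeff_nonneg p σ τ a
  calc |∑' p : ℤ³ × ℤ³, gevreyWeight 7 σ τ p.1 ^ 2 * pairingTerm m d b d p|
      ≤ ∑' p : ℤ³ × ℤ³, M * 2 ^ 8 * (weightedCoeff (7 + σ / 2) σ τ d p.1 *
          weightedCoeff 9 σ τ b (p.1 - p.2) * weightedCoeff (7 + σ / 2) σ τ d p.2) := by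
        rw [← Real.norm_eq_abs]
        exact tsum_of_norm_bounded ((hb.summable_coupling hd hσ hρ).mul_left _).hasSum
          (hm.abs_pairing_coupling_le hτ b d)
    _ ≤ M * 2 ^ 8 * ((∑' k, weightedCoeff 9 σ τ b k) * (gevreyEnergy (7 + σ / 2) σ τ d +
          gevreyEnergy (7 + σ / 2) σ τ d) / 2) := by
        rw [tsum_mul_left, tsum_mul_mul_conv_swap]
        exact mul_le_mul_of_nonneg_left
          (tsum_mul_mul_conv_le hY hsq hsq (h0 _ _) (h0 _ _) (h0 _ _)) (by positivity)
    _ = _ := by ring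

end EnergyEstimates

section TransportOperator

/-- The Fourier coefficients of `u · ∇b`, where `u` is the velocity of `a`. -/
def transport (m : ℤ³ → Fin 3 → ℝ) (a b : ℤ³ → ℂ) (k : ℤ³) : ℂ := ∑' j, transportTerm m a b k j

variable {σ M ρ ρ' δ K K' : ℝ} {m : ℤ³ → Fin 3 → ℝ} {a b c : ℤ³ → ℂ}

theorem IsTransportSymbol.norm_transportTerm_le (hm : IsTransportSymbol σ M m) (hρ : 0 ≤ ρ)
    (hδ : 0 ≤ δ) (ha : HasDecay σ (ρ + δ) K a) (hb : HasDecay σ (ρ + δ) K' b) (k j : ℤ³) :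
    ‖transportTerm m a b k j‖ ≤
      M * K * K' * (waveNorm k * expDecay σ ρ k) * (waveNorm j ^ 1 * expDecay σ δ j) := by
  have hM := hm.nonneg
  have hK := ha.nonneg
  have hK' := hb.nonneg
  have hj := waveNorm_nonneg j
  have hk := waveNorm_nonneg k
  have hE (ρ : ℝ) (k : ℤ³) := expDecay_pos σ ρ k
  have hsym : |symDot m j k| ≤ M * waveNorm j * waveNorm k :=
    (hm.bound j k).trans (by gcongr; exact waveNorm_rpow_le_self hm.pos hm.le_one j)
  have haj := ha j
  rw [expDecay_add] at haj
  have hbkj : ‖b (k - j)‖ ≤ K' * expDecay σ ρ (k - j) := hb.mono (by linarith) le_rfl (k - j)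
  rw [norm_transportTerm]
  calc |symDot m j k| * ‖a j‖ * ‖b (k - j)‖
      ≤ (M * waveNorm j * waveNorm k) * (K * (expDecay σ ρ j * expDecay σ δ j)) *
          (K' * expDecay σ ρ (k - j)) := by
        have := hE ρ j
        have := hE δ j
        gcongr
    _ = M * K * K' * waveNorm k * (expDecay σ ρ j * expDecay σ ρ (k - j)) *
          (waveNorm j * expDecay σ δ j) := by ring
    _ ≤ M * K * K' * waveNorm k * expDecay σ ρ k * (waveNorm j * expDecay σ δ j) := by
        have := hE δ j
        gcongr
        exact expDecay_mul_le hm.pos.le hm.le_one hρ j k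
    _ = _ := by ring

theorem IsTransportSymbol.summable_transportTerm (hm : IsTransportSymbol σ M m) (hρ : 0 < ρ)
    (ha : HasDecay σ ρ K a) (hb : HasDecay σ ρ K' b) (k : ℤ³) :
    Summable (transportTerm m a b k) := by
  rw [← zero_add ρ] at ha hb
  exact ((summable_pow_mul_expDecay hm.pos hρ 1).mul_left _).of_norm_bounded
    (hm.norm_transportTerm_le le_rfl hρ.le ha hb k)

theorem IsTransportSymbol.exists_hasDecay_transport (hm : IsTransportSymbol σ M m)
    (hρ' : 0 < ρ') (hρ : ρ' < ρ) : ∃ C : ℝ, 0 ≤ C ∧ ∀ K K' : ℝ, ∀ a b : ℤ³ → ℂ,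
      HasDecay σ ρ K a → HasDecay σ ρ K' b →
        HasDecay σ ρ' (C * (K * K')) (transport m a b) := by
  obtain ⟨δ, hδ, rfl⟩ : ∃ δ, 0 < δ ∧ ρ = ρ' + δ + δ := ⟨(ρ - ρ') / 2, by linarith, by ring⟩
  obtain ⟨C, hC, hbound⟩ := exists_pow_mul_expDecay_le hm.pos hδ 1
  have hM := hm.nonneg
  let S : ℝ := ∑' j : ℤ³, waveNorm j ^ 1 * expDecay σ δ j
  have hS : 0 ≤ S :=
    tsum_nonneg fun j => mul_nonneg (pow_nonneg (waveNorm_nonneg j) _) (expDecay_pos _ _ _).le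
  refine ⟨M * C * S, by positivity, fun K K' a b ha hb k => ?_⟩
  have hK := ha.nonneg
  have hK' := hb.nonneg
  calc ‖transport m a b k‖ ≤ M * K * K' * (waveNorm k * expDecay σ (ρ' + δ) k) * S := by
        rw [← tsum_mul_left]
        exact tsum_of_norm_bounded ((summable_pow_mul_expDecay hm.pos hδ 1).mul_left _).hasSum
          (hm.norm_transportTerm_le (by linarith) hδ.le ha hb k)
    _ = M * K * K' * (waveNorm k ^ 1 * expDecay σ δ k) * expDecay σ ρ' k * S := by
        rw [expDecay_add]
        ring
    _ ≤ M * K * K' * C * expDecay σ ρ' k * S := by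
        have := expDecay_pos σ ρ' k
        gcongr
        exact hbound k
    _ = _ := by ring

theorem IsTransportSymbol.transport_self_sub_transport_self (hm : IsTransportSymbol σ M m)
    (hρ : 0 < ρ) (ha : HasDecay σ ρ K a) (hb : HasDecay σ ρ K' b) (k : ℤ³) :
    transport m a a k - transport m b b k =
      transport m (a - b) b k + transport m a (a - b) k := by
  have hab := ha.sub hb
  have ha' := ha.mono le_rfl (le_add_of_nonneg_right hb.nonneg)
  have hb' := hb.mono le_rfl (le_add_of_nonneg_left ha.nonneg)
  simp only [transport]
  rw [← (hm.summable_transportTerm hρ ha ha k).tsum_sub (hm.summable_transportTerm hρ hb hb k),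
    ← (hm.summable_transportTerm hρ hab hb' k).tsum_add
      (hm.summable_transportTerm hρ ha' hab k)]
  refine tsum_congr fun j => ?_
  simp only [transportTerm, Pi.sub_apply]
  ring

theorem Hermitian.transport (heven : ∀ k, m (-k) = m k) (ha : Hermitian a) (hb : Hermitian b) :
    Hermitian (transport m a b) := fun k => by
  rw [MG.transport, MG.transport, Complex.conj_tsum, ← (Equiv.neg ℤ³).tsum_eq]
  refine tsum_congr fun j => ?_
  have hneg : symDot m (-j) (-k) = -symDot m j k := by
    simp [symDot, heven, Finset.sum_neg_distrib]
  simp only [Equiv.neg_apply, transportTerm, map_mul, Complex.conj_I, Complex.conj_ofReal, hneg,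
    ha j, ← hb (k - j), neg_sub_neg, neg_sub]
  push_cast
  ring

theorem transport_zero (m : ℤ³ → Fin 3 → ℝ) (a b : ℤ³ → ℂ) : transport m a b 0 = 0 := by
  simp [transport, transportTerm, symDot]

theorem hasSum_sq_mul_re_conj_mul_transport {w : ℤ³ → ℝ}
    (hs : Summable fun p : ℤ³ × ℤ³ => w p.1 ^ 2 * pairingTerm m a b c p)
    (hterm : ∀ k, Summable (transportTerm m a b k)) :
    HasSum (fun k => w k ^ 2 * (conj (c k) * transport m a b k).re)
      (∑' p : ℤ³ × ℤ³, w p.1 ^ 2 * pairingTerm m a b c p) :=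
  hs.hasSum.prod_fiberwise fun k =>
    (Complex.hasSum_re ((hterm k).hasSum.mul_left (conj (c k)))).mul_left _

end TransportOperator

section Galerkin

theorem hasDerivWithinAt_norm_sq {f : ℝ → ℂ} {f' : ℂ} {s : Set ℝ} {t : ℝ}
    (hf : HasDerivWithinAt f f' s t) :
    HasDerivWithinAt (fun u => ‖f u‖ ^ 2) (2 * (conj (f t) * f').re) s t := by
  simpa only [Complex.inner, mul_comm f'] using hf.norm_sq

theorem exists_solution_of_lipschitzWith_of_bounded {E : Type*} [NormedAddCommGroup E]
    [NormedSpace ℝ E] [CompleteSpace E] {f : E → E} {C : NNReal} {L T : ℝ}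
    (hf : LipschitzWith C f) (hL : ∀ x, ‖f x‖ ≤ L) (x₀ : E) (hT : 0 ≤ T) :
    ∃ x : ℝ → E, x 0 = x₀ ∧
      ∀ t ∈ Set.Icc 0 T, HasDerivWithinAt x (f (x t)) (Set.Icc 0 T) t := by
  have hL0 : 0 ≤ L := (norm_nonneg _).trans (hL x₀)
  have hf_picard : IsPicardLindelof (fun _ => f) (⟨0, by simp [hT]⟩ : Set.Icc 0 T) x₀
      (L.toNNReal * T.toNNReal) 0 L.toNNReal C :=
    { lipschitzOnWith := fun _ _ => hf.lipschitzOnWith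
      continuousOn := fun _ _ => continuousOn_const
      norm_le := fun _ _ x _ => by simpa [Real.coe_toNNReal _ hL0] using hL x
      mul_max_le := by simp [Real.coe_toNNReal _ hL0, Real.coe_toNNReal _ hT, hT] }
  exact hf_picard.exists_eq_forall_mem_Icc_hasDerivWithinAt₀

variable {σ M T : ℝ} {m : ℤ³ → Fin 3 → ℝ} {F : Finset ℤ³} {a b : ℤ³ → ℂ} {k : ℤ³}

theorem summable_transportTerm_of_finite (m : ℤ³ → Fin 3 → ℝ) (ha : ∀ k ∉ F, a k = 0)
    (b : ℤ³ → ℂ) (k : ℤ³) : Summable (transportTerm m a b k) :=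
  summable_of_ne_finset_zero (s := F) fun j hj => by simp [transportTerm, ha j hj]

theorem IsTransportSymbol.sum_re_conj_mul_transport_eq_zero (hm : IsTransportSymbol σ M m)
    (ha : ∀ k ∉ F, a k = 0) (hHa : Hermitian a) :
    ∑ k ∈ F, (conj (a k) * transport m a a k).re = 0 := by
  have hs : Summable fun p : ℤ³ × ℤ³ => (1 : ℤ³ → ℝ) p.1 ^ 2 * pairingTerm m a a a p :=
    summable_of_ne_finset_zero (s := F ×ˢ F) fun p hp => by
      rw [Finset.mem_product, not_and_or] at hp
      rcases hp with hp | hp <;> simp [pairingTerm, transportTerm, ha _ hp]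
  have hpairing := hasSum_sq_mul_re_conj_mul_transport hs (summable_transportTerm_of_finite m ha a)
  have hzero := hm.tsum_pairingTerm_eq_zero hHa a 1
  simp only [Pi.one_apply, one_pow, one_mul] at hpairing hzero
  rw [hzero] at hpairing
  exact (hasSum_sum_of_ne_finset_zero fun k hk => by simp [ha k hk]).unique hpairing

/-- The coefficient at `k` of the extension by zero of a family of coefficients on `F`. -/
def zeroExtend (F : Finset ℤ³) (k : ℤ³) : (F → ℂ) →L[ℝ] ℂ :=
  if h : k ∈ F then .proj ⟨k, h⟩ else 0

theorem zeroExtend_of_mem (hk : k ∈ F) (x : F → ℂ) : zeroExtend F k x = x ⟨k, hk⟩ := by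
  simp [zeroExtend, hk]

theorem zeroExtend_of_notMem (hk : k ∉ F) (x : F → ℂ) : zeroExtend F k x = 0 := by
  simp [zeroExtend, hk]

/-- The projection of a family of coefficients on `F = -F` onto the Hermitian families. -/
def hermitianPart (F : Finset ℤ³) : (F → ℂ) →L[ℝ] (F → ℂ) :=
  .pi fun k => (2⁻¹ : ℝ) • (zeroExtend F k + Complex.conjCLE.toContinuousLinearMap ∘L
    zeroExtend F (-k))

theorem hermitianPart_apply (x : F → ℂ) (k : F) :
    hermitianPart F x k = 2⁻¹ * (zeroExtend F k x + conj (zeroExtend F (-k) x)) := by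
  simp [hermitianPart, mul_add]

theorem hermitian_zeroExtend_hermitianPart (hF : ∀ k ∈ F, -k ∈ F) (x : F → ℂ) :
    Hermitian fun k => zeroExtend F k (hermitianPart F x) := fun k => by
  beta_reduce
  by_cases hk : k ∈ F
  · rw [zeroExtend_of_mem hk, zeroExtend_of_mem (hF k hk), hermitianPart_apply,
      hermitianPart_apply, neg_neg, map_mul, map_add, Complex.conj_conj, map_inv₀,
      Complex.conj_ofNat, add_comm]
  · have hk' : -k ∉ F := fun h => hk (neg_neg k ▸ hF _ h)
    simp only [zeroExtend_of_notMem hk, zeroExtend_of_notMem hk', map_zero]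

theorem hermitianPart_restrict (hF : ∀ k ∈ F, -k ∈ F) (ha : Hermitian a) :
    hermitianPart F (fun k => a k) = fun k : F => a k := by
  ext k
  rw [hermitianPart_apply, zeroExtend_of_mem k.2, zeroExtend_of_mem (hF k k.2), ha,
    Complex.conj_conj]
  ring

/-- The vector field `x ↦ -(u · ∇θ)^` on families of coefficients on `F`, with the result
truncated to `F`. -/
def galerkinField (m : ℤ³ → Fin 3 → ℝ) (F : Finset ℤ³) (x : F → ℂ) (k : F) : ℂ :=
  -transport m (fun l => zeroExtend F l x) (fun l => zeroExtend F l x) k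

theorem contDiff_galerkinField (m : ℤ³ → Fin 3 → ℝ) (F : Finset ℤ³) :
    ContDiff ℝ 1 (galerkinField m F) := by
  refine contDiff_pi.2 fun k => ContDiff.neg ?_
  have hfinite (x : F → ℂ) :
      transport m (fun l => zeroExtend F l x) (fun l => zeroExtend F l x) k =
        ∑ j ∈ F, Complex.I * symDot m j k * zeroExtend F j x * zeroExtend F (k - j) x :=
    tsum_eq_sum fun j hj => by simp [transportTerm, zeroExtend_of_notMem hj]
  simp only [hfinite]
  exact ContDiff.sum fun j _ =>
    (contDiff_const.mul (zeroExtend F j).contDiff).mul (zeroExtend F (k - j)).contDiff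

theorem hermitianPart_galerkinField (heven : ∀ k, m (-k) = m k) (hF : ∀ k ∈ F, -k ∈ F) {x : F → ℂ}
    (hx : Hermitian fun k => zeroExtend F k x) :
    hermitianPart F (galerkinField m F x) = galerkinField m F x :=
  hermitianPart_restrict (a := fun k => -transport m _ _ k) hF fun k => by
    beta_reduce
    rw [hx.transport heven hx, map_neg]

theorem exists_cutoff_galerkin_solution (heven : ∀ k, m (-k) = m k) (hF : ∀ k ∈ F, -k ∈ F)
    (ha : Hermitian a) (φ : ContDiffBump (0 : F → ℂ)) (hT : 0 ≤ T) :
    ∃ x : ℝ → F → ℂ, (x 0 = fun k : F => a k) ∧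
      (∀ t, Hermitian fun k => zeroExtend F k (x t)) ∧
      ∀ t ∈ Set.Icc 0 T,
        HasDerivWithinAt x (φ (x t) • galerkinField m F (x t)) (Set.Icc 0 T) t := by
  let f (x : F → ℂ) := φ x • galerkinField m F x
  have hf : ContDiff ℝ 1 f := φ.contDiff.smul (contDiff_galerkinField m F)
  have hcompact : HasCompactSupport f := φ.hasCompactSupport.smul_right
  obtain ⟨C, hC⟩ := hf.lipschitzWith_of_hasCompactSupport hcompact one_ne_zero
  obtain ⟨L, hL⟩ := hf.continuous.bounded_above_of_compact_support hcompact
  -- Solving `y' = f(Py)` with the Hermitian projection `P` makes `x = Py` Hermitian for free.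
  obtain ⟨y, hy0, hy⟩ := exists_solution_of_lipschitzWith_of_bounded
    (hC.comp (hermitianPart F).lipschitz) (fun y => hL (hermitianPart F y)) (fun k : F => a k) hT
  have hHerm (t : ℝ) := hermitian_zeroExtend_hermitianPart hF (y t)
  refine ⟨fun t => hermitianPart F (y t), by simp only [hy0, hermitianPart_restrict hF ha], hHerm,
    fun t ht => ?_⟩
  have hderiv := (hermitianPart F).hasFDerivAt.comp_hasDerivWithinAt t (hy t ht)
  rwa [Function.comp_apply, map_smul,
    hermitianPart_galerkinField heven hF (hHerm t)] at hderiv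

theorem IsTransportSymbol.sum_norm_sq_galerkin_eq (hm : IsTransportSymbol σ M m)
    {c : ℝ → ℝ} {x : ℝ → F → ℂ} (hHerm : ∀ t, Hermitian fun k => zeroExtend F k (x t))
    (hx : ∀ t ∈ Set.Icc 0 T, HasDerivWithinAt x (c t • galerkinField m F (x t)) (Set.Icc 0 T) t)
    {t : ℝ} (ht : t ∈ Set.Icc 0 T) : ∑ k, ‖x t k‖ ^ 2 = ∑ k, ‖x 0 k‖ ^ 2 := by
  have hderiv (t) (ht : t ∈ Set.Icc 0 T) :
      HasDerivWithinAt (fun u => ∑ k, ‖x u k‖ ^ 2) 0 (Set.Icc 0 T) t := by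
    convert! HasDerivWithinAt.fun_sum fun k (_ : k ∈ Finset.univ) =>
      hasDerivWithinAt_norm_sq (hasDerivWithinAt_pi.1 (hx t ht) k) using 1
    have hconserved := hm.sum_re_conj_mul_transport_eq_zero
      (fun k hk => zeroExtend_of_notMem hk (x t)) (hHerm t)
    rw [← Finset.sum_coe_sort] at hconserved
    calc (0 : ℝ) = ∑ k : F, -(2 * c t) * (conj (zeroExtend F k (x t)) *
          transport m (fun l => zeroExtend F l (x t)) (fun l => zeroExtend F l (x t)) k).re := by
          rw [← Finset.mul_sum, hconserved, mul_zero]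
      _ = _ := Finset.sum_congr rfl fun k _ => by
          simp only [Pi.smul_apply, galerkinField, zeroExtend_of_mem k.2, smul_neg, mul_neg,
            Complex.neg_re, mul_smul_comm, Complex.smul_re, smul_eq_mul]
          ring
  exact constant_of_has_deriv_right_zero (fun t ht => (hderiv t ht).continuousWithinAt)
    (fun t ht => (hderiv t ⟨ht.1, ht.2.le⟩).mono_of_mem_nhdsWithin (Icc_mem_nhdsGE_of_mem ht)) t ht

/-- A solution on `[0,T]` of the Fourier side of `∂ₜθ + u · ∇θ = 0`, truncated to the wave vectors
in `F`. -/
structure IsTruncatedSolution (m : ℤ³ → Fin 3 → ℝ) (F : Set ℤ³) (T : ℝ) (x : ℝ → ℤ³ → ℂ) :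
    Prop where
  eq_zero : ∀ t, ∀ k ∉ F, x t k = 0
  hasDerivWithinAt : ∀ t ∈ Set.Icc 0 T, ∀ k ∈ F,
    HasDerivWithinAt (fun u => x u k) (-transport m (x t) (x t) k) (Set.Icc 0 T) t

theorem IsTransportSymbol.exists_galerkin_solution (hm : IsTransportSymbol σ M m)
    (hF : ∀ k ∈ F, -k ∈ F) (ha : Hermitian a) (hT : 0 ≤ T) :
    ∃ x : ℝ → ℤ³ → ℂ, IsTruncatedSolution m F T x ∧ (∀ k ∈ F, x 0 k = a k) ∧
      ∀ t, Hermitian (x t) := by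
  let S := ∑ k : F, ‖a k‖ ^ 2
  have hS : 0 ≤ S := Finset.sum_nonneg fun _ _ => sq_nonneg _
  let φ : ContDiffBump (0 : F → ℂ) := ⟨S + 1, S + 2, by linarith, by linarith⟩
  obtain ⟨x, hx0, hHerm, hx⟩ := exists_cutoff_galerkin_solution hm.even hF ha φ hT
  have hφ (t) (ht : t ∈ Set.Icc 0 T) : φ (x t) = 1 := by
    refine φ.one_of_mem_closedBall (mem_closedBall_zero_iff.2 ?_)
    refine (pi_norm_le_iff_of_nonneg (by linarith : (0 : ℝ) ≤ S + 1)).2 fun k => ?_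
    have henergy := hm.sum_norm_sq_galerkin_eq hHerm hx ht
    have hk : ‖x t k‖ ^ 2 ≤ ∑ k, ‖x t k‖ ^ 2 :=
      Finset.single_le_sum (f := fun k => ‖x t k‖ ^ 2) (fun _ _ => sq_nonneg _)
        (Finset.mem_univ k)
    rw [henergy, hx0] at hk
    nlinarith [sq_nonneg (‖x t k‖ - 1)]
  refine ⟨fun t k => zeroExtend F k (x t), ⟨fun t k hk => zeroExtend_of_notMem hk _,
    fun t ht k hk => ?_⟩, fun k hk => ?_, hHerm⟩
  · rw [Finset.mem_coe] at hk
    have hderiv := hasDerivWithinAt_pi.1 (hx t ht) ⟨k, hk⟩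
    rw [hφ t ht, one_smul] at hderiv
    simpa only [zeroExtend_of_mem hk, galerkinField] using hderiv
  · simp only [zeroExtend_of_mem hk, hx0]

end Galerkin

section GalerkinEnergy

variable {p σ τ τ₁ ρ κ t T M K : ℝ} {m : ℤ³ → Fin 3 → ℝ} {F : Finset ℤ³} {a : ℤ³ → ℂ} {k : ℤ³}

theorem weightedCoeff_eq_zero (p σ τ : ℝ) (ha : a k = 0) : weightedCoeff p σ τ a k = 0 := by
  simp [weightedCoeff, ha]

theorem gevreyEnergy_eq_sum (p σ τ : ℝ) (ha : ∀ k ∉ F, a k = 0) :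
    gevreyEnergy p σ τ a = ∑ k ∈ F, weightedCoeff p σ τ a k ^ 2 :=
  tsum_eq_sum fun k hk => by simp [weightedCoeff_eq_zero p σ τ (ha k hk)]

theorem weightedCoeff_le_of_gevreyEnergy_le (ha : ∀ k ∉ F, a k = 0) (hK : 0 ≤ K)
    (hE : gevreyEnergy p σ τ a ≤ K ^ 2) (k : ℤ³) : weightedCoeff p σ τ a k ≤ K := by
  by_cases hk : k ∈ F
  · refine le_of_sq_le_sq ?_ hK
    rw [gevreyEnergy_eq_sum p σ τ ha] at hE
    exact (Finset.single_le_sum (fun k _ => sq_nonneg (weightedCoeff p σ τ a k)) hk).trans hE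
  · rwa [weightedCoeff_eq_zero p σ τ (ha k hk)]

theorem hasDecay_of_weightedCoeff_le (ha : ∀ k, weightedCoeff p σ τ a k ≤ K) (hp : 0 ≤ p)
    (hρ : ρ ≤ τ) (ha0 : a 0 = 0) (hK : 0 ≤ K) : HasDecay σ ρ K a := fun k => by
  have hdecay := (expDecay_pos σ ρ k).le
  rcases eq_or_ne k 0 with rfl | hk
  · rw [ha0, norm_zero]
    positivity
  · calc ‖a k‖ ≤ (gevreyWeight p σ τ k * expDecay σ ρ k) * ‖a k‖ :=
          le_mul_of_one_le_left (norm_nonneg _) (one_le_gevreyWeight_mul_expDecay hp hρ hk)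
      _ = weightedCoeff p σ τ a k * expDecay σ ρ k := by
          rw [weightedCoeff]
          ring
      _ ≤ _ := mul_le_mul_of_nonneg_right (ha k) hdecay

theorem hasDerivAt_gevreyWeight_shrinking (p σ τ₁ κ : ℝ) (k : ℤ³) (t : ℝ) :
    HasDerivAt (fun u => gevreyWeight p σ (τ₁ - κ * u) k)
      (-κ * (waveNorm k ^ σ * gevreyWeight p σ (τ₁ - κ * t) k)) t := by
  have hradius : HasDerivAt (fun u => (τ₁ - κ * u) * waveNorm k ^ σ) (-κ * waveNorm k ^ σ) t := by
    simpa using (((hasDerivAt_id t).const_mul κ).const_sub τ₁).mul_const (waveNorm k ^ σ)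
  simp only [gevreyWeight]
  convert! hradius.exp.const_mul (waveNorm k ^ p) using 1
  ring

/-- The rate of change of the squared weighted coefficient `(|k|^p e^{τ|k|^σ} |a_k|)²` when `a`
moves with velocity `v` while the radius `τ` shrinks at speed `κ`. The shrinking contributes the
dissipation that absorbs the loss of `σ` derivatives in the transport term. -/
def energyRate (p σ κ τ : ℝ) (a v : ℤ³ → ℂ) (k : ℤ³) : ℝ :=
  -(2 * κ) * weightedCoeff (p + σ / 2) σ τ a k ^ 2 +
    2 * (gevreyWeight p σ τ k ^ 2 * (conj (a k) * v k).re)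

theorem hasDerivWithinAt_sq_weightedCoeff {c : ℝ → ℤ³ → ℂ} {v : ℤ³ → ℂ} {s : Set ℝ}
    (hp : 0 < p) (hpσ : p + σ / 2 ≠ 0) (hc : HasDerivWithinAt (fun u => c u k) (v k) s t) :
    HasDerivWithinAt (fun u => weightedCoeff p σ (τ₁ - κ * u) (c u) k ^ 2)
      (energyRate p σ κ (τ₁ - κ * t) (c t) v k) s t := by
  have hweight := (hasDerivAt_gevreyWeight_shrinking p σ τ₁ κ k t).hasDerivWithinAt (s := s)
  simp only [weightedCoeff, mul_pow]
  convert! (hweight.pow 2).mul (hasDerivWithinAt_norm_sq hc) using 1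
  rw [energyRate, weightedCoeff, mul_pow, sq_gevreyWeight_add_half hp hpσ, Pi.pow_apply]
  push_cast
  ring

/-- The constant of the a priori energy estimate; the summand `1` makes that estimate strict. -/
def energyConst (M τ : ℝ) : ℝ :=
  M * (2 ^ 8 * (7 + τ)) * (2 * ∑' k : ℤ³, (waveNorm k ^ 4)⁻¹) + 1

theorem energyConst_pos (hM : 0 ≤ M) (hτ : 0 ≤ τ) : 0 < energyConst M τ := by
  have : 0 ≤ ∑' k : ℤ³, (waveNorm k ^ 4)⁻¹ :=
    tsum_nonneg fun k => inv_nonneg.2 (pow_nonneg (waveNorm_nonneg k) _)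
  unfold energyConst
  positivity

theorem IsTransportSymbol.abs_sum_re_conj_mul_transport_le (hm : IsTransportSymbol σ M m)
    (hτ : 0 ≤ τ) (hτ₁ : τ ≤ τ₁) (ha : ∀ k ∉ F, a k = 0) (hHa : Hermitian a) (hK : 0 ≤ K)
    (hE : gevreyEnergy 7 σ τ a ≤ K ^ 2) :
    |∑ k ∈ F, gevreyWeight 7 σ τ k ^ 2 * (conj (a k) * transport m a a k).re| ≤
      (energyConst M τ₁ - 1) * K * gevreyEnergy (7 + σ / 2) σ τ a := by
  obtain ⟨C, hC⟩ := exists_hasDecay_of_finite σ (τ + 1) ha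
  have hpairing := hm.abs_tsum_pairing_self_le hτ (lt_add_one τ) hC hHa
    (weightedCoeff_le_of_gevreyEnergy_le ha hK hE)
  rw [(hasSum_sq_mul_re_conj_mul_transport (hm.summable_pairing hτ (lt_add_one τ) hC hC)
    (summable_transportTerm_of_finite m ha a)).unique
      (hasSum_sum_of_ne_finset_zero (s := F) fun k hk => by simp [ha k hk])] at hpairing
  refine hpairing.trans ?_
  have := hm.nonneg
  have := gevreyEnergy_nonneg (7 + σ / 2) σ τ a
  have : 0 ≤ ∑' k : ℤ³, (waveNorm k ^ 4)⁻¹ :=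
    tsum_nonneg fun k => inv_nonneg.2 (pow_nonneg (waveNorm_nonneg k) _)
  rw [energyConst, add_sub_cancel_right]
  gcongr

theorem IsTransportSymbol.sum_energyRate_neg (hm : IsTransportSymbol σ M m) (hτ : 0 ≤ τ)
    (hτ₁ : τ ≤ τ₁) (ha : ∀ k ∉ F, a k = 0) (hHa : Hermitian a) (hK : 0 < K)
    (hE : gevreyEnergy 7 σ τ a = K ^ 2) :
    ∑ k ∈ F, energyRate 7 σ (2 * energyConst M τ₁ * K) τ a (-transport m a a) k < 0 := by
  have hC := energyConst_pos hm.nonneg (hτ.trans hτ₁)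
  have hpos : 0 < gevreyEnergy (7 + σ / 2) σ τ a := by
    refine (pow_pos hK 2).trans_le (hE.symm.trans_le ?_)
    rw [gevreyEnergy_eq_sum 7 σ τ ha, gevreyEnergy_eq_sum (7 + σ / 2) σ τ ha]
    exact Finset.sum_le_sum fun k _ => pow_le_pow_left₀ (weightedCoeff_nonneg _ _ _ _ _)
      (weightedCoeff_mono (by norm_num) (by linarith [hm.pos]) a k) 2
  have htransport :=
    neg_le_of_abs_le (hm.abs_sum_re_conj_mul_transport_le hτ hτ₁ ha hHa hK.le hE.le)
  simp only [energyRate, Pi.neg_apply, mul_neg, Complex.neg_re]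
  rw [Finset.sum_add_distrib, ← Finset.mul_sum, ← gevreyEnergy_eq_sum (7 + σ / 2) σ τ ha,
    Finset.sum_neg_distrib, ← Finset.mul_sum]
  nlinarith [mul_pos hK hpos, mul_pos hC (mul_pos hK hpos)]

theorem IsTransportSymbol.hasDecay_galerkin (hm : IsTransportSymbol σ M m) (hτ₁ : 0 < τ₁)
    (hK : 0 < K) (hT : 2 * (2 * energyConst M τ₁ * K) * T ≤ τ₁) {x : ℝ → ℤ³ → ℂ} (hF : 0 ∉ F)
    (hx : IsTruncatedSolution m F T x) (hHerm : ∀ t, Hermitian (x t))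
    (hinit : gevreyEnergy 7 σ τ₁ (x 0) ≤ K ^ 2) :
    ∀ t ∈ Set.Icc 0 T, HasDecay σ (τ₁ / 2) K (x t) := by
  set κ := 2 * energyConst M τ₁ * K
  have hκ : 0 < κ := mul_pos (mul_pos two_pos (energyConst_pos hm.nonneg hτ₁.le)) hK
  have hhalf : (7 : ℝ) + σ / 2 ≠ 0 := by linarith [hm.pos]
  have hradius (t) (ht : t ∈ Set.Icc 0 T) : τ₁ / 2 ≤ τ₁ - κ * t := by
    linarith [mul_le_mul_of_nonneg_left ht.2 hκ.le]
  have hderiv (t) (ht : t ∈ Set.Icc 0 T) := HasDerivWithinAt.fun_sum fun k hk =>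
    hasDerivWithinAt_sq_weightedCoeff (κ := κ) (τ₁ := τ₁) (v := -transport m (x t) (x t))
      (by norm_num) hhalf
      (hx.hasDerivWithinAt t ht k hk)
  have hsum (t : ℝ) := gevreyEnergy_eq_sum 7 σ (τ₁ - κ * t) (hx.eq_zero t)
  have henergy (t) (ht : t ∈ Set.Icc 0 T) : gevreyEnergy 7 σ (τ₁ - κ * t) (x t) ≤ K ^ 2 := by
    rw [hsum]
    refine image_le_of_deriv_right_lt_deriv_boundary
      (B := fun _ => K ^ 2) (B' := fun _ => 0) (fun t ht => (hderiv t ht).continuousWithinAt)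
      (fun t ht => (hderiv t ⟨ht.1, ht.2.le⟩).mono_of_mem_nhdsWithin (Icc_mem_nhdsGE_of_mem ht))
      ((hsum 0).symm.trans_le (by simpa using hinit)) (fun _ => hasDerivAt_const _ _)
      (fun t ht hE => ?_) ht
    exact hm.sum_energyRate_neg (by linarith [hradius t ⟨ht.1, ht.2.le⟩])
      (by linarith [mul_nonneg hκ.le ht.1]) (hx.eq_zero t) (hHerm t) hK ((hsum t).trans hE)
  exact fun t ht => hasDecay_of_weightedCoeff_le
    (weightedCoeff_le_of_gevreyEnergy_le (hx.eq_zero t) hK.le (henergy t ht)) (by norm_num)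
    (hradius t ht) (hx.eq_zero t 0 hF) hK.le

end GalerkinEnergy

section FourierExistence

variable {p σ M ρ τ K T : ℝ} {m : ℤ³ → Fin 3 → ℝ} {a : ℤ³ → ℂ} {x : ℝ → ℤ³ → ℂ} {F : Set ℤ³}

theorem IsTruncatedSolution.hasDecay_sub (hx : IsTruncatedSolution m F T x) {D : ℝ}
    (hD : ∀ t ∈ Set.Icc 0 T, HasDecay σ ρ D (transport m (x t) (x t))) {s t : ℝ}
    (hs : s ∈ Set.Icc 0 T) (ht : t ∈ Set.Icc 0 T) :
    HasDecay σ ρ (D * |t - s|) (x t - x s) := fun k => by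
  have hdecay := (expDecay_pos σ ρ k).le
  have hD0 := (hD s hs).nonneg
  have hst : Set.uIcc s t ⊆ Set.Icc 0 T := Set.uIcc_subset_Icc hs ht
  by_cases hk : k ∈ F
  · refine ((convex_uIcc s t).norm_image_sub_le_of_norm_hasDerivWithin_le
      (f := fun u => x u k) (C := D * expDecay σ ρ k)
      (fun u hu => (hx.hasDerivWithinAt u (hst hu) k hk).mono hst)
      (fun u hu => (norm_neg _).trans_le (hD u (hst hu) k))
      Set.left_mem_uIcc Set.right_mem_uIcc).trans_eq ?_
    rw [Real.norm_eq_abs]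
    ring
  · simp only [Pi.sub_apply, hx.eq_zero _ k hk, sub_self, norm_zero]
    positivity

theorem IsTransportSymbol.exists_hasDecay_transport_sub (hm : IsTransportSymbol σ M m)
    (hρ : 0 < ρ) (K : ℝ) : ∃ C : ℝ, 0 ≤ C ∧ ∀ (F : Set ℤ³) (T : ℝ) (x : ℝ → ℤ³ → ℂ),
      IsTruncatedSolution m F T x → (∀ t ∈ Set.Icc 0 T, HasDecay σ ρ K (x t)) →
      ∀ s ∈ Set.Icc 0 T, ∀ t ∈ Set.Icc 0 T, HasDecay σ (ρ / 4) (C * |t - s|)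
        (transport m (x t) (x t) - transport m (x s) (x s)) := by
  obtain ⟨C₁, hC₁, htransport₁⟩ :=
    hm.exists_hasDecay_transport (half_pos hρ) (half_lt_self hρ)
  obtain ⟨C₂, hC₂, htransport₂⟩ :=
    hm.exists_hasDecay_transport (ρ := ρ / 2) (ρ' := ρ / 4) (by linarith) (by linarith)
  refine ⟨2 * C₂ * C₁ * K ^ 2 * |K|, by positivity, fun F T x hx hK s hs t ht => ?_⟩
  have hdiff := hx.hasDecay_sub (fun u hu => htransport₁ K K _ _ (hK u hu) (hK u hu)) hs ht
  have hhalf (u) (hu : u ∈ Set.Icc 0 T) := (hK u hu).mono (half_le_self hρ.le) le_rfl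
  have hsplit : transport m (x t) (x t) - transport m (x s) (x s) =
      transport m (x t - x s) (x s) + transport m (x t) (x t - x s) :=
    funext (hm.transport_self_sub_transport_self hρ (hK t ht) (hK s hs))
  rw [hsplit]
  refine ((htransport₂ _ _ _ _ hdiff (hhalf s hs)).add
    (htransport₂ _ _ _ _ (hhalf t ht) hdiff)).mono le_rfl (le_of_eq ?_)
  rw [abs_of_nonneg (hK s hs).nonneg]
  ring

theorem IsTransportSymbol.exists_taylor_bound (hm : IsTransportSymbol σ M m) (hρ : 0 < ρ)
    (K : ℝ) : ∃ L : ℝ, 0 ≤ L ∧ ∀ (F : Set ℤ³) (T : ℝ) (x : ℝ → ℤ³ → ℂ),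
      IsTruncatedSolution m F T x → (∀ t ∈ Set.Icc 0 T, HasDecay σ ρ K (x t)) →
      ∀ s ∈ Set.Icc 0 T, ∀ t ∈ Set.Icc 0 T, ∀ k ∈ F,
        ‖x t k - x s k + (t - s) * transport m (x s) (x s) k‖ ≤
          L * expDecay σ (ρ / 4) k * (t - s) ^ 2 := by
  obtain ⟨L, hL, htransport⟩ := hm.exists_hasDecay_transport_sub hρ K
  refine ⟨L, hL, fun F T x hx hK s hs t ht k hk => ?_⟩
  have hst : Set.uIcc s t ⊆ Set.Icc 0 T := Set.uIcc_subset_Icc hs ht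
  have hderiv (u) (hu : u ∈ Set.uIcc s t) : HasDerivWithinAt
      (fun v : ℝ => x v k + (v - s) * transport m (x s) (x s) k)
      (-transport m (x u) (x u) k + transport m (x s) (x s) k) (Set.uIcc s t) u := by
    refine ((hx.hasDerivWithinAt u (hst hu) k hk).mono hst).add ?_
    simpa using ((Complex.ofRealCLM.hasDerivAt.sub_const (s : ℂ)).mul_const
      (transport m (x s) (x s) k)).hasDerivWithinAt (s := Set.uIcc s t) (x := u)
  have hbound (u) (hu : u ∈ Set.uIcc s t) :
      ‖-transport m (x u) (x u) k + transport m (x s) (x s) k‖ ≤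
        L * |t - s| * expDecay σ (ρ / 4) k := by
    rw [neg_add_eq_sub, norm_sub_rev]
    refine (htransport F T x hx hK s hs u (hst hu) k).trans ?_
    refine mul_le_mul_of_nonneg_right ?_ (expDecay_pos _ _ _).le
    exact mul_le_mul_of_nonneg_left (Set.abs_sub_left_of_mem_uIcc hu) hL
  have htaylor := (convex_uIcc s t).norm_image_sub_le_of_norm_hasDerivWithin_le hderiv hbound
    Set.left_mem_uIcc Set.right_mem_uIcc
  simp only [sub_self, zero_mul, add_zero] at htaylor
  rw [sub_add_eq_add_sub]
  refine htaylor.trans_eq ?_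
  rw [Real.norm_eq_abs, mul_right_comm L, mul_assoc _ |t - s|, abs_mul_abs_self, sq (t - s)]

/-- The wave vectors of sup norm at most `N`, without the zero mode. -/
def freqBox (N : ℕ) : Finset ℤ³ := (Finset.Icc (fun _ => -(N : ℤ)) fun _ => (N : ℤ)).erase 0

theorem zero_notMem_freqBox (N : ℕ) : 0 ∉ freqBox N := Finset.notMem_erase _ _

theorem neg_mem_freqBox (N : ℕ) : ∀ k ∈ freqBox N, -k ∈ freqBox N := fun k hk => by
  simp only [freqBox, Finset.mem_erase, Finset.mem_Icc, Pi.le_def, ne_eq, neg_eq_zero,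
    Pi.neg_apply] at hk ⊢
  exact ⟨hk.1, fun i => by linarith [hk.2.2 i], fun i => by linarith [hk.2.1 i]⟩

theorem eventually_mem_freqBox {k : ℤ³} (hk : k ≠ 0) : ∀ᶠ N : ℕ in atTop, k ∈ freqBox N := by
  filter_upwards [eventually_ge_atTop (∑ i, (k i).natAbs)] with N hN
  have habs (i : Fin 3) : |k i| ≤ N := by
    rw [Int.abs_eq_natAbs]
    exact_mod_cast (Finset.single_le_sum (f := fun i => (k i).natAbs) (fun _ _ => Nat.zero_le _)
      (Finset.mem_univ i)).trans hN
  simp only [freqBox, Finset.mem_erase, Finset.mem_Icc, Pi.le_def]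
  exact ⟨hk, fun i => (abs_le.1 (habs i)).1, fun i => (abs_le.1 (habs i)).2⟩

theorem HasDecay.gevreyEnergy_le (ha : HasDecay σ ρ K a) (hσ : 0 < σ) (hp : 0 < p) (hτ : τ < ρ) :
    gevreyEnergy p σ τ a ≤ (K * ∑' k : ℤ³, waveNorm k ^ p * expDecay σ (ρ - τ) k) ^ 2 := by
  have hnonneg (k : ℤ³) := weightedCoeff_nonneg p σ τ a k
  have hle : ∑' k, weightedCoeff p σ τ a k ≤ K * ∑' k, waveNorm k ^ p * expDecay σ (ρ - τ) k :=
    ha.tsum_weightedCoeff_le hσ hp le_rfl hτ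
  refine le_trans ?_ (pow_le_pow_left₀ (tsum_nonneg hnonneg) hle 2)
  have hcoeff := ha.summable_weightedCoeff hσ hp hτ
  rw [gevreyEnergy, sq (∑' _, _), ← tsum_mul_right]
  refine (ha.summable_sq_weightedCoeff hσ hp hτ).tsum_le_tsum (fun k => ?_) (hcoeff.mul_right _)
  rw [sq]
  exact mul_le_mul_of_nonneg_left (hcoeff.le_tsum k fun j _ => hnonneg j) (hnonneg k)

theorem IsTransportSymbol.exists_galerkin_solution_hasDecay (hm : IsTransportSymbol σ M m)
    (hρ : 0 < ρ) (hK : 0 < K) : ∃ T K₁ : ℝ, 0 < T ∧ ∀ a : ℤ³ → ℂ, Hermitian a →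
      HasDecay σ ρ K a → ∀ F : Finset ℤ³, 0 ∉ F → (∀ k ∈ F, -k ∈ F) →
        ∃ x : ℝ → ℤ³ → ℂ, IsTruncatedSolution m F T x ∧ (∀ k ∈ F, x 0 k = a k) ∧
          (∀ t, Hermitian (x t)) ∧ ∀ t ∈ Set.Icc 0 T, HasDecay σ (ρ / 4) K₁ (x t) := by
  have hτ := half_pos hρ
  have hC := energyConst_pos hm.nonneg hτ.le
  let S := ∑' k : ℤ³, waveNorm k ^ (7 : ℝ) * expDecay σ (ρ - ρ / 2) k
  have hS : 0 ≤ S := tsum_nonneg fun k =>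
    mul_nonneg (Real.rpow_nonneg (waveNorm_nonneg k) _) (expDecay_pos _ _ _).le
  let K₁ := K * (S + 1)
  have hK₁ : 0 < K₁ := by positivity
  have hT : 0 < ρ / 2 / (2 * (2 * energyConst M (ρ / 2) * K₁)) := by positivity
  refine ⟨_, K₁, hT, fun a hHa ha F hF0 hF => ?_⟩
  obtain ⟨x, hx, hx0, hHerm⟩ := hm.exists_galerkin_solution hF hHa hT.le
  have hx0_decay : HasDecay σ ρ K (x 0) := fun k => by
    by_cases hk : k ∈ F
    · exact hx0 k hk ▸ ha k
    · rw [hx.eq_zero 0 k hk, norm_zero]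
      exact mul_nonneg hK.le (expDecay_pos _ _ _).le
  have hinit : gevreyEnergy 7 σ (ρ / 2) (x 0) ≤ K₁ ^ 2 :=
    (hx0_decay.gevreyEnergy_le hm.pos (by norm_num) (half_lt_self hρ)).trans
      (pow_le_pow_left₀ (mul_nonneg hK.le hS)
        (mul_le_mul_of_nonneg_left (le_add_of_nonneg_right zero_le_one) hK.le) 2)
  refine ⟨x, hx, hx0, hHerm, ?_⟩
  rw [(by ring : ρ / 4 = ρ / 2 / 2)]
  exact hm.hasDecay_galerkin hτ hK₁ (mul_div_cancel₀ _ (by positivity)).le hF0 hx hHerm hinit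

theorem exists_tendsto_hyperfilter_of_hasDecay {X : Type*} {S : Set X} {c : ℕ → X → ℤ³ → ℂ}
    (hc : ∀ N, ∀ t ∈ S, HasDecay σ ρ K (c N t)) : ∃ b : X → ℤ³ → ℂ,
      ∀ t ∈ S, ∀ k, Tendsto (fun N => c N t k) (hyperfilter ℕ : Filter ℕ) (𝓝 (b t k)) := by
  have hlim (t : X) (k : ℤ³) : ∃ z : ℂ, t ∈ S →
      Tendsto (fun N => c N t k) (hyperfilter ℕ : Filter ℕ) (𝓝 z) := by
    by_cases ht : t ∈ S
    · obtain ⟨z, -, hz⟩ := (isCompact_closedBall (0 : ℂ) (K * expDecay σ ρ k)).ultrafilter_le_nhds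
        ((hyperfilter ℕ).map fun N => c N t k) (le_principal_iff.2 (Ultrafilter.mem_map.2
          (Eventually.of_forall fun N => mem_closedBall_zero_iff.2 (hc N t ht k))))
      exact ⟨z, fun _ => hz⟩
    · exact ⟨0, fun h => absurd h ht⟩
  choose b hb using hlim
  exact ⟨b, fun t ht k => hb t k ht⟩

theorem IsTransportSymbol.tendsto_transport (hm : IsTransportSymbol σ M m) (hρ : 0 < ρ)
    {ι : Type*} {l : Filter ι} {c : ι → ℤ³ → ℂ} {b : ℤ³ → ℂ} (hc : ∀ i, HasDecay σ ρ K (c i))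
    (hcb : ∀ k, Tendsto (fun i => c i k) l (𝓝 (b k))) (k : ℤ³) :
    Tendsto (fun i => transport m (c i) (c i) k) l (𝓝 (transport m b b k)) := by
  rw [← zero_add ρ] at hc
  exact tendsto_tsum_of_dominated_convergence
    ((summable_pow_mul_expDecay hm.pos hρ 1).mul_left _)
    (fun j => (tendsto_const_nhds.mul (hcb j)).mul (hcb (k - j)))
    (Eventually.of_forall fun i j => hm.norm_transportTerm_le le_rfl hρ.le (hc i) (hc i) k j)

/-- A solution on `[0,T]` of the full Fourier system with datum `a`, decaying uniformly in time.
The equation is encoded by a second-order Taylor bound, which unlike a derivative passes to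
pointwise limits and can be summed over `k`. -/
structure IsFourierSolution (m : ℤ³ → Fin 3 → ℝ) (σ T ρ K L : ℝ) (a : ℤ³ → ℂ)
    (x : ℝ → ℤ³ → ℂ) : Prop where
  initial : x 0 = a
  hermitian : ∀ t ∈ Set.Icc 0 T, Hermitian (x t)
  apply_zero : ∀ t ∈ Set.Icc 0 T, x t 0 = 0
  hasDecay : ∀ t ∈ Set.Icc 0 T, HasDecay σ ρ K (x t)
  taylor : ∀ s ∈ Set.Icc 0 T, ∀ t ∈ Set.Icc 0 T, ∀ k,
    ‖x t k - x s k + (t - s) * transport m (x s) (x s) k‖ ≤ L * expDecay σ ρ k * (t - s) ^ 2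

theorem IsTransportSymbol.exists_isFourierSolution (hm : IsTransportSymbol σ M m) (hρ : 0 < ρ)
    (hK : 0 < K) : ∃ T ρ₁ K₁ L : ℝ, 0 < T ∧ 0 < ρ₁ ∧ ∀ a : ℤ³ → ℂ, Hermitian a → a 0 = 0 →
      HasDecay σ ρ K a → ∃ x, IsFourierSolution m σ T ρ₁ K₁ L a x := by
  obtain ⟨T, K₁, hT, hgalerkin⟩ := hm.exists_galerkin_solution_hasDecay hρ hK
  have hρ₁ : 0 < ρ / 4 := by positivity
  obtain ⟨L, hL, htaylor⟩ := hm.exists_taylor_bound hρ₁ K₁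
  refine ⟨T, ρ / 4 / 4, K₁, L, hT, by positivity, fun a hHa ha0 ha => ?_⟩
  choose x hx hinit hHerm hdecay using
    fun N => hgalerkin a hHa ha (freqBox N) (zero_notMem_freqBox N) (neg_mem_freqBox N)
  obtain ⟨b, hb⟩ := exists_tendsto_hyperfilter_of_hasDecay hdecay
  have hmem {k : ℤ³} (hk : k ≠ 0) : ∀ᶠ N in (hyperfilter ℕ : Filter ℕ), k ∈ freqBox N :=
    (eventually_mem_freqBox hk).filter_mono Nat.hyperfilter_le_atTop
  have hzero (t) (ht : t ∈ Set.Icc 0 T) : b t 0 = 0 :=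
    tendsto_nhds_unique (hb t ht 0)
      (tendsto_const_nhds.congr fun N => ((hx N).eq_zero t 0 (zero_notMem_freqBox N)).symm)
  refine ⟨b, ?_, fun t ht k => ?_, hzero, fun t ht k => ?_, fun s hs t ht k => ?_⟩
  · funext k
    rcases eq_or_ne k 0 with rfl | hk
    · rw [hzero 0 ⟨le_rfl, hT.le⟩, ha0]
    · refine tendsto_nhds_unique (hb 0 ⟨le_rfl, hT.le⟩ k) (tendsto_const_nhds.congr' ?_)
      filter_upwards [hmem hk] with N hN using (hinit N k hN).symm
  · exact tendsto_nhds_unique (hb t ht (-k)) (((Complex.continuous_conj.tendsto _).comp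
      (hb t ht k)).congr fun N => (hHerm N t k).symm)
  · exact le_of_tendsto (hb t ht k).norm (Eventually.of_forall fun N =>
      (hdecay N t ht).mono (by linarith) le_rfl k)
  · rcases eq_or_ne k 0 with rfl | hk
    · rw [hzero t ht, hzero s hs, transport_zero, sub_self, mul_zero, add_zero, norm_zero]
      exact mul_nonneg (mul_nonneg hL (expDecay_pos _ _ _).le) (sq_nonneg _)
    · have htransport := hm.tendsto_transport hρ₁ (fun N => hdecay N s hs) (hb s hs) k
      refine le_of_tendsto (((hb t ht k).sub (hb s hs k)).add (htransport.const_mul _)).norm ?_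
      filter_upwards [hmem hk] with N hN
      exact htaylor (freqBox N) T (x N) (hx N) (hdecay N) s hs t ht k hN

end FourierExistence

section Uniqueness

variable {p σ M ρ ρ' τ κ T K K' : ℝ} {m : ℤ³ → Fin 3 → ℝ}

theorem HasDecay.weightedCoeff_le_of_le {τ₁ : ℝ} {a : ℤ³ → ℂ} (ha : HasDecay σ ρ K a) (p : ℝ)
    (hτ : τ ≤ τ₁) (k : ℤ³) :
    weightedCoeff p σ τ a k ≤ K * (waveNorm k ^ p * expDecay σ (ρ - τ₁) k) :=
  (ha.weightedCoeff_le p τ k).trans (mul_le_mul_of_nonneg_left (mul_le_mul_of_nonneg_left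
    (expDecay_anti (by linarith) k) (Real.rpow_nonneg (waveNorm_nonneg k) _)) ha.nonneg)

theorem neg_energyRate_le {a v : ℤ³ → ℂ} {k : ℤ³} {x y z : ℝ} (hκ : 0 ≤ κ)
    (hx : weightedCoeff (p + σ / 2) σ τ a k ≤ x) (hy : weightedCoeff p σ τ a k ≤ y)
    (hz : weightedCoeff p σ τ v k ≤ z) :
    -energyRate p σ κ τ a v k ≤ 2 * κ * (x * x) + 2 * (y * z) := by
  have hsq : weightedCoeff (p + σ / 2) σ τ a k ^ 2 ≤ x * x := by
    rw [← sq]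
    exact pow_le_pow_left₀ (weightedCoeff_nonneg _ _ _ _ _) hx 2
  have hwork : |gevreyWeight p σ τ k ^ 2 * (conj (a k) * v k).re| ≤ y * z :=
    calc |gevreyWeight p σ τ k ^ 2 * (conj (a k) * v k).re|
        ≤ gevreyWeight p σ τ k ^ 2 * (‖a k‖ * ‖v k‖) := by
          rw [abs_mul, abs_of_nonneg (sq_nonneg _)]
          refine mul_le_mul_of_nonneg_left ((Complex.abs_re_le_norm _).trans_eq ?_) (sq_nonneg _)
          rw [norm_mul, RCLike.norm_conj]
      _ = weightedCoeff p σ τ a k * weightedCoeff p σ τ v k := by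
          rw [weightedCoeff, weightedCoeff]
          ring
      _ ≤ y * z := mul_le_mul hy hz (weightedCoeff_nonneg _ _ _ _ _)
          ((weightedCoeff_nonneg _ _ _ _ _).trans hy)
  have hdissipation := mul_le_mul_of_nonneg_left hsq (by positivity : 0 ≤ 2 * κ)
  rw [energyRate]
  linarith [neg_le_of_abs_le hwork]

theorem exists_summable_neg_energyRate_le {τ₁ : ℝ} (hσ : 0 < σ) (hp : 0 < p) (hκ : 0 ≤ κ)
    (hK : 0 ≤ K) (hK' : 0 ≤ K') (hρ : τ₁ < ρ) (hρ' : τ₁ < ρ') :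
    ∃ g : ℤ³ → ℝ, Summable g ∧ ∀ a v : ℤ³ → ℂ, HasDecay σ ρ K a → HasDecay σ ρ' K' v →
      ∀ τ ≤ τ₁, ∀ k, -energyRate p σ κ τ a v k ≤ g k := by
  have hsummable (q : ℝ) (hq : 0 < q) (r : ℝ) (hr : τ₁ < r) (C : ℝ) :
      Summable fun k : ℤ³ => C * (waveNorm k ^ q * expDecay σ (r - τ₁) k) :=
    (summable_rpow_mul_expDecay hσ (sub_pos.2 hr) hq).mul_left C
  have hnonneg (q r : ℝ) (C : ℝ) (hC : 0 ≤ C) (k : ℤ³) :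
      0 ≤ C * (waveNorm k ^ q * expDecay σ (r - τ₁) k) :=
    mul_nonneg hC (mul_nonneg (Real.rpow_nonneg (waveNorm_nonneg k) _) (expDecay_pos _ _ _).le)
  have hhalf := hsummable (p + σ / 2) (by positivity) ρ hρ K
  have hhalf0 := hnonneg (p + σ / 2) ρ K hK
  refine ⟨_, ((summable_mul_of_nonneg hhalf hhalf hhalf0 hhalf0).mul_left (2 * κ)).add
    ((summable_mul_of_nonneg (hsummable p hp ρ hρ K) (hsummable p hp ρ' hρ' K')
      (hnonneg p ρ K hK) (hnonneg p ρ' K' hK')).mul_left 2), fun a v ha hv τ hτ k => ?_⟩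
  exact neg_energyRate_le hκ (ha.weightedCoeff_le_of_le _ hτ k) (ha.weightedCoeff_le_of_le _ hτ k)
    (hv.weightedCoeff_le_of_le _ hτ k)

theorem IsTransportSymbol.exists_hasSum_energyRate_sub_nonpos (hm : IsTransportSymbol σ M m)
    (hτ : 0 ≤ τ) (hρ : τ < ρ) {a b : ℤ³ → ℂ} (ha : HasDecay σ ρ K a) (hb : HasDecay σ ρ K' b)
    (hHa : Hermitian a)
    (hκ : M * (2 ^ 8 * (7 + τ)) * (2 * ∑' k, weightedCoeff (7 + σ / 2) σ τ a k) +
      M * 2 ^ 8 * ∑' k, weightedCoeff 9 σ τ b k ≤ κ) :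
    ∃ S ≤ 0, HasSum (energyRate 7 σ κ τ (a - b) (transport m b b - transport m a a)) S := by
  have hρ0 := hτ.trans_lt hρ
  have hd := ha.sub hb
  have htransport := hm.abs_tsum_pairing_transport_le hτ hρ ha hd hHa
  have hcoupling := hm.abs_tsum_pairing_coupling_le hτ hρ hb hd
  have hsum_transport := hasSum_sq_mul_re_conj_mul_transport
    (hm.summable_pairing hτ hρ ha hd) (hm.summable_transportTerm hρ0 ha hd)
  have hsum_coupling := hasSum_sq_mul_re_conj_mul_transport
    (hm.summable_pairing_coupling hτ hρ hb hd) (hm.summable_transportTerm hρ0 hd hb)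
  have hdissipation := (hd.summable_sq_weightedCoeff hm.pos
    (by linarith [hm.pos] : 0 < 7 + σ / 2) hρ).hasSum
  refine ⟨_, ?_, ((hdissipation.mul_left (-(2 * κ))).add
    ((hsum_coupling.add hsum_transport).mul_left (-2))).congr_fun fun k => ?_⟩
  · rw [← gevreyEnergy]
    have := mul_le_mul_of_nonneg_right hκ (gevreyEnergy_nonneg (7 + σ / 2) σ τ (a - b))
    linarith [neg_le_of_abs_le htransport, neg_le_of_abs_le hcoupling]
  · have hsplit := hm.transport_self_sub_transport_self hρ0 ha hb k
    rw [energyRate, Pi.sub_apply (transport m b b), ← neg_sub (transport m a a k), hsplit]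
    simp only [mul_neg, mul_add, Complex.neg_re, Complex.add_re]
    ring

theorem IsTransportSymbol.exists_hasSum_energyRate_sub_nonpos_of_le (hm : IsTransportSymbol σ M m)
    {τ₁ : ℝ} (hρ : τ₁ < ρ) (hK : 0 ≤ K) : ∃ κ : ℝ, 0 < κ ∧ ∀ a b : ℤ³ → ℂ, Hermitian a →
      HasDecay σ ρ K a → HasDecay σ ρ K b → ∀ τ, 0 ≤ τ → τ ≤ τ₁ →
        ∃ S ≤ 0, HasSum (energyRate 7 σ κ τ (a - b) (transport m b b - transport m a a)) S := by
  have hM := hm.nonneg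
  have hσ := hm.pos
  have hS (q : ℝ) : 0 ≤ ∑' k : ℤ³, waveNorm k ^ q * expDecay σ (ρ - τ₁) k :=
    tsum_nonneg fun k =>
      mul_nonneg (Real.rpow_nonneg (waveNorm_nonneg k) _) (expDecay_pos _ _ _).le
  have hS₁ := mul_nonneg hK (hS (7 + σ / 2))
  have hS₂ := mul_nonneg hK (hS 9)
  refine ⟨M * (2 ^ 8 * (7 + |τ₁|)) *
      (2 * (K * ∑' k : ℤ³, waveNorm k ^ (7 + σ / 2) * expDecay σ (ρ - τ₁) k)) +
      M * 2 ^ 8 * (K * ∑' k : ℤ³, waveNorm k ^ (9 : ℝ) * expDecay σ (ρ - τ₁) k) + 1,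
    by positivity, fun a b hHa ha hb τ hτ hτ₁ => ?_⟩
  refine hm.exists_hasSum_energyRate_sub_nonpos hτ (hτ₁.trans_lt hρ) ha hb hHa ?_
  have hA := ha.tsum_weightedCoeff_le hσ (by positivity : 0 < 7 + σ / 2) hτ₁ hρ
  have hB := hb.tsum_weightedCoeff_le hσ (by norm_num : (0 : ℝ) < 9) hτ₁ hρ
  have hτ₁' : τ ≤ |τ₁| := hτ₁.trans (le_abs_self τ₁)
  have hA0 : 0 ≤ ∑' k, weightedCoeff (7 + σ / 2) σ τ a k :=
    tsum_nonneg fun k => weightedCoeff_nonneg _ _ _ _ _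
  refine le_trans ?_ (le_add_of_nonneg_right zero_le_one)
  gcongr

/- Only finite sums of squared coefficients can be differentiated in time term by term. The total
energy rate is nonpositive, so a finite sum of rates exceeds zero by at most a tail of `g`. -/
theorem IsTransportSymbol.exists_sum_energyRate_sub_le (hm : IsTransportSymbol σ M m)
    (hρ : 0 < ρ) (hK : 0 ≤ K) : ∃ κ : ℝ, 0 < κ ∧ ∃ g : ℤ³ → ℝ, Summable g ∧
      ∀ a b : ℤ³ → ℂ, Hermitian a → HasDecay σ ρ K a → HasDecay σ ρ K b →
        ∀ τ, 0 ≤ τ → τ ≤ ρ / 4 → ∀ F : Finset ℤ³,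
          ∑ k ∈ F, energyRate 7 σ κ τ (a - b) (transport m b b - transport m a a) k ≤
            ∑' k, g k - ∑ k ∈ F, g k := by
  obtain ⟨κ, hκ, hrate⟩ :=
    hm.exists_hasSum_energyRate_sub_nonpos_of_le (by linarith : ρ / 4 < ρ) hK
  obtain ⟨C, hC, htransport⟩ :=
    hm.exists_hasDecay_transport (half_pos hρ) (half_lt_self hρ)
  obtain ⟨g, hg, hle⟩ := exists_summable_neg_energyRate_le (p := 7) (K := K + K)
    (K' := C * (K * K) + C * (K * K)) hm.pos (by norm_num) hκ.le (by positivity) (by positivity)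
    (by linarith : ρ / 4 < ρ) (by linarith : ρ / 4 < ρ / 2)
  refine ⟨κ, hκ, g, hg, fun a b hHa ha hb τ hτ hτρ F => ?_⟩
  obtain ⟨S, hS, hsum⟩ := hrate a b hHa ha hb τ hτ hτρ
  have hge (k : ℤ³) := hle _ _ (ha.sub hb)
    ((htransport K K b b hb hb).sub (htransport K K a a ha ha)) τ hτρ k
  have htail := sum_le_hasSum F (fun k _ => neg_le_iff_add_nonneg'.1 (hge k)) (hsum.add hg.hasSum)
  rw [Finset.sum_add_distrib] at htail
  linarith

theorem sum_sq_weightedCoeff_le {t₀ t₁ τ₁ C : ℝ} {d v : ℝ → ℤ³ → ℂ} {F : Finset ℤ³} (hp : 0 < p)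
    (hpσ : p + σ / 2 ≠ 0) (hd : ∀ t ∈ Set.Icc t₀ t₁, ∀ k ∈ F,
      HasDerivWithinAt (fun u => d u k) (v t k) (Set.Icc t₀ t₁) t) (h0 : d t₀ = 0)
    (hrate : ∀ t ∈ Set.Icc t₀ t₁, ∑ k ∈ F, energyRate p σ κ (τ₁ - κ * t) (d t) (v t) k ≤ C)
    (ht : t₀ ≤ t₁) :
    ∑ k ∈ F, weightedCoeff p σ (τ₁ - κ * t₁) (d t₁) k ^ 2 ≤ C * (t₁ - t₀) := by
  have hderiv (t) (ht : t ∈ Set.Icc t₀ t₁) := HasDerivWithinAt.fun_sum fun k hk =>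
    hasDerivWithinAt_sq_weightedCoeff (κ := κ) (τ₁ := τ₁) hp hpσ (hd t ht k hk)
  refine image_le_of_deriv_right_le_deriv_boundary
    (f := fun t => ∑ k ∈ F, weightedCoeff p σ (τ₁ - κ * t) (d t) k ^ 2)
    (B := fun t => C * (t - t₀)) (B' := fun _ => C)
    (fun t ht => (hderiv t ht).continuousWithinAt)
    (fun t ht => (hderiv t ⟨ht.1, ht.2.le⟩).mono_of_mem_nhdsWithin (Icc_mem_nhdsGE_of_mem ht))
    ?_ (by fun_prop) (fun t _ => ?_) (fun t ht => hrate t ⟨ht.1, ht.2.le⟩) ⟨ht, le_rfl⟩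
  · simp [h0, weightedCoeff_eq_zero]
  · simpa using (((hasDerivAt_id t).sub_const t₀).const_mul C).hasDerivWithinAt

theorem eq_zero_of_sum_sq_weightedCoeff_le {g : ℤ³ → ℝ} {d : ℤ³ → ℂ} {C : ℝ} (hg : Summable g)
    (hd : ∀ F : Finset ℤ³, ∑ k ∈ F, weightedCoeff p σ τ d k ^ 2 ≤
      (∑' k, g k - ∑ k ∈ F, g k) * C) {k : ℤ³} (hk : k ≠ 0) : d k = 0 := by
  have hlim : Tendsto (fun F : Finset ℤ³ => (∑' k, g k - ∑ k ∈ F, g k) * C) atTop (𝓝 0) := by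
    simpa using ((tendsto_const_nhds (x := ∑' k, g k)).sub hg.hasSum).mul_const C
  have hle : weightedCoeff p σ τ d k ^ 2 ≤ 0 := by
    refine ge_of_tendsto hlim ?_
    filter_upwards [eventually_ge_atTop {k}] with F hF
    exact (Finset.single_le_sum (f := fun k => weightedCoeff p σ τ d k ^ 2)
      (fun _ _ => sq_nonneg _) (hF (Finset.mem_singleton_self k))).trans (hd F)
  have hweight : 0 < gevreyWeight p σ τ k :=
    mul_pos (Real.rpow_pos_of_pos (one_pos.trans_le (one_le_waveNorm hk)) _) (Real.exp_pos _)
  have hzero := pow_eq_zero_iff two_ne_zero |>.1 (le_antisymm hle (sq_nonneg _))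
  exact norm_eq_zero.1 ((mul_eq_zero.1 hzero).resolve_left hweight.ne')

theorem forall_mem_Icc_of_forall_step {P : ℝ → Prop} {δ : ℝ} (hδ : 0 < δ) (h0 : P 0)
    (hstep : ∀ s ∈ Set.Icc 0 T, P s → ∀ t ∈ Set.Icc s T, t ≤ s + δ → P t) :
    ∀ t ∈ Set.Icc 0 T, P t := by
  have hind (n : ℕ) : ∀ t ∈ Set.Icc 0 T, t ≤ n * δ → P t := by
    induction n with
    | zero =>
      intro t ht h
      rwa [le_antisymm (by simpa using h) ht.1]
    | succ n ih =>
      intro t ht h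
      rcases le_total t (n * δ) with hle | hge
      · exact ih t ht hle
      · have hmem : n * δ ∈ Set.Icc 0 T := ⟨by positivity, hge.trans ht.2⟩
        refine hstep _ hmem (ih _ hmem le_rfl) t ⟨hge, ht.2⟩ (h.trans_eq ?_)
        push_cast
        ring
  intro t ht
  obtain ⟨n, hn⟩ := exists_nat_ge (t / δ)
  exact hind n t ht ((div_le_iff₀ hδ).1 hn)

theorem IsTransportSymbol.fourier_unique (hm : IsTransportSymbol σ M m) (hρ : 0 < ρ)
    {a b : ℝ → ℤ³ → ℂ} (hHa : ∀ t ∈ Set.Icc 0 T, Hermitian (a t))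
    (ha : ∀ t ∈ Set.Icc 0 T, HasDecay σ ρ K (a t)) (hb : ∀ t ∈ Set.Icc 0 T, HasDecay σ ρ K (b t))
    (hzero : ∀ t ∈ Set.Icc 0 T, a t 0 = b t 0)
    (ha' : ∀ t ∈ Set.Icc 0 T, ∀ k,
      HasDerivWithinAt (fun u => a u k) (-transport m (a t) (a t) k) (Set.Icc 0 T) t)
    (hb' : ∀ t ∈ Set.Icc 0 T, ∀ k,
      HasDerivWithinAt (fun u => b u k) (-transport m (b t) (b t) k) (Set.Icc 0 T) t)
    (hinit : a 0 = b 0) {t : ℝ} (ht : t ∈ Set.Icc 0 T) : a t = b t := by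
  obtain ⟨κ, hκ, g, hg, hrate⟩ := hm.exists_sum_energyRate_sub_le hρ (ha t ht).nonneg
  have hδ : κ * (ρ / 4 / κ) = ρ / 4 := mul_div_cancel₀ _ hκ.ne'
  refine forall_mem_Icc_of_forall_step (P := fun t => a t = b t)
    (div_pos (by positivity : 0 < ρ / 4) hκ) hinit (fun t₀ ht₀ heq t₁ ht₁ hstep => ?_) t ht
  have hsub : Set.Icc t₀ t₁ ⊆ Set.Icc 0 T := Set.Icc_subset_Icc ht₀.1 ht₁.2
  funext k
  rcases eq_or_ne k 0 with rfl | hk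
  · exact hzero t₁ (hsub ⟨ht₁.1, le_rfl⟩)
  refine sub_eq_zero.1 (eq_zero_of_sum_sq_weightedCoeff_le (p := 7) (σ := σ) (d := a t₁ - b t₁)
    (τ := ρ / 4 + κ * t₀ - κ * t₁) (C := t₁ - t₀) hg (fun F => ?_) hk)
  refine sum_sq_weightedCoeff_le (d := fun u => a u - b u)
    (v := fun u => transport m (b u) (b u) - transport m (a u) (a u)) (by norm_num)
    (by linarith [hm.pos]) (fun u hu k _ => ?_) (sub_eq_zero.2 heq) (fun u hu => ?_) ht₁.1
  · rw [Pi.sub_apply, ← neg_sub_neg]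
    exact ((ha' u (hsub hu) k).mono hsub).sub ((hb' u (hsub hu) k).mono hsub)
  · have hu0 := mul_le_mul_of_nonneg_left hu.1 hκ.le
    have hu1 := mul_le_mul_of_nonneg_left (hu.2.trans hstep) hκ.le
    exact hrate _ _ (hHa u (hsub hu)) (ha u (hsub hu)) (hb u (hsub hu)) _ (by linarith)
      (by linarith) F

end Uniqueness

section TorusFourierSeries

open scoped Pointwise

attribute [local instance] instMeasureSpaceUnitAddCircle

local instance : IsProbabilityMeasure (volume : Measure UnitAddCircle) :=
  inferInstanceAs (IsProbabilityMeasure AddCircle.haarAddCircle)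

variable {a b : ℤ³ → ℂ} {f : ℝ³ → ℝ}

/-- The exponential `e^{ik·x}`. -/
def expMode (k : ℤ³) (x : ℝ³) : ℂ := Complex.exp (Complex.I * (phase k x : ℂ))

/-- The Fourier series `∑_k a_k e^{ik·x}`. -/
def fourierSeries (a : ℤ³ → ℂ) (x : ℝ³) : ℂ := ∑' k, a k * expMode k x

theorem norm_expMode (k : ℤ³) (x : ℝ³) : ‖expMode k x‖ = 1 := by
  rw [expMode, mul_comm, Complex.norm_exp_ofReal_mul_I]

theorem expMode_neg (k : ℤ³) (x : ℝ³) : expMode (-k) x = conj (expMode k x) := by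
  simp [expMode, phase_neg, ← Complex.exp_conj, Complex.conj_ofReal]

theorem phase_add (j k : ℤ³) (x : ℝ³) : phase (j + k) x = phase j x + phase k x := by
  simp [phase, add_mul, Finset.sum_add_distrib]

theorem expMode_add (j k : ℤ³) (x : ℝ³) : expMode (j + k) x = expMode j x * expMode k x := by
  rw [expMode, expMode, expMode, ← Complex.exp_add, phase_add, Complex.ofReal_add, mul_add]

theorem summable_mul_expMode (ha : Summable fun k => ‖a k‖) (x : ℝ³) :
    Summable fun k => a k * expMode k x :=
  Summable.of_norm (by simpa [norm_expMode] using ha)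

theorem fourierSeries_im (ha : Hermitian a) (x : ℝ³) : (fourierSeries a x).im = 0 := by
  rw [← Complex.conj_eq_iff_im, fourierSeries, Complex.conj_tsum, ← (Equiv.neg ℤ³).tsum_eq]
  refine tsum_congr fun k => ?_
  simp [ha k, expMode_neg]

theorem ofReal_re_fourierSeries (ha : Hermitian a) (x : ℝ³) :
    ((fourierSeries a x).re : ℂ) = fourierSeries a x :=
  Complex.ext rfl (by rw [Complex.ofReal_im, fourierSeries_im ha])

theorem expMode_periodic (k : ℤ³) (x : ℝ³) (i : Fin 3) :
    expMode k (x + Pi.single i (2 * Real.pi)) = expMode k x := by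
  have hphase : phase k (x + Pi.single i (2 * Real.pi)) = phase k x + k i * (2 * Real.pi) := by
    simp [phase, mul_add, Finset.sum_add_distrib, Pi.single_apply]
  rw [expMode, hphase, expMode, ← mul_one (Complex.exp (Complex.I * phase k x)),
    ← Complex.exp_int_mul_two_pi_mul_I (k i), ← Complex.exp_add]
  push_cast
  ring_nf

theorem fourierSeries_periodic (a : ℤ³ → ℂ) : TorusPeriodic fun x => (fourierSeries a x).re :=
  fun x i => by simp only [fourierSeries, expMode_periodic]

/-- The covering map `y ↦ y mod ℤ³` onto the unit torus. The torus `[0,2π]³` of the statement is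
compared with it through `x = 2πy`. -/
def torusMk : C(ℝ³, UnitAddTorus (Fin 3)) where
  toFun y i := (y i : UnitAddCircle)
  continuous_toFun := continuous_pi fun i => (AddCircle.continuous_mk' 1).comp (continuous_apply i)

theorem isQuotientMap_torusMk : IsQuotientMap torusMk :=
  (IsOpenQuotientMap.piMap (f := fun (_ : Fin 3) (y : ℝ) => (y : UnitAddCircle))
    fun _ => QuotientAddGroup.isOpenQuotientMap_mk).isQuotientMap

theorem mFourier_torusMk (k : ℤ³) (y : ℝ³) :
    UnitAddTorus.mFourier k (torusMk y) = expMode k ((2 * Real.pi) • y) := by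
  have hprod : ∏ i : Fin 3, fourier (k i) ((y i : ℝ) : UnitAddCircle) =
      ∏ i : Fin 3, Complex.exp (2 * Real.pi * Complex.I * (k i) * (y i) / (1 : ℝ)) :=
    Finset.prod_congr rfl fun i _ => fourier_coe_apply
  refine hprod.trans ?_
  rw [ ← Complex.exp_sum, expMode, phase, Complex.ofReal_sum, Finset.mul_sum]
  congr 1
  refine Finset.sum_congr rfl fun i _ => ?_
  simp only [Pi.smul_apply, smul_eq_mul, Complex.ofReal_mul, Complex.ofReal_ofNat,
    Complex.ofReal_one, Complex.ofReal_intCast, div_one]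
  ring

theorem TorusPeriodic.add_zsmul (hf : TorusPeriodic f) (i : Fin 3) (n : ℤ) (x : ℝ³) :
    f (x + n • Pi.single i (2 * Real.pi)) = f x :=
  Function.Periodic.zsmul (fun x => hf x i) n x

theorem TorusPeriodic.factorsThrough (hf : TorusPeriodic f) :
    Function.FactorsThrough (fun y : ℝ³ => (f ((2 * Real.pi) • y) : ℂ)) torusMk := by
  intro y z hyz
  have hinteger (i : Fin 3) : ∃ n : ℤ, (n : ℝ) = y i - z i := by
    have hcoe : ((y i : ℝ) : UnitAddCircle) = ((z i : ℝ) : UnitAddCircle) := congrFun hyz i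
    simpa using (AddCircle.coe_eq_zero_iff (1 : ℝ) (x := y i - z i)).1
      (by rw [AddCircle.coe_sub, hcoe, sub_self])
  choose n hn using hinteger
  have hy : (2 * Real.pi) • y = (2 * Real.pi) • z + n 0 • Pi.single 0 (2 * Real.pi) +
      n 1 • Pi.single 1 (2 * Real.pi) + n 2 • Pi.single 2 (2 * Real.pi) := by
    funext i
    fin_cases i <;> simp [hn] <;> ring
  simp only [hy, hf.add_zsmul]

theorem TorusPeriodic.exists_lift (hf : TorusPeriodic f) (hc : Continuous f) :
    ∃ G : C(UnitAddTorus (Fin 3), ℂ), ∀ y, G (torusMk y) = (f ((2 * Real.pi) • y) : ℂ) := by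
  let g : C(ℝ³, ℂ) := ⟨fun y => (f ((2 * Real.pi) • y) : ℂ), by fun_prop⟩
  exact ⟨isQuotientMap_torusMk.lift g hf.factorsThrough,
    DFunLike.congr_fun (isQuotientMap_torusMk.lift_comp g hf.factorsThrough)⟩

theorem integral_unitAddTorus (H : UnitAddTorus (Fin 3) → ℂ) {h : ℝ³ → ℂ}
    (hH : ∀ y, H (torusMk y) = h ((2 * Real.pi) • y)) :
    ∫ z, H z = ((2 * Real.pi : ℝ) : ℂ)⁻¹ ^ 3 *
      ∫ x in Set.Icc (0 : ℝ³) (fun _ => 2 * Real.pi), h x := by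
  have hpi : (0 : ℝ) < 2 * Real.pi := by positivity
  have hcube : {x : ℝ³ | ∀ i, x i ∈ Set.Ioc ((0 : ℝ³) i) ((0 : ℝ³) i + 1)} =
      Set.univ.pi fun i => Set.Ioc ((0 : ℝ³) i) ((1 : ℝ³) i) := by
    ext x; simp
  have hscale : (2 * Real.pi) • Set.Icc (0 : ℝ³) 1 = Set.Icc 0 fun _ => 2 * Real.pi := by
    refine ((OrderIso.smulRight hpi).image_Icc (0 : ℝ³) 1).trans ?_
    congr 1
    · exact smul_zero (2 * Real.pi)
    · exact funext fun _ => mul_one _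
  have hH' : ∀ y : ℝ³, H (fun i => (y i : UnitAddCircle)) = h ((2 * Real.pi) • y) := hH
  rw [UnitAddTorus.integral_preimage H 0, hcube, volume_pi,
    setIntegral_congr_set Measure.univ_pi_Ioc_ae_eq_Icc, ← volume_pi]
  simp only [hH']
  rw [Measure.setIntegral_comp_smul_of_pos volume h _ hpi, hscale, Module.finrank_fin_fun,
    Complex.real_smul, Complex.ofReal_inv, Complex.ofReal_pow, inv_pow]

theorem mFourierCoeff_eq_fourierCoeffT3 {G : UnitAddTorus (Fin 3) → ℂ}
    (hG : ∀ y, G (torusMk y) = (f ((2 * Real.pi) • y) : ℂ)) (k : ℤ³) :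
    UnitAddTorus.mFourierCoeff G k = fourierCoeffT3 f k := by
  refine integral_unitAddTorus _ fun y => ?_
  rw [hG, mFourier_torusMk, expMode, phase_neg, smul_eq_mul, mul_comm, Complex.ofReal_neg, mul_neg]

theorem TorusPeriodic.eq_fourierSeries (hf : TorusPeriodic f) (hc : Continuous f)
    (hs : Summable fun k => ‖fourierCoeffT3 f k‖) (x : ℝ³) :
    (f x : ℂ) = fourierSeries (fourierCoeffT3 f) x := by
  obtain ⟨G, hG⟩ := hf.exists_lift hc
  have hcoeff : UnitAddTorus.mFourierCoeff G = fourierCoeffT3 f :=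
    funext (mFourierCoeff_eq_fourierCoeffT3 hG)
  have hinv := UnitAddTorus.hasSum_mFourier_series_apply_of_summable (f := G)
    (by rw [hcoeff]; exact hs.of_norm) (torusMk ((2 * Real.pi)⁻¹ • x))
  simp only [hG, hcoeff, mFourier_torusMk, smul_inv_smul₀ Real.two_pi_pos.ne', smul_eq_mul] at hinv
  exact hinv.tsum_eq.symm

theorem mFourierCoeff_tsum {d : Type*} [Fintype d] {c : (d → ℤ) → ℂ}
    (hs : Summable fun j => ‖c j‖) (k : d → ℤ) :
    UnitAddTorus.mFourierCoeff (∑' j, c j • UnitAddTorus.mFourier j : C(UnitAddTorus d, ℂ)) k =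
      c k := by
  classical
  have hsum : Summable fun j => c j • (UnitAddTorus.mFourier j : C(UnitAddTorus d, ℂ)) :=
    Summable.of_norm (by simpa [norm_smul, UnitAddTorus.mFourier_norm] using hs)
  rw [← UnitAddTorus.mFourierCoeff_toLp, ← UnitAddTorus.mFourierBasis_repr,
    HilbertBasis.repr_apply_apply, UnitAddTorus.coe_mFourierBasis]
  have hinner := (innerSL ℂ (UnitAddTorus.mFourierLp (d := d) 2 k)).hasSum
    ((ContinuousMap.toLp 2 volume ℂ).hasSum hsum.hasSum)
  have hterm : ∀ j, innerSL ℂ (UnitAddTorus.mFourierLp (d := d) 2 k)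
      (ContinuousMap.toLp 2 volume ℂ (c j • UnitAddTorus.mFourier j)) =
      if j = k then c k else 0 := fun j => by
    rw [map_smul, innerSL_apply_apply, inner_smul_right,
      orthonormal_iff_ite.1 (UnitAddTorus.orthonormal_mFourier (d := d)) k j]
    by_cases hjk : j = k
    · simp [hjk]
    · simp [hjk, Ne.symm hjk]
  simp only [hterm] at hinner
  exact hinner.unique (hasSum_ite_eq k (c k))

theorem fourierCoeffT3_re_fourierSeries (ha : Hermitian a) (hs : Summable fun k => ‖a k‖) (k : ℤ³) :
    fourierCoeffT3 (fun x => (fourierSeries a x).re) k = a k := by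
  have hsum : Summable fun j => a j • (UnitAddTorus.mFourier j : C(UnitAddTorus (Fin 3), ℂ)) :=
    Summable.of_norm (by simpa [norm_smul, UnitAddTorus.mFourier_norm] using hs)
  rw [← mFourierCoeff_tsum hs k]
  refine (mFourierCoeff_eq_fourierCoeffT3 (fun y => ?_) k).symm
  rw [ofReal_re_fourierSeries ha, fourierSeries]
  refine ((ContinuousMap.evalCLM ℂ (torusMk y)).map_tsum hsum).trans (tsum_congr fun j => ?_)
  exact congrArg (a j * ·) (mFourier_torusMk j y)

theorem meanZero_iff (f : ℝ³ → ℝ) : MeanZero f ↔ fourierCoeffT3 f 0 = 0 := by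
  simp [MeanZero, fourierCoeffT3, phase, integral_complex_ofReal, Real.pi_ne_zero]

/-- The phase `x ↦ k · x` as a continuous linear form. -/
def phaseCLM (k : ℤ³) : ℝ³ →L[ℝ] ℝ :=
  ∑ i, (k i : ℝ) • ContinuousLinearMap.proj (R := ℝ) (φ := fun _ : Fin 3 => ℝ) i

theorem phaseCLM_apply (k : ℤ³) (x : ℝ³) : phaseCLM k x = phase k x := by
  simp [phaseCLM, phase]

theorem norm_phaseCLM_le (k : ℤ³) : ‖phaseCLM k‖ ≤ 3 * waveNorm k := by
  refine ContinuousLinearMap.opNorm_le_bound _ (mul_nonneg (by norm_num) (waveNorm_nonneg k))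
    fun x => ?_
  rw [phaseCLM_apply, phase]
  calc ‖∑ i, (k i : ℝ) * x i‖ ≤ ∑ _i : Fin 3, waveNorm k * ‖x‖ :=
        norm_sum_le_of_le _ fun i _ => by
          rw [norm_mul]
          exact mul_le_mul (abs_coord_le_waveNorm k i) (norm_le_pi_norm x i) (norm_nonneg _)
            (waveNorm_nonneg k)
    _ = 3 * waveNorm k * ‖x‖ := by
        rw [Finset.sum_const, Finset.card_univ, Fintype.card_fin, nsmul_eq_mul]
        push_cast
        ring

theorem expMode_eq_comp (k : ℤ³) :
    expMode k = (fun t : ℝ => Complex.exp (Complex.I * t)) ∘ phaseCLM k :=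
  funext fun x => by rw [Function.comp_apply, phaseCLM_apply, expMode]

theorem contDiff_exp_I_mul {n : ℕ∞} : ContDiff ℝ n fun t : ℝ => Complex.exp (Complex.I * t) :=
  (contDiff_const.mul Complex.ofRealCLM.contDiff).cexp

theorem hasDerivAt_exp_I_mul (t : ℝ) :
    HasDerivAt (fun t : ℝ => Complex.exp (Complex.I * t)) (Complex.I * Complex.exp (Complex.I * t))
      t := by
  simpa [mul_comm] using (Complex.ofRealCLM.hasDerivAt (x := t).const_mul Complex.I).cexp

theorem contDiff_expMode (k : ℤ³) {n : ℕ∞} : ContDiff ℝ n (expMode k) := by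
  rw [expMode_eq_comp]
  exact contDiff_exp_I_mul.comp (phaseCLM k).contDiff

theorem hasFDerivAt_expMode (k : ℤ³) (x : ℝ³) :
    HasFDerivAt (expMode k) ((phaseCLM k).smulRight (Complex.I * expMode k x)) x := by
  rw [expMode_eq_comp]
  convert! (hasDerivAt_exp_I_mul (phaseCLM k x)).hasFDerivAt.comp x (phaseCLM k).hasFDerivAt using 1

theorem iteratedDeriv_exp_I_mul (n : ℕ) :
    iteratedDeriv n (fun t : ℝ => Complex.exp (Complex.I * t)) =
      fun t : ℝ => Complex.I ^ n * Complex.exp (Complex.I * t) := by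
  induction n with
  | zero => simp
  | succ n ih =>
    funext t
    rw [iteratedDeriv_succ, ih, ((hasDerivAt_exp_I_mul t).const_mul _).deriv, pow_succ, mul_assoc]

theorem norm_iteratedFDeriv_expMode_le (k : ℤ³) (n : ℕ) (x : ℝ³) :
    ‖iteratedFDeriv ℝ n (expMode k) x‖ ≤ (3 * waveNorm k) ^ n := by
  rw [expMode_eq_comp, (phaseCLM k).iteratedFDeriv_comp_right
    (contDiff_exp_I_mul (n := n)) x le_rfl]
  refine (ContinuousMultilinearMap.norm_compContinuousLinearMap_le _ _).trans ?_
  rw [norm_iteratedFDeriv_eq_norm_iteratedDeriv, iteratedDeriv_exp_I_mul]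
  simp only [norm_mul, norm_pow, Complex.norm_I, one_pow, one_mul, Finset.prod_const,
    Finset.card_univ, Fintype.card_fin]
  rw [mul_comm Complex.I, Complex.norm_exp_ofReal_mul_I, one_mul]
  exact pow_le_pow_left₀ (norm_nonneg _) (norm_phaseCLM_le k) n

theorem contDiff_fourierSeries (hs : ∀ n : ℕ, Summable fun k => waveNorm k ^ n * ‖a k‖) :
    ContDiff ℝ ∞ (fourierSeries a) := by
  refine contDiff_tsum (v := fun n k => 3 ^ n * (waveNorm k ^ n * ‖a k‖))
    (fun k => contDiff_const.mul (contDiff_expMode k)) (fun n _ => (hs n).mul_left _)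
    fun n k x _ => ?_
  change ‖iteratedFDeriv ℝ n (fun x => a k • expMode k x) x‖ ≤ _
  rw [iteratedFDeriv_const_smul_apply' (contDiff_expMode k (n := n)).contDiffAt, norm_smul]
  calc ‖a k‖ * ‖iteratedFDeriv ℝ n (expMode k) x‖ ≤ ‖a k‖ * (3 * waveNorm k) ^ n :=
        mul_le_mul_of_nonneg_left (norm_iteratedFDeriv_expMode_le k n x) (norm_nonneg _)
    _ = 3 ^ n * (waveNorm k ^ n * ‖a k‖) := by ring

/-- The Fourier coefficients `i k_j a_k` of the `j`-th partial derivative. -/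
def derivCoeff (j : Fin 3) (a : ℤ³ → ℂ) (k : ℤ³) : ℂ := Complex.I * (k j : ℂ) * a k

theorem norm_smulRight_expMode_le (a : ℤ³ → ℂ) (k : ℤ³) (x : ℝ³) :
    ‖(phaseCLM k).smulRight (a k * (Complex.I * expMode k x))‖ ≤ 3 * (waveNorm k * ‖a k‖) := by
  rw [ContinuousLinearMap.norm_smulRight_apply, norm_mul, norm_mul, norm_expMode, Complex.norm_I,
    mul_one, mul_one, ← mul_assoc]
  exact mul_le_mul_of_nonneg_right (norm_phaseCLM_le k) (norm_nonneg (a k))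

theorem hasFDerivAt_fourierSeries (h0 : Summable fun k => ‖a k‖)
    (h1 : Summable fun k => waveNorm k * ‖a k‖) (x : ℝ³) :
    HasFDerivAt (fourierSeries a)
      (∑' k, (phaseCLM k).smulRight (a k * (Complex.I * expMode k x))) x := by
  refine hasFDerivAt_tsum (h1.mul_left 3) (fun k x => ?_) (norm_smulRight_expMode_le a)
    (summable_mul_expMode h0 0) x
  convert! (hasFDerivAt_expMode k x).const_mul (a k) using 1
  ext v
  simp [mul_left_comm]

theorem partialDeriv_re_fourierSeries (h0 : Summable fun k => ‖a k‖)
    (h1 : Summable fun k => waveNorm k * ‖a k‖) (j : Fin 3) (x : ℝ³) :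
    partialDeriv j (fun x => (fourierSeries a x).re) x =
      (fourierSeries (derivCoeff j a) x).re := by
  have hsum : Summable fun k => (phaseCLM k).smulRight (a k * (Complex.I * expMode k x)) :=
    (h1.mul_left 3).of_norm_bounded fun k => norm_smulRight_expMode_le a k x
  have hre : HasFDerivAt (fun x => (fourierSeries a x).re) _ x :=
    Complex.reCLM.hasFDerivAt.comp x (hasFDerivAt_fourierSeries h0 h1 x)
  rw [partialDeriv, hre.fderiv, ContinuousLinearMap.comp_apply, Complex.reCLM_apply]
  congr 1
  refine ((ContinuousLinearMap.apply ℝ ℂ (Pi.single j 1 : ℝ³)).map_tsum hsum).trans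
    (tsum_congr fun k => ?_)
  rw [ContinuousLinearMap.apply_apply, ContinuousLinearMap.smulRight_apply, phaseCLM_apply, phase,
    derivCoeff]
  simp only [Pi.single_apply, mul_ite, mul_one, mul_zero, Finset.sum_ite_eq', Finset.mem_univ,
    if_true, Complex.real_smul, Complex.ofReal_intCast]
  ring

theorem fourierSeries_mul (ha : Summable fun k => ‖a k‖) (hb : Summable fun k => ‖b k‖) (x : ℝ³) :
    fourierSeries a x * fourierSeries b x =
      fourierSeries (fun k => ∑' j, a j * b (k - j)) x := by
  have hprod : Summable fun p : ℤ³ × ℤ³ => a p.1 * expMode p.1 x * (b p.2 * expMode p.2 x) :=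
    summable_mul_of_summable_norm (f := fun k => a k * expMode k x)
      (g := fun k => b k * expMode k x) (by simpa [norm_expMode] using ha)
      (by simpa [norm_expMode] using hb)
  have hconv (p : ℤ³ × ℤ³) : a (convEquiv ℤ³ p).1 * expMode (convEquiv ℤ³ p).1 x *
      (b (convEquiv ℤ³ p).2 * expMode (convEquiv ℤ³ p).2 x) =
      a p.2 * b (p.1 - p.2) * expMode p.1 x := by
    have hmode : expMode p.1 x = expMode p.2 x * expMode (p.1 - p.2) x := by
      rw [← expMode_add, add_sub_cancel]
    simp only [convEquiv, Equiv.coe_fn_mk]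
    rw [hmode]
    ring
  have hsum : Summable fun p : ℤ³ × ℤ³ => a p.2 * b (p.1 - p.2) * expMode p.1 x :=
    ((convEquiv ℤ³).summable_iff.2 hprod).congr hconv
  rw [fourierSeries, fourierSeries, (summable_mul_expMode ha x).tsum_mul_tsum
    (summable_mul_expMode hb x) hprod, ← (convEquiv ℤ³).tsum_eq, tsum_congr hconv, hsum.tsum_prod,
    fourierSeries]
  exact tsum_congr fun k => tsum_mul_right (f := fun j => a j * b (k - j)) (a := expMode k x)

end TorusFourierSeries

section MagnetogeostrophicSymbol

variable {Ω b x y z N u v : ℝ}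

/-- The denominator `4Ω²k₃²|k|² + b²k₂⁴` of the symbol of `𝐌`, with `b = β²/η`, as a function of
`y = k₂`, `z = k₃` and `N = |k|`. -/
def symbolDenom (Ω b y z N : ℝ) : ℝ := 4 * Ω ^ 2 * z ^ 2 * N ^ 2 + b ^ 2 * y ^ 4

theorem symbolDenom_pos (hΩ : 0 < Ω) (hz : 1 ≤ |z|) (hN : 1 ≤ N) : 0 < symbolDenom Ω b y z N := by
  have hz2 : 0 < z ^ 2 := by rw [← sq_abs]; positivity
  unfold symbolDenom
  positivity

theorem coriolis_le_symbolDenom (hΩ : 0 < Ω) (hz : 1 ≤ |z|) :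
    2 * Ω * (|z| * N ^ 2) ≤ 1 / (2 * Ω) * symbolDenom Ω b y z N := by
  have hzN : |z| * N ^ 2 ≤ z ^ 2 * N ^ 2 := by
    rw [← sq_abs z]
    exact mul_le_mul_of_nonneg_right (le_self_pow₀ hz two_ne_zero) (sq_nonneg N)
  rw [one_div_mul_eq_div, le_div_iff₀ (by positivity), symbolDenom]
  nlinarith [mul_le_mul_of_nonneg_left hzN (by positivity : 0 ≤ 4 * Ω ^ 2),
    (by positivity : 0 ≤ b ^ 2 * y ^ 4)]

theorem magnetic_le_symbolDenom (hΩ : 0 < Ω) :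
    b * y ^ 2 * (|z| * N) ≤ 1 / (4 * Ω) * symbolDenom Ω b y z N := by
  rw [one_div_mul_eq_div, le_div_iff₀ (by positivity), symbolDenom, ← sq_abs z]
  nlinarith [sq_nonneg (2 * Ω * (|z| * N) - b * y ^ 2)]

theorem abs_horizontal_numerator_le (hΩ : 0 < Ω) (hb : 0 ≤ b) (hz : 1 ≤ |z|) (hN : 1 ≤ N)
    (hu : |u| ≤ N) (hv : |v| ≤ N) :
    |2 * Ω * u * z * N ^ 2 + b * v * y ^ 2 * z| ≤
      (1 / (2 * Ω) + 1 / (4 * Ω)) * N * symbolDenom Ω b y z N := by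
  have hN0 : 0 ≤ N := by linarith
  calc |2 * Ω * u * z * N ^ 2 + b * v * y ^ 2 * z|
      ≤ |2 * Ω * u * z * N ^ 2| + |b * v * y ^ 2 * z| := abs_add_le _ _
    _ = |u| * (2 * Ω * (|z| * N ^ 2)) + b * y ^ 2 * (|z| * |v|) := by
        simp only [abs_mul, abs_of_pos hΩ, abs_of_nonneg hb, abs_of_nonneg (sq_nonneg y),
          abs_of_nonneg (sq_nonneg N), abs_two]
        ring
    _ ≤ N * (2 * Ω * (|z| * N ^ 2)) + b * y ^ 2 * (|z| * N) := by gcongr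
    _ ≤ N * (1 / (2 * Ω) * symbolDenom Ω b y z N) +
          N * (1 / (4 * Ω) * symbolDenom Ω b y z N) := by
        refine add_le_add (mul_le_mul_of_nonneg_left (coriolis_le_symbolDenom hΩ hz) hN0)
          ((magnetic_le_symbolDenom hΩ).trans (le_mul_of_one_le_left ?_ hN))
        have := symbolDenom_pos (b := b) (y := y) hΩ hz hN
        positivity
    _ = (1 / (2 * Ω) + 1 / (4 * Ω)) * N * symbolDenom Ω b y z N := by ring

theorem abs_vertical_numerator_le (hΩ : 0 < Ω) (hb : 0 ≤ b) (hz : 1 ≤ |z|) (hN : 1 ≤ N)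
    (hxy : x ^ 2 + y ^ 2 ≤ N ^ 2) :
    |b * y ^ 2 * (x ^ 2 + y ^ 2)| ≤
      (1 / (2 * Ω) + 1 / (4 * Ω)) * N * symbolDenom Ω b y z N := by
  have hD := symbolDenom_pos (b := b) (y := y) hΩ hz hN
  rw [abs_of_nonneg (by positivity)]
  calc b * y ^ 2 * (x ^ 2 + y ^ 2) ≤ b * y ^ 2 * N ^ 2 := by gcongr
    _ = N * (b * y ^ 2 * (1 * N)) := by ring
    _ ≤ N * (b * y ^ 2 * (|z| * N)) := by gcongr
    _ ≤ N * (1 / (4 * Ω) * symbolDenom Ω b y z N) :=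
        mul_le_mul_of_nonneg_left (magnetic_le_symbolDenom hΩ) (by linarith)
    _ ≤ (1 / (2 * Ω) + 1 / (4 * Ω)) * N * symbolDenom Ω b y z N := by
        have : 0 ≤ 1 / (2 * Ω) * N * symbolDenom Ω b y z N := by positivity
        linarith

variable {β η α σ : ℝ}

theorem exists_abs_symbolM_le (hΩ : 0 < Ω) (hη : 0 < η) (β : ℝ) :
    ∃ C, 0 ≤ C ∧ ∀ k i, |symbolM Ω β η k i| ≤ C * waveNorm k := by
  refine ⟨1 / (2 * Ω) + 1 / (4 * Ω), by positivity, fun k i => ?_⟩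
  by_cases h3 : k 2 = 0
  · simp only [symbolM, h3, if_true, Pi.zero_apply, abs_zero]
    have := waveNorm_nonneg k
    positivity
  have hb : 0 ≤ β ^ 2 / η := by positivity
  have hz : 1 ≤ |(k 2 : ℝ)| := by exact_mod_cast Int.one_le_abs h3
  have hN : 1 ≤ waveNorm k := hz.trans (abs_coord_le_waveNorm k 2)
  have hD : 0 < symbolDenom Ω (β ^ 2 / η) (k 1) (k 2) (waveNorm k) := symbolDenom_pos hΩ hz hN
  have h0 : |-(k 0 : ℝ)| ≤ waveNorm k := (abs_neg _).trans_le (abs_coord_le_waveNorm k 0)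
  have h1 : |(k 1 : ℝ)| ≤ waveNorm k := abs_coord_le_waveNorm k 1
  have hxy : (k 0 : ℝ) ^ 2 + (k 1 : ℝ) ^ 2 ≤ waveNorm k ^ 2 := by
    rw [waveNorm_sq, Fin.sum_univ_three]
    exact le_add_of_nonneg_right (sq_nonneg _)
  simp only [symbolM, h3, if_false]
  fin_cases i <;> dsimp <;> rw [← symbolDenom, abs_div, abs_of_pos hD, div_le_iff₀ hD]
  · exact (congrArg abs (by ring)).trans_le (abs_horizontal_numerator_le hΩ hb hz hN h1 h0)
  · exact (congrArg abs (by ring)).trans_le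
      (abs_horizontal_numerator_le hΩ hb hz hN h0 ((abs_neg _).trans_le h1))
  · exact abs_vertical_numerator_le hΩ hb hz hN hxy

theorem symDot_symbolM_self (Ω β η : ℝ) (k : ℤ³) : symDot (symbolM Ω β η) k k = 0 := by
  by_cases h3 : k 2 = 0
  · simp [symDot, symbolM, h3]
  · simp only [symDot, symbolM, h3, if_false, Fin.sum_univ_three, Matrix.cons_val]
    ring

theorem symDot_symbolFracM (α Ω β η : ℝ) (j k : ℤ³) :
    symDot (symbolFracM α Ω β η) j k = waveNorm j ^ α * symDot (symbolM Ω β η) j k := by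
  simp only [symDot, symbolFracM, Finset.mul_sum, mul_assoc]

theorem symbolFracM_zero_left (Ω β η : ℝ) : symbolFracM 0 Ω β η = symbolM Ω β η := by
  funext k i
  rw [symbolFracM, Real.rpow_zero, one_mul]

theorem abs_symDot_le {m : ℤ³ → Fin 3 → ℝ} {C : ℝ} {k : ℤ³} (hC : 0 ≤ C) (hm : ∀ i, |m k i| ≤ C)
    (l : ℤ³) : |symDot m k l| ≤ 3 * C * waveNorm l :=
  calc |symDot m k l| ≤ ∑ i, |m k i * (l i : ℝ)| := Finset.abs_sum_le_sum_abs _ _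
    _ ≤ ∑ _i : Fin 3, C * waveNorm l := Finset.sum_le_sum fun i _ => by
        rw [abs_mul]
        exact mul_le_mul (hm i) (abs_coord_le_waveNorm l i) (abs_nonneg _) hC
    _ = 3 * C * waveNorm l := by
        rw [Finset.sum_const, Finset.card_univ, Fintype.card_fin, nsmul_eq_mul]
        push_cast
        ring

theorem exists_isTransportSymbol_symbolFracM (hΩ : 0 < Ω) (hη : 0 < η) (hσ0 : 0 < σ) (hσ1 : σ ≤ 1)
    (hα : α + 1 ≤ σ) : ∃ M, IsTransportSymbol σ M (symbolFracM α Ω β η) := by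
  obtain ⟨C, hC, hb⟩ := exists_abs_symbolM_le hΩ hη β
  refine ⟨3 * C, hσ0, hσ1, by positivity, symbolFracM_neg α Ω β η, fun k => ?_, fun k l => ?_⟩
  · rw [symDot_symbolFracM, symDot_symbolM_self, mul_zero]
  have hN := waveNorm_nonneg k
  have hL := waveNorm_nonneg l
  rcases eq_or_ne k 0 with rfl | hk
  · have hzero : symDot (symbolFracM α Ω β η) 0 l = 0 := by simp [symDot, symbolFracM, symbolM]
    rw [hzero, abs_zero]
    positivity
  have hN1 := one_le_waveNorm hk
  rw [symDot_symbolFracM, abs_mul, abs_of_nonneg (Real.rpow_nonneg hN α)]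
  calc waveNorm k ^ α * |symDot (symbolM Ω β η) k l|
      ≤ waveNorm k ^ α * (3 * (C * waveNorm k) * waveNorm l) :=
        mul_le_mul_of_nonneg_left (abs_symDot_le (by positivity) (hb k) l) (Real.rpow_nonneg hN α)
    _ = 3 * C * waveNorm k ^ (α + 1) * waveNorm l := by
        rw [Real.rpow_add_one (by linarith)]; ring
    _ ≤ 3 * C * waveNorm k ^ σ * waveNorm l := by
        have := Real.rpow_le_rpow_of_exponent_le hN1 hα
        gcongr

end MagnetogeostrophicSymbol

section GevreyNorm

variable {r s σ τ ρ K : ℝ} {f : ℝ³ → ℝ} {a b : ℤ³ → ℂ}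

theorem sq_weightedCoeff (p σ τ : ℝ) (a : ℤ³ → ℂ) (k : ℤ³) :
    weightedCoeff p σ τ a k ^ 2 =
      waveNorm k ^ (2 * p) * Real.exp (2 * τ * waveNorm k ^ σ) * ‖a k‖ ^ 2 := by
  rw [weightedCoeff, gevreyWeight, mul_pow, mul_pow, ← Real.exp_nat_mul,
    mul_comm 2 p, Real.rpow_mul (waveNorm_nonneg k), Real.rpow_two]
  push_cast
  ring_nf

theorem gevreyNorm_eq (r s τ : ℝ) (f : ℝ³ → ℝ) :
    gevreyNorm r s τ f = (∑' k : {k : ℤ³ // k ≠ 0},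
      ENNReal.ofReal (weightedCoeff r (1 / s) τ (fourierCoeffT3 f) k ^ 2)) ^ (1 / 2 : ℝ) := by
  simp only [gevreyNorm, sq_weightedCoeff]

theorem gevreyNorm_le_iff (hK : 0 ≤ K) :
    gevreyNorm r s τ f ≤ ENNReal.ofReal K ↔ ∑' k : {k : ℤ³ // k ≠ 0},
      ENNReal.ofReal (weightedCoeff r (1 / s) τ (fourierCoeffT3 f) k ^ 2) ≤
        ENNReal.ofReal (K ^ 2) := by
  rw [gevreyNorm_eq, one_div 2, ENNReal.rpow_inv_le_iff two_pos,
    ENNReal.ofReal_rpow_of_nonneg hK zero_le_two, Real.rpow_two]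

theorem weightedCoeff_le_of_gevreyNorm_le (hK : 0 ≤ K)
    (h : gevreyNorm r s τ f ≤ ENNReal.ofReal K) {k : ℤ³} (hk : k ≠ 0) :
    weightedCoeff r (1 / s) τ (fourierCoeffT3 f) k ≤ K := by
  have hterm := (ENNReal.le_tsum (⟨k, hk⟩ : {k : ℤ³ // k ≠ 0})).trans ((gevreyNorm_le_iff hK).1 h)
  rw [ENNReal.ofReal_le_ofReal_iff (sq_nonneg K)] at hterm
  exact (pow_le_pow_iff_left₀ (weightedCoeff_nonneg _ _ _ _ _) hK two_ne_zero).1 hterm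

theorem exists_one_le_mul_gevreyWeight_mul_expDecay (hσ : 0 < σ) (hρ : ρ < τ) (r : ℝ) :
    ∃ C, 0 < C ∧ ∀ k ≠ 0, 1 ≤ C * (gevreyWeight r σ τ k * expDecay σ ρ k) := by
  obtain ⟨n, hn⟩ := exists_nat_ge (-r)
  obtain ⟨C, hC, hle⟩ := exists_pow_mul_expDecay_le hσ (sub_pos.2 hρ) n
  refine ⟨C, hC, fun k hk => ?_⟩
  have hpow : 1 ≤ waveNorm k ^ n * waveNorm k ^ r := by
    rw [← Real.rpow_natCast, ← Real.rpow_add (one_pos.trans_le (one_le_waveNorm hk))]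
    exact Real.one_le_rpow (one_le_waveNorm hk) (by linarith)
  have hexp : expDecay σ (τ - ρ) k * expDecay σ (ρ - τ) k = 1 := by
    rw [← expDecay_add, sub_add_sub_cancel', sub_self, expDecay, zero_mul, neg_zero, Real.exp_zero]
  calc 1 ≤ waveNorm k ^ n * waveNorm k ^ r * (expDecay σ (τ - ρ) k * expDecay σ (ρ - τ) k) := by
        rwa [hexp, mul_one]
    _ = waveNorm k ^ n * expDecay σ (τ - ρ) k * (gevreyWeight r σ τ k * expDecay σ ρ k) := by
        rw [gevreyWeight_mul_expDecay, mul_mul_mul_comm]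
    _ ≤ C * (gevreyWeight r σ τ k * expDecay σ ρ k) :=
        mul_le_mul_of_nonneg_right (hle k)
          (mul_nonneg (gevreyWeight_nonneg _ _ _ _) (expDecay_pos _ _ _).le)

theorem exists_hasDecay_of_gevreyNorm_le (hs : 0 < s) (hρ : ρ < τ) (r : ℝ) (hK : 0 ≤ K) :
    ∃ K', ∀ f, MeanZero f → gevreyNorm r s τ f ≤ ENNReal.ofReal K →
      HasDecay (1 / s) ρ K' (fourierCoeffT3 f) := by
  obtain ⟨C, hC, hle⟩ := exists_one_le_mul_gevreyWeight_mul_expDecay (one_div_pos.2 hs) hρ r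
  refine ⟨C * K, fun f hmean hf k => ?_⟩
  have hdecay := (expDecay_pos (1 / s) ρ k).le
  rcases eq_or_ne k 0 with rfl | hk
  · rw [(meanZero_iff f).1 hmean, norm_zero]
    exact mul_nonneg (mul_nonneg hC.le hK) hdecay
  calc ‖fourierCoeffT3 f k‖
      ≤ C * (gevreyWeight r (1 / s) τ k * expDecay (1 / s) ρ k) * ‖fourierCoeffT3 f k‖ :=
        le_mul_of_one_le_left (norm_nonneg _) (hle k hk)
    _ = C * weightedCoeff r (1 / s) τ (fourierCoeffT3 f) k * expDecay (1 / s) ρ k := by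
        rw [weightedCoeff]
        ring
    _ ≤ C * K * expDecay (1 / s) ρ k := by
        gcongr
        exact weightedCoeff_le_of_gevreyNorm_le hK hf hk

theorem exists_gevreyNorm_le (hs : 0 < s) (hτ : τ < ρ) (r K : ℝ) :
    ∃ K', ∀ f, HasDecay (1 / s) ρ K (fourierCoeffT3 f) →
      gevreyNorm r s τ f ≤ ENNReal.ofReal K' := by
  have hσ := one_div_pos.2 hs
  have hp : 0 < max r 1 := lt_max_of_lt_right one_pos
  refine ⟨|K * ∑' k : ℤ³, waveNorm k ^ max r 1 * expDecay (1 / s) (ρ - τ) k|, fun f hf => ?_⟩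
  rw [gevreyNorm_le_iff (abs_nonneg _), sq_abs]
  have hsum := hf.summable_sq_weightedCoeff hσ hp hτ
  have hcoeff (k : {k : ℤ³ // k ≠ 0}) : weightedCoeff r (1 / s) τ (fourierCoeffT3 f) k ≤
      weightedCoeff (max r 1) (1 / s) τ (fourierCoeffT3 f) k :=
    mul_le_mul_of_nonneg_right (mul_le_mul_of_nonneg_right
      (Real.rpow_le_rpow_of_exponent_le (one_le_waveNorm k.2) (le_max_left r 1))
      (Real.exp_pos _).le) (norm_nonneg _)
  calc ∑' k : {k : ℤ³ // k ≠ 0},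
        ENNReal.ofReal (weightedCoeff r (1 / s) τ (fourierCoeffT3 f) k ^ 2)
      ≤ ∑' k : {k : ℤ³ // k ≠ 0},
        ENNReal.ofReal (weightedCoeff (max r 1) (1 / s) τ (fourierCoeffT3 f) k ^ 2) :=
        ENNReal.tsum_le_tsum fun k => ENNReal.ofReal_le_ofReal
          (pow_le_pow_left₀ (weightedCoeff_nonneg _ _ _ _ _) (hcoeff k) 2)
    _ ≤ ∑' k, ENNReal.ofReal (weightedCoeff (max r 1) (1 / s) τ (fourierCoeffT3 f) k ^ 2) :=
        ENNReal.tsum_comp_le_tsum_of_injective Subtype.val_injective _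
    _ = ENNReal.ofReal (gevreyEnergy (max r 1) (1 / s) τ (fourierCoeffT3 f)) :=
        (ENNReal.ofReal_tsum_of_nonneg (fun _ => sq_nonneg _) hsum).symm
    _ ≤ _ := ENNReal.ofReal_le_ofReal (hf.gevreyEnergy_le hσ hp hτ)

end GevreyNorm

section TransportTerm

variable {σ M ρ K : ℝ} {m : ℤ³ → Fin 3 → ℝ} {a b : ℤ³ → ℂ} {f : ℝ³ → ℝ}

theorem HasDecay.summable_norm (h : HasDecay σ ρ K a) (hσ : 0 < σ) (hρ : 0 < ρ) :
    Summable fun k => ‖a k‖ := by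
  simpa using h.summable_pow_mul hσ hρ 0

theorem HasDecay.summable_waveNorm_mul (h : HasDecay σ ρ K a) (hσ : 0 < σ) (hρ : 0 < ρ) :
    Summable fun k => waveNorm k * ‖a k‖ := by
  simpa using h.summable_pow_mul hσ hρ 1

theorem HasDecay.norm_fourierSeries_le (h : HasDecay σ ρ K a) (hσ : 0 < σ) (hρ : 0 < ρ) (x : ℝ³) :
    ‖fourierSeries a x‖ ≤ K * ∑' k, expDecay σ ρ k := by
  rw [← tsum_mul_left]
  exact tsum_of_norm_bounded ((summable_expDecay hσ hρ).mul_left K).hasSum fun k => by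
    simpa [norm_expMode] using h k

theorem hermitian_fourierCoeffT3 (f : ℝ³ → ℝ) : Hermitian (fourierCoeffT3 f) :=
  fourierCoeffT3_neg f

theorem HasDecay.smoothMeanZero (h : HasDecay σ ρ K a) (hσ : 0 < σ) (hρ : 0 < ρ)
    (ha : Hermitian a) (h0 : a 0 = 0) : SmoothMeanZero fun x => (fourierSeries a x).re where
  smooth := Complex.reCLM.contDiff.comp (contDiff_fourierSeries (h.summable_pow_mul hσ hρ))
  periodic := fourierSeries_periodic a
  mean_zero := (meanZero_iff _).2
    ((fourierCoeffT3_re_fourierSeries ha (h.summable_norm hσ hρ) 0).trans h0)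

theorem SmoothMeanZero.eq_re_fourierSeries (hf : SmoothMeanZero f)
    (hs : Summable fun k => ‖fourierCoeffT3 f k‖) :
    f = fun x => (fourierSeries (fourierCoeffT3 f) x).re := by
  funext x
  rw [← hf.periodic.eq_fourierSeries hf.smooth.continuous hs x, Complex.ofReal_re]

theorem SmoothMeanZero.partialDeriv_eq (hf : SmoothMeanZero f)
    (h0 : Summable fun k => ‖fourierCoeffT3 f k‖)
    (h1 : Summable fun k => waveNorm k * ‖fourierCoeffT3 f k‖) (i : Fin 3) (x : ℝ³) :
    partialDeriv i f x = (fourierSeries (derivCoeff i (fourierCoeffT3 f)) x).re := by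
  conv_lhs => rw [hf.eq_re_fourierSeries h0]
  exact partialDeriv_re_fourierSeries h0 h1 i x

theorem Hermitian.derivCoeff (ha : Hermitian a) (i : Fin 3) : Hermitian (derivCoeff i a) :=
  fun k => by simp [MG.derivCoeff, ha k]

theorem summable_norm_derivCoeff (h1 : Summable fun k => waveNorm k * ‖a k‖) (i : Fin 3) :
    Summable fun k => ‖derivCoeff i a k‖ :=
  h1.of_nonneg_of_le (fun _ => norm_nonneg _) fun k => by
    rw [derivCoeff, norm_mul, norm_mul, Complex.norm_I, one_mul, Complex.norm_intCast]
    exact mul_le_mul_of_nonneg_right (abs_coord_le_waveNorm k i) (norm_nonneg _)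

theorem IsTransportSymbol.abs_apply_le (hm : IsTransportSymbol σ M m) (k : ℤ³) (i : Fin 3) :
    |m k i| ≤ M * waveNorm k := by
  have hdot : symDot m k (Pi.single i 1) = m k i := by simp [symDot, Pi.single_apply]
  have hnorm : waveNorm (Pi.single i 1) = 1 := by simp [waveNorm, Pi.single_apply]
  have hbound := hm.bound k (Pi.single i 1)
  rw [hdot, hnorm, mul_one] at hbound
  exact hbound.trans
    (mul_le_mul_of_nonneg_left (waveNorm_rpow_le_self hm.pos hm.le_one k) hm.nonneg)

theorem IsTransportSymbol.summable_norm_velocity (hm : IsTransportSymbol σ M m)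
    (h1 : Summable fun k => waveNorm k * ‖a k‖) (i : Fin 3) :
    Summable fun k => ‖(m k i : ℂ) * a k‖ :=
  (h1.mul_left M).of_nonneg_of_le (fun _ => norm_nonneg _) fun k => by
    rw [norm_mul, Complex.norm_real, ← mul_assoc]
    exact mul_le_mul_of_nonneg_right (hm.abs_apply_le k i) (norm_nonneg _)

theorem summable_mul_sub (ha : Summable fun k => ‖a k‖) (hb : Summable fun k => ‖b k‖) (k : ℤ³) :
    Summable fun j => a j * b (k - j) :=
  Summable.of_norm (by simpa using
    (summable_mul_conv ha hb (fun _ => norm_nonneg _) fun _ => norm_nonneg _).prod_factor k)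

theorem summable_norm_tsum_mul_sub (ha : Summable fun k => ‖a k‖) (hb : Summable fun k => ‖b k‖) :
    Summable fun k => ‖∑' j, a j * b (k - j)‖ := by
  have hconv := summable_mul_conv ha hb (fun _ => norm_nonneg _) fun _ => norm_nonneg _
  exact hconv.prod.of_nonneg_of_le (fun _ => norm_nonneg _) fun k => by
    simpa using norm_tsum_le_tsum_norm (f := fun j => a j * b (k - j))
      (by simpa using hconv.prod_factor k)

theorem fourierSeries_sum {ι : Type*} (S : Finset ι) {c : ι → ℤ³ → ℂ}
    (hc : ∀ i ∈ S, Summable fun k => ‖c i k‖) (x : ℝ³) :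
    fourierSeries (fun k => ∑ i ∈ S, c i k) x = ∑ i ∈ S, fourierSeries (c i) x := by
  simp only [fourierSeries, Finset.sum_mul]
  exact Summable.tsum_finsetSum fun i hi => summable_mul_expMode (hc i hi) x

theorem IsTransportSymbol.transport_eq_sum (hm : IsTransportSymbol σ M m)
    (ha : Summable fun k => waveNorm k * ‖a k‖) (hb : Summable fun k => waveNorm k * ‖b k‖)
    (k : ℤ³) :
    transport m a b k = ∑ i, ∑' j, (m j i : ℂ) * a j * derivCoeff i b (k - j) := by
  rw [transport, ← Summable.tsum_finsetSum fun i _ =>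
    summable_mul_sub (hm.summable_norm_velocity ha i) (summable_norm_derivCoeff hb i) k]
  refine tsum_congr fun j => ?_
  rw [transportTerm, ← hm.symDot_sub_self, symDot]
  push_cast
  rw [Finset.mul_sum, Finset.sum_mul, Finset.sum_mul]
  refine Finset.sum_congr rfl fun i _ => ?_
  simp only [derivCoeff, Pi.sub_apply, Int.cast_sub]
  ring

theorem IsTransportSymbol.sum_multiplier_mul_partialDeriv (hm : IsTransportSymbol σ M m)
    (hρ : 0 < ρ) (hf : SmoothMeanZero f) (hd : HasDecay σ ρ K (fourierCoeffT3 f)) (x : ℝ³) :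
    ∑ i, multiplier (fun k => m k i) f x * partialDeriv i f x =
      (fourierSeries (transport m (fourierCoeffT3 f) (fourierCoeffT3 f)) x).re := by
  set a := fourierCoeffT3 f
  have h0 := hd.summable_norm hm.pos hρ
  have h1 := hd.summable_waveNorm_mul hm.pos hρ
  have hvel := hm.summable_norm_velocity h1
  have hderiv := summable_norm_derivCoeff h1
  have hmul (i : Fin 3) : multiplier (fun k => m k i) f x * partialDeriv i f x =
      (fourierSeries (fun k => ∑' j, (m j i : ℂ) * a j * derivCoeff i a (k - j)) x).re := by
    rw [← fourierSeries_mul (hvel i) (hderiv i), hf.partialDeriv_eq h0 h1, Complex.mul_re,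
      fourierSeries_im ((hermitian_fourierCoeffT3 f).derivCoeff i), mul_zero, sub_zero]
    rfl
  simp only [hmul, funext (hm.transport_eq_sum h1 h1)]
  rw [← Complex.re_sum,
    fourierSeries_sum _ fun i _ => summable_norm_tsum_mul_sub (hvel i) (hderiv i)]

end TransportTerm

section DerivativeWithin

variable {E : Type*} [NormedAddCommGroup E] [NormedSpace ℝ E] {S : Set ℝ} {t : ℝ}

theorem hasDerivWithinAt_of_norm_sub_le_sq {f : ℝ → E} {f' : E} {C : ℝ}
    (h : ∀ u ∈ S, ‖f u - f t - (u - t) • f'‖ ≤ C * (u - t) ^ 2) : HasDerivWithinAt f f' S t := by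
  rw [hasDerivWithinAt_iff_isLittleO]
  have hO : (fun u => f u - f t - (u - t) • f') =O[𝓝[S] t] fun u => ‖u - t‖ ^ 2 :=
    .of_bound C (eventually_nhdsWithin_of_forall fun u hu => by simpa using h u hu)
  exact hO.trans_isLittleO
    ((Asymptotics.isLittleO_pow_sub_sub t one_lt_two).mono nhdsWithin_le_nhds)

theorem hasDerivWithinAt_integral_of_norm_deriv_le {X : Type*} [MeasurableSpace X] {μ : Measure X}
    [IsFiniteMeasure μ] (hS : Convex ℝ S) {F F' : ℝ → X → E} {B : ℝ}
    (hFint : ∀ u ∈ S, Integrable (F u) μ)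
    (hderiv : ∀ u ∈ S, ∀ x, HasDerivWithinAt (fun v => F v x) (F' u x) S u)
    (hbound : ∀ u ∈ S, ∀ x, ‖F' u x‖ ≤ B) (ht : t ∈ S) :
    HasDerivWithinAt (fun u => ∫ x, F u x ∂μ) (∫ x, F' t x ∂μ) S t := by
  rw [hasDerivWithinAt_iff_tendsto_slope]
  have hslope : ∀ᶠ u in 𝓝[S \ {t}] t, u ∈ S \ {t} := self_mem_nhdsWithin
  have hlim : Tendsto (fun u => ∫ x, slope (fun v => F v x) t u ∂μ) (𝓝[S \ {t}] t)
      (𝓝 (∫ x, F' t x ∂μ)) := by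
    refine tendsto_integral_filter_of_dominated_convergence (fun _ => B) ?_ ?_
      (integrable_const B)
      (Eventually.of_forall fun x => hasDerivWithinAt_iff_tendsto_slope.1 (hderiv t ht x))
    · filter_upwards [hslope] with u hu
      simp only [slope_def_module]
      exact (((hFint u hu.1).sub (hFint t ht)).smul _).aestronglyMeasurable
    · filter_upwards [hslope] with u hu
      refine Eventually.of_forall fun x => ?_
      have hmvt := hS.norm_image_sub_le_of_norm_hasDerivWithin_le (fun v hv => hderiv v hv x)
        (fun v hv => hbound v hv x) ht hu.1
      rw [slope_def_module, norm_smul, norm_inv]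
      rwa [inv_mul_le_iff₀ (norm_pos_iff.2 (sub_ne_zero.2 hu.2)), mul_comm]
  refine hlim.congr' ?_
  filter_upwards [hslope] with u hu
  simp only [slope_def_module, integral_smul, integral_sub (hFint u hu.1) (hFint t ht)]

theorem hasDerivWithinAt_fourierCoeffT3 (hS : Convex ℝ S) {θ θ' : ℝ → ℝ³ → ℝ} {B : ℝ}
    (hcont : ∀ u ∈ S, Continuous (θ u))
    (hderiv : ∀ u ∈ S, ∀ x, HasDerivWithinAt (fun v => θ v x) (θ' u x) S u)
    (hbound : ∀ u ∈ S, ∀ x, |θ' u x| ≤ B) (ht : t ∈ S) (k : ℤ³) :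
    HasDerivWithinAt (fun u => fourierCoeffT3 (θ u) k) (fourierCoeffT3 (θ' t) k) S t := by
  have hphase : Continuous fun x : ℝ³ => Complex.exp (-(Complex.I * (phase k x : ℂ))) := by
    unfold phase
    fun_prop
  have hnorm (x : ℝ³) : ‖Complex.exp (-(Complex.I * (phase k x : ℂ)))‖ = 1 := by
    simp [Complex.norm_exp]
  have : IsFiniteMeasure (volume.restrict (Set.Icc (0 : ℝ³) fun _ => 2 * Real.pi)) :=
    ⟨by simpa using isCompact_Icc.measure_lt_top⟩
  refine (hasDerivWithinAt_integral_of_norm_deriv_le hS (B := B) (fun u hu => ?_)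
    (fun u hu x => (hderiv u hu x).ofReal_comp.mul_const _) (fun u hu x => ?_) ht).const_mul _
  · exact ((Complex.continuous_ofReal.comp (hcont u hu)).mul hphase).continuousOn
      |>.integrableOn_compact isCompact_Icc
  · rw [norm_mul, hnorm, mul_one, Complex.norm_real]
    exact hbound u hu x

end DerivativeWithin

section LocalWellPosedness

variable {s σ M r T T' ρ K L : ℝ} {m : ℤ³ → Fin 3 → ℝ} {a : ℤ³ → ℂ} {x : ℝ → ℤ³ → ℂ}
  {θ₀ : ℝ³ → ℝ} {θ θ' : ℝ → ℝ³ → ℝ}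

theorem IsFourierSolution.hasDerivWithinAt_fourierSeries (hm : IsTransportSymbol σ M m)
    (hρ : 0 < ρ) (hx : IsFourierSolution m σ T ρ K L a x) {t : ℝ} (ht : t ∈ Set.Icc 0 T) (y : ℝ³) :
    HasDerivWithinAt (fun u => fourierSeries (x u) y) (-fourierSeries (transport m (x t) (x t)) y)
      (Set.Icc 0 T) t := by
  refine hasDerivWithinAt_of_norm_sub_le_sq (C := L * ∑' k, expDecay σ ρ k) fun u hu => ?_
  obtain ⟨C, -, hC⟩ := hm.exists_hasDecay_transport (half_pos hρ) (half_lt_self hρ)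
  have hsum {ρ' K' : ℝ} {b : ℤ³ → ℂ} (hρ' : 0 < ρ') (hb : HasDecay σ ρ' K' b) :
      HasSum (fun k => b k * expMode k y) (fourierSeries b y) :=
    (summable_mul_expMode (hb.summable_norm hm.pos hρ') y).hasSum
  have hremainder := ((hsum hρ (hx.hasDecay u hu)).sub (hsum hρ (hx.hasDecay t ht))).sub
    ((hsum (half_pos hρ) (hC K K _ _ (hx.hasDecay t ht) (hx.hasDecay t ht))).neg.const_smul (u - t))
  rw [← hremainder.tsum_eq, mul_right_comm, ← tsum_mul_left]
  refine tsum_of_norm_bounded ((summable_expDecay hm.pos hρ).mul_left _).hasSum fun k => ?_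
  calc ‖x u k * expMode k y - x t k * expMode k y -
        (u - t) • -(transport m (x t) (x t) k * expMode k y)‖
      = ‖(x u k - x t k + (u - t) * transport m (x t) (x t) k) * expMode k y‖ := by
        rw [Complex.real_smul]
        push_cast
        ring_nf
    _ ≤ L * expDecay σ ρ k * (u - t) ^ 2 := by
        rw [norm_mul, norm_expMode, mul_one]
        exact hx.taylor t ht u hu k
    _ = L * (u - t) ^ 2 * expDecay σ ρ k := by ring

theorem IsFourierSolution.isGevreySolution (hs : 0 < s) (hm : IsTransportSymbol (1 / s) M m)
    (hρ : 0 < ρ) (hx : IsFourierSolution m (1 / s) T ρ K L (fourierCoeffT3 θ₀) x)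
    (hθ₀ : SmoothMeanZero θ₀) (hsum : Summable fun k => ‖fourierCoeffT3 θ₀ k‖) (r : ℝ) :
    IsGevreySolution m r s T θ₀ fun t y => (fourierSeries (x t) y).re := by
  have hcoeff {t : ℝ} (ht : t ∈ Set.Icc 0 T) :
      fourierCoeffT3 (fun y => (fourierSeries (x t) y).re) = x t :=
    funext (fourierCoeffT3_re_fourierSeries (hx.hermitian t ht)
      ((hx.hasDecay t ht).summable_norm hm.pos hρ))
  have hsmooth {t : ℝ} (ht : t ∈ Set.Icc 0 T) :
      SmoothMeanZero fun y => (fourierSeries (x t) y).re :=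
    (hx.hasDecay t ht).smoothMeanZero hm.pos hρ (hx.hermitian t ht) (hx.apply_zero t ht)
  refine ⟨?_, fun t ht => hsmooth (Set.Ico_subset_Icc_self ht), fun T' hT' => ?_,
    fun t ht y => ?_⟩
  · rw [hx.initial]
    exact (hθ₀.eq_re_fourierSeries hsum).symm
  · obtain ⟨K', hK'⟩ := exists_gevreyNorm_le hs (half_lt_self hρ) r K
    refine ⟨ρ / 2, half_pos hρ, K', fun t ht => hK' _ ?_⟩
    have ht' : t ∈ Set.Icc 0 T := ⟨ht.1, ht.2.trans hT'.2.le⟩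
    rw [hcoeff ht']
    exact hx.hasDecay t ht'
  · have ht' := Set.Ico_subset_Icc_self ht
    rw [hm.sum_multiplier_mul_partialDeriv hρ (hsmooth ht')
      (by rw [hcoeff ht']; exact hx.hasDecay t ht'), hcoeff ht']
    have hmem : Set.Icc 0 T ∈ 𝓝[Set.Ici 0] t := by
      rw [← Set.Ici_inter_Iic]
      exact inter_mem_nhdsWithin _ (Iic_mem_nhds ht.2)
    exact (Complex.reCLM.hasFDerivAt.comp_hasDerivWithinAt t
      (hx.hasDerivWithinAt_fourierSeries hm hρ ht' y)).mono_of_mem_nhdsWithin hmem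

theorem IsGevreySolution.exists_hasDecay (hs : 0 < s) (hθ : IsGevreySolution m r s T θ₀ θ)
    (hT' : T' ∈ Set.Ico 0 T) :
    ∃ ρ K : ℝ, 0 < ρ ∧ ∀ t ∈ Set.Icc 0 T', HasDecay (1 / s) ρ K (fourierCoeffT3 (θ t)) := by
  obtain ⟨τ, hτ, K, hK⟩ := hθ.gevrey T' hT'
  obtain ⟨K', hK'⟩ := exists_hasDecay_of_gevreyNorm_le hs (half_lt_self hτ) r (le_max_right K 0)
  exact ⟨τ / 2, K', half_pos hτ, fun t ht => hK' _
    (hθ.smooth t ⟨ht.1, ht.2.trans_lt hT'.2⟩).mean_zero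
    ((hK t ht).trans (ENNReal.ofReal_le_ofReal (le_max_left K 0)))⟩

theorem IsGevreySolution.hasDerivWithinAt_fourierCoeffT3 (hm : IsTransportSymbol σ M m)
    (hθ : IsGevreySolution m r s T θ₀ θ) (hT' : T' < T) (hρ : 0 < ρ)
    (hd : ∀ t ∈ Set.Icc 0 T', HasDecay σ ρ K (fourierCoeffT3 (θ t))) {t : ℝ}
    (ht : t ∈ Set.Icc 0 T') (k : ℤ³) :
    HasDerivWithinAt (fun u => fourierCoeffT3 (θ u) k)
      (-transport m (fourierCoeffT3 (θ t)) (fourierCoeffT3 (θ t)) k) (Set.Icc 0 T') t := by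
  obtain ⟨C, -, hC⟩ := hm.exists_hasDecay_transport (half_pos hρ) (half_lt_self hρ)
  have hmem {u : ℝ} (hu : u ∈ Set.Icc 0 T') : u ∈ Set.Ico 0 T := ⟨hu.1, hu.2.trans_lt hT'⟩
  let N (u : ℝ) : ℤ³ → ℂ := -transport m (fourierCoeffT3 (θ u)) (fourierCoeffT3 (θ u))
  have hNherm (u : ℝ) : Hermitian (N u) := fun k => by
    simp [N, (hermitian_fourierCoeffT3 (θ u)).transport hm.even (hermitian_fourierCoeffT3 (θ u)) k]
  have hNdecay {u : ℝ} (hu : u ∈ Set.Icc 0 T') : HasDecay σ (ρ / 2) (C * (K * K)) (N u) :=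
    fun k => by simpa [N] using hC K K _ _ (hd u hu) (hd u hu) k
  have hderiv {u : ℝ} (hu : u ∈ Set.Icc 0 T') (x : ℝ³) :
      HasDerivWithinAt (fun v => θ v x) (fourierSeries (N u) x).re (Set.Icc 0 T') u := by
    have hNseries : (fourierSeries (N u) x).re =
        -(fourierSeries (transport m (fourierCoeffT3 (θ u)) (fourierCoeffT3 (θ u))) x).re := by
      simp [N, fourierSeries, tsum_neg]
    rw [hNseries,
      ← hm.sum_multiplier_mul_partialDeriv hρ (hθ.smooth u (hmem hu)) (hd u hu)]
    exact (hθ.equation u (hmem hu) x).mono Set.Icc_subset_Ici_self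
  change HasDerivWithinAt _ (N t k) _ _
  rw [← fourierCoeffT3_re_fourierSeries (hNherm t)
    ((hNdecay ht).summable_norm hm.pos (half_pos hρ)) k]
  exact MG.hasDerivWithinAt_fourierCoeffT3 (convex_Icc 0 T')
    (fun u hu => (hθ.smooth u (hmem hu)).smooth.continuous) (fun u hu => hderiv hu)
    (fun u hu x => (Complex.abs_re_le_norm _).trans
      ((hNdecay hu).norm_fourierSeries_le hm.pos (half_pos hρ) x)) ht k

theorem IsGevreySolution.eqOn (hs : 0 < s) (hm : IsTransportSymbol (1 / s) M m)
    (hθ : IsGevreySolution m r s T θ₀ θ) (hθ' : IsGevreySolution m r s T θ₀ θ') :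
    Set.EqOn θ θ' (Set.Ico 0 T) := by
  intro t ht
  obtain ⟨ρ, K, hρ, hd⟩ := hθ.exists_hasDecay hs ht
  obtain ⟨ρ', K', hρ', hd'⟩ := hθ'.exists_hasDecay hs ht
  have hmem {u : ℝ} (hu : u ∈ Set.Icc 0 t) : u ∈ Set.Ico 0 T := ⟨hu.1, hu.2.trans_lt ht.2⟩
  have htt : t ∈ Set.Icc 0 t := ⟨ht.1, le_rfl⟩
  have hcoeff : fourierCoeffT3 (θ t) = fourierCoeffT3 (θ' t) :=
    hm.fourier_unique (lt_min hρ hρ') (a := fun u => fourierCoeffT3 (θ u))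
      (b := fun u => fourierCoeffT3 (θ' u)) (fun u _ => hermitian_fourierCoeffT3 _)
      (fun u hu => (hd u hu).mono (min_le_left _ _) (le_max_left K K'))
      (fun u hu => (hd' u hu).mono (min_le_right _ _) (le_max_right K K'))
      (fun u hu => ((meanZero_iff _).1 (hθ.smooth u (hmem hu)).mean_zero).trans
        ((meanZero_iff _).1 (hθ'.smooth u (hmem hu)).mean_zero).symm)
      (fun u hu => hθ.hasDerivWithinAt_fourierCoeffT3 hm ht.2 hρ hd hu)
      (fun u hu => hθ'.hasDerivWithinAt_fourierCoeffT3 hm ht.2 hρ' hd' hu)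
      (by simp only [hθ.initial, hθ'.initial]) htt
  rw [(hθ.smooth t ht).eq_re_fourierSeries ((hd t htt).summable_norm hm.pos hρ),
    (hθ'.smooth t ht).eq_re_fourierSeries ((hd' t htt).summable_norm hm.pos hρ'), hcoeff]

theorem IsTransportSymbol.exists_hasUniqueGevreySolution (hs : 0 < s)
    (hm : IsTransportSymbol (1 / s) M m) (r : ℝ) (hρ : 0 < ρ) (K : ℝ) :
    ∃ T, 0 < T ∧ ∀ θ₀, SmoothMeanZero θ₀ → HasDecay (1 / s) ρ K (fourierCoeffT3 θ₀) →
      HasUniqueGevreySolution m r s T θ₀ := by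
  obtain ⟨T, ρ₁, K₁, L, hT, hρ₁, hsol⟩ := hm.exists_isFourierSolution hρ
    (lt_max_of_lt_right one_pos : 0 < max K 1)
  refine ⟨T, hT, fun θ₀ hθ₀ hd => ?_⟩
  obtain ⟨x, hx⟩ := hsol (fourierCoeffT3 θ₀) (hermitian_fourierCoeffT3 θ₀)
    ((meanZero_iff θ₀).1 hθ₀.mean_zero) (hd.mono le_rfl (le_max_left K 1))
  have hθ := hx.isGevreySolution hs hm hρ₁ hθ₀ (hd.summable_norm hm.pos hρ) r
  exact ⟨_, hθ, fun θ' hθ' => hθ'.eqOn hs hm hθ⟩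

end LocalWellPosedness

section AnalyticSeries

variable {ι 𝕜 E F : Type*} [NontriviallyNormedField 𝕜] [NormedAddCommGroup E] [NormedSpace 𝕜 E]
  [NormedAddCommGroup F] [NormedSpace 𝕜 F] [CompleteSpace F]

theorem hasFPowerSeriesOnBall_tsum {f : ι → E → F} {p : ι → FormalMultilinearSeries 𝕜 E F} {x : E}
    {δ : NNReal} (hδ : 0 < δ) (hf : ∀ i, HasFPowerSeriesOnBall (f i) (p i) x δ)
    (hp : Summable fun z : ι × ℕ => ‖p z.1 z.2‖ * δ ^ z.2) :
    HasFPowerSeriesOnBall (fun y => ∑' i, f i y) (fun n => ∑' i, p i n) x δ := by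
  have hnorm (n : ℕ) : Summable fun i => ‖p i n‖ := by
    refine (summable_mul_right_iff (pow_ne_zero n (NNReal.coe_ne_zero.2 hδ.ne'))).1 ?_
    exact hp.comp_injective (i := fun i => (i, n)) (Prod.mk_left_injective n)
  refine ⟨FormalMultilinearSeries.le_radius_of_bound _
    (∑' z : ι × ℕ, ‖p z.1 z.2‖ * δ ^ z.2) fun n => ?_, by simpa using hδ, fun {y} hy => ?_⟩
  · calc ‖∑' i, p i n‖ * δ ^ n ≤ (∑' i, ‖p i n‖) * δ ^ n := by
          gcongr
          exact norm_tsum_le_tsum_norm (hnorm n)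
      _ = ∑' i, ‖p i n‖ * δ ^ n := tsum_mul_right.symm
      _ ≤ _ := tsum_comp_le_tsum_of_inj hp (i := fun i => (i, n)) (fun _ => by positivity)
          (Prod.mk_left_injective n)
  · have hyδ : ‖y‖ ≤ δ := by
      rw [Metric.eball_coe, mem_ball_zero_iff] at hy
      exact hy.le
    have hsum : Summable fun z : ι × ℕ => p z.1 z.2 fun _ => y := by
      exact hp.of_norm_bounded fun z =>
        (p z.1 z.2).le_opNorm_mul_pow_of_le ((pi_norm_const_le y).trans hyδ)
    have htsum : ∑' z : ι × ℕ, (p z.1 z.2 fun _ => y) = ∑' i, f i (x + y) := by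
      rw [hsum.tsum_prod]
      exact tsum_congr fun i => ((hf i).hasSum hy).tsum_eq
    refine ((Equiv.prodComm ℕ ι).hasSum_iff.2 (htsum ▸ hsum.hasSum)).prod_fiberwise fun n => ?_
    exact ContinuousMultilinearMap.hasSum_eval (hnorm n).of_norm.hasSum fun _ => y

end AnalyticSeries

section AnalyticExponentialSeries

variable {ι E : Type*} [NormedAddCommGroup E] [NormedSpace ℝ E]

theorem hasFPowerSeriesOnBall_exp_comp (φ : E →L[ℝ] ℂ) (c : ℂ) :
    HasFPowerSeriesOnBall (fun y => c * Complex.exp (φ y))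
      (c • (NormedSpace.expSeries ℝ ℂ).compContinuousLinearMap φ) 0 ⊤ := by
  have h : HasFPowerSeriesOnBall (NormedSpace.exp : ℂ → ℂ) (NormedSpace.expSeries ℝ ℂ) (φ 0) ⊤ := by
    rw [map_zero]
    exact NormedSpace.exp_hasFPowerSeriesOnBall
  simpa [← Complex.exp_eq_exp_ℂ, ENNReal.top_div, Function.comp_def, Pi.smul_def]
    using h.compContinuousLinearMap.const_smul (c := c)

theorem norm_smul_expSeries_comp_le (φ : E →L[ℝ] ℂ) (c : ℂ) (n : ℕ) :
    ‖(c • (NormedSpace.expSeries ℝ ℂ).compContinuousLinearMap φ) n‖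
      ≤ ‖c‖ * (‖φ‖ ^ n / n.factorial) := by
  have hexp : ‖NormedSpace.expSeries ℝ ℂ n‖ = (n.factorial : ℝ)⁻¹ := by
    simp [NormedSpace.expSeries, norm_smul]
  refine (norm_smul_le c ((NormedSpace.expSeries ℝ ℂ).compContinuousLinearMap φ n)).trans
    (mul_le_mul_of_nonneg_left ?_ (norm_nonneg c))
  refine (FormalMultilinearSeries.norm_compContinuousLinearMap_le _ φ n).trans_eq ?_
  rw [hexp, inv_mul_eq_div]

theorem analyticAt_tsum_mul_exp {φ : ι → E →L[ℝ] ℂ} {c : ι → ℂ} {δ : ℝ} (hδ : 0 < δ)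
    (h : Summable fun i => ‖c i‖ * Real.exp (δ * ‖φ i‖)) :
    AnalyticAt ℝ (fun y => ∑' i, c i * Complex.exp (φ i y)) 0 := by
  lift δ to NNReal using hδ.le
  have hexp (i : ι) : HasSum (fun n : ℕ => ‖c i‖ * ((δ * ‖φ i‖) ^ n / n.factorial))
      (‖c i‖ * Real.exp (δ * ‖φ i‖)) := by
    rw [Real.exp_eq_exp_ℝ]
    exact (NormedSpace.expSeries_div_hasSum_exp (δ * ‖φ i‖ : ℝ)).mul_left ‖c i‖
  have hmajorant : Summable fun z : ι × ℕ => ‖c z.1‖ * ((δ * ‖φ z.1‖) ^ z.2 / z.2.factorial) :=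
    (summable_prod_of_nonneg fun _ => by positivity).2
      ⟨fun i => (hexp i).summable, by simpa only [(hexp _).tsum_eq] using h⟩
  refine (hasFPowerSeriesOnBall_tsum (NNReal.coe_pos.1 hδ) (fun i =>
    (hasFPowerSeriesOnBall_exp_comp (φ i) (c i)).mono (by simpa using hδ) le_top) <|
    hmajorant.of_nonneg_of_le (fun _ => by positivity) fun ⟨i, n⟩ => ?_).analyticAt
  refine (mul_le_mul_of_nonneg_right (norm_smul_expSeries_comp_le (φ i) (c i) n)
    (by positivity)).trans_eq ?_
  simp only
  ring

end AnalyticExponentialSeries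

theorem expMode_eq_mul_exp_sub (k : ℤ³) (x y : ℝ³) :
    expMode k y
      = expMode k x * Complex.exp ((phaseCLM k).smulRight Complex.I (y - x)) := by
  rw [expMode, expMode, ← Complex.exp_add, ContinuousLinearMap.smulRight_apply, map_sub,
    phaseCLM_apply, phaseCLM_apply, Complex.real_smul, Complex.ofReal_sub]
  ring_nf

theorem HasDecay.analyticAt_fourierSeries {ρ K : ℝ} {a : ℤ³ → ℂ} (hρ : 0 < ρ)
    (ha : HasDecay 1 ρ K a) (x : ℝ³) : AnalyticAt ℝ (fourierSeries a) x := by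
  have hsum : Summable fun k => ‖a k * expMode k x‖ *
      Real.exp (ρ / 6 * ‖(phaseCLM k).smulRight Complex.I‖) := by
    refine ((summable_expDecay one_pos (half_pos hρ)).mul_left K).of_nonneg_of_le
      (fun k => by positivity) fun k => ?_
    have hexp : Real.exp (ρ / 6 * ‖(phaseCLM k).smulRight Complex.I‖)
        ≤ Real.exp (ρ / 2 * waveNorm k) := by
      have := norm_phaseCLM_le k
      rw [ContinuousLinearMap.norm_smulRight_apply, Complex.norm_I, Real.exp_le_exp]
      nlinarith
    have hcancel : expDecay 1 (ρ / 2) k * Real.exp (ρ / 2 * waveNorm k) = 1 := by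
      simp [expDecay, ← Real.exp_add]
    rw [norm_mul, norm_expMode, mul_one]
    calc _ ≤ K * expDecay 1 (ρ / 2 + ρ / 2) k * Real.exp (ρ / 2 * waveNorm k) := by
          rw [add_halves]
          exact mul_le_mul (ha k) hexp (Real.exp_pos _).le ((norm_nonneg _).trans (ha k))
      _ = K * expDecay 1 (ρ / 2) k := by
          rw [expDecay_add, mul_assoc, mul_assoc, hcancel, mul_one]
  have htranslate : fourierSeries a = fun y => ∑' k, a k * expMode k x *
      Complex.exp ((phaseCLM k).smulRight Complex.I (y - x)) := by
    funext y
    simp only [fourierSeries, expMode_eq_mul_exp_sub _ x y, mul_assoc]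
  rw [htranslate]
  have h := analyticAt_tsum_mul_exp (by positivity) hsum
  rw [← sub_self x] at h
  exact h.fun_comp (f := fun y => y - x) (by fun_prop)

section CauchyEstimates

open scoped NNReal

variable {E F : Type*} [NormedAddCommGroup E] [NormedSpace ℝ E] [NormedAddCommGroup F]
  [NormedSpace ℝ F]

theorem exists_nnnorm_changeOrigin_mul_pow_le (p : FormalMultilinearSeries ℝ E F)
    (hp : 0 < p.radius) : ∃ r C : ℝ≥0, 0 < r ∧
      ∀ x : E, ‖x‖₊ ≤ r → ∀ n, ‖p.changeOrigin x n‖₊ * r ^ n ≤ C := by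
  obtain ⟨R, hR0, hR⟩ := ENNReal.lt_iff_exists_nnreal_btwn.1 hp
  have hRR : ((R / 2 : ℝ≥0) : ℝ≥0∞) + ((R / 2 : ℝ≥0) : ℝ≥0∞) < p.radius := by
    rwa [← ENNReal.coe_add, add_halves]
  have hR2 : ((R / 2 : ℝ≥0) : ℝ≥0∞) < p.radius := lt_of_le_of_lt le_self_add hRR
  have hsum := NNReal.summable_sigma.1 (p.changeOriginSeries_summable_aux₁ hRR)
  refine ⟨R / 2, ∑' n, ∑' s : Σ l : ℕ, {s : Finset (Fin (n + l)) // s.card = l},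
    ‖p (n + s.1)‖₊ * (R / 2) ^ s.1 * (R / 2) ^ n, half_pos (ENNReal.coe_pos.1 hR0),
    fun x hx n => le_trans ?_ (hsum.2.le_tsum' n)⟩
  have hxR : (‖x‖₊ : ℝ≥0∞) < p.radius := lt_of_le_of_lt (ENNReal.coe_le_coe.2 hx) hR2
  simp only [NNReal.tsum_mul_right]
  refine mul_le_mul_left ((p.nnnorm_changeOrigin_le n hxR).trans ?_) _
  refine Summable.tsum_le_tsum (fun s => ?_) (p.changeOriginSeries_summable_aux₂ hxR n)
    (p.changeOriginSeries_summable_aux₂ hR2 n)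
  gcongr

/-- The Cauchy estimates of an analytic function with constant `C` and reciprocal radius `A`,
uniform on `S`. Only diagonal values of the derivatives are controlled, since these are the Taylor
coefficients read off from a power series. -/
def CauchyEstimateOn (f : E → F) (C A : ℝ) (S : Set E) : Prop :=
  ∀ y ∈ S, ∀ (n : ℕ) (v : E), ‖v‖ ≤ 1 →
    ‖iteratedFDeriv ℝ n f y fun _ => v‖ ≤ C * n.factorial * A ^ n

theorem CauchyEstimateOn.mono {f : E → F} {C C' A A' : ℝ} {S : Set E}
    (h : CauchyEstimateOn f C A S) (hC0 : 0 ≤ C) (hA0 : 0 ≤ A) (hC : C ≤ C') (hA : A ≤ A') :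
    CauchyEstimateOn f C' A' S := fun y hy n v hv => by
  have hC0' := hC0.trans hC
  exact (h y hy n v hv).trans (by gcongr)

theorem exists_cauchyEstimateOn_nhds [CompleteSpace F] {f : E → F} {x : E} (hf : AnalyticAt ℝ f x) :
    ∃ U ∈ 𝓝 x, ∃ C A : ℝ, 0 ≤ C ∧ 0 < A ∧ CauchyEstimateOn f C A U := by
  obtain ⟨p, R, hp⟩ := hf
  obtain ⟨r, C, hr0, hC⟩ := exists_nnnorm_changeOrigin_mul_pow_le p (hp.r_pos.trans_le hp.r_le)
  have hmin : 0 < min (r : ℝ≥0∞) R := lt_min (ENNReal.coe_pos.2 hr0) hp.r_pos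
  refine ⟨Metric.eball x (min r R), Metric.eball_mem_nhds x hmin, C, (r : ℝ)⁻¹,
    C.coe_nonneg, by positivity, fun y hy n v hv => ?_⟩
  rw [Metric.mem_eball, edist_eq_enorm_sub, lt_min_iff] at hy
  have hseries := hp.changeOrigin hy.2
  rw [add_sub_cancel] at hseries
  have hcoeff : ‖p.changeOrigin (y - x) n‖ ≤ C * (r : ℝ)⁻¹ ^ n := by
    rw [inv_pow, ← div_eq_mul_inv, le_div_iff₀ (by positivity)]
    exact_mod_cast hC _ (ENNReal.coe_le_coe.1 hy.1.le) n
  have hdiag : ‖p.changeOrigin (y - x) n fun _ => v‖ ≤ ‖p.changeOrigin (y - x) n‖ := by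
    simpa using (p.changeOrigin (y - x) n).le_opNorm_mul_pow_of_le ((pi_norm_const_le v).trans hv)
  rw [← hseries.factorial_smul v n, ← Nat.cast_smul_eq_nsmul ℝ, norm_smul, Real.norm_natCast]
  calc (n.factorial : ℝ) * ‖p.changeOrigin (y - x) n fun _ => v‖
      ≤ n.factorial * (C * (r : ℝ)⁻¹ ^ n) := by gcongr; exact hdiag.trans hcoeff
    _ = _ := by ring

theorem exists_cauchyEstimateOn_of_isCompact [CompleteSpace F] {f : E → F} {S : Set E}
    (hS : IsCompact S) (hf : AnalyticOnNhd ℝ f S) :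
    ∃ C A : ℝ, 0 ≤ C ∧ 0 < A ∧ CauchyEstimateOn f C A S := by
  have hmono {T T' : Set E} (hTT : T ⊆ T') :
      (∃ C A : ℝ, 0 ≤ C ∧ 0 < A ∧ CauchyEstimateOn f C A T') →
        ∃ C A : ℝ, 0 ≤ C ∧ 0 < A ∧ CauchyEstimateOn f C A T :=
    fun ⟨C, A, hC, hA, h⟩ => ⟨C, A, hC, hA, fun y hy => h y (hTT hy)⟩
  refine hS.induction_on ⟨0, 1, le_rfl, one_pos, fun y hy => absurd hy (Set.notMem_empty y)⟩
    (fun T T' => hmono) ?_ fun x hx => ?_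
  · rintro T T' ⟨C, A, hC, hA, h⟩ ⟨C', A', hC', hA', h'⟩
    refine ⟨max C C', max A A', le_max_of_le_left hC, lt_max_of_lt_left hA, ?_⟩
    rintro y (hy | hy)
    · exact h.mono hC hA.le (le_max_left _ _) (le_max_left _ _) y hy
    · exact h'.mono hC' hA'.le (le_max_right _ _) (le_max_right _ _) y hy
  · obtain ⟨U, hU, h⟩ := exists_cauchyEstimateOn_nhds (hf x hx)
    exact ⟨U, mem_nhdsWithin_of_mem_nhds hU, h⟩

end CauchyEstimates

theorem exp_mul_le_of_pow_mul_le {t b C A : ℝ} (hA : 0 < A)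
    (h : ∀ n : ℕ, t ^ n * b ≤ C * n.factorial * A ^ n) :
    Real.exp (t / (2 * A)) * b ≤ C * 2 := by
  have hexp : HasSum (fun n : ℕ => (t / (2 * A)) ^ n / n.factorial) (Real.exp (t / (2 * A))) := by
    rw [Real.exp_eq_exp_ℝ]
    exact NormedSpace.expSeries_div_hasSum_exp _
  refine hasSum_le (fun n => ?_) (hexp.mul_right b) (hasSum_geometric_two.mul_left C)
  calc (t / (2 * A)) ^ n / n.factorial * b
      = t ^ n * b / ((2 * A) ^ n * n.factorial) := by rw [div_pow]; ring
    _ ≤ C * n.factorial * A ^ n / ((2 * A) ^ n * n.factorial) :=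
        div_le_div_of_nonneg_right (h n) (by positivity)
    _ = C * (1 / 2) ^ n := by rw [mul_pow, div_pow, one_pow]; field_simp

section IntegrationByParts

theorem integral_fderiv_single_eq_zero {E : Type*} [NormedAddCommGroup E] [NormedSpace ℝ E]
    {n : ℕ} {a b : Fin (n + 1) → ℝ} (hab : a ≤ b) {G : (Fin (n + 1) → ℝ) → E}
    {G' : (Fin (n + 1) → ℝ) → (Fin (n + 1) → ℝ) →L[ℝ] E} (hG : ∀ x, HasFDerivAt G (G' x) x)
    (hG' : Continuous G') (i : Fin (n + 1))
    (hper : ∀ x, G (x + Pi.single i (b i - a i)) = G x) :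
    ∫ x in Set.Icc a b, G' x (Pi.single i 1) = 0 := by
  have hcont : Continuous G := continuous_iff_continuousAt.2 fun x => (hG x).continuousAt
  have hsum (x : Fin (n + 1) → ℝ) :
      ∑ j, (if j = i then G' x else 0) (Pi.single j (1 : ℝ)) = G' x (Pi.single i 1) := by
    rw [Finset.sum_eq_single i (fun j _ hj => by simp [hj]) (by simp), if_pos rfl]
  have hdiv := integral_divergence_of_hasFDerivAt_off_countable' a b hab
    (fun j => if j = i then G else 0) (fun j x => if j = i then G' x else 0) ∅
    Set.countable_empty
    (fun j => by split_ifs <;> [exact hcont.continuousOn; exact continuousOn_const])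
    (fun x _ j => by split_ifs <;> [exact hG x; exact hasFDerivAt_const 0 x])
    (by
      simp only [hsum]
      exact (hG'.clm_apply continuous_const).continuousOn.integrableOn_compact isCompact_Icc)
  simp only [hsum] at hdiv
  rw [hdiv]
  refine Finset.sum_eq_zero fun j _ => ?_
  rcases eq_or_ne j i with rfl | hj
  · have hface (x : Fin n → ℝ) : G (j.insertNth (b j) x) = G (j.insertNth (a j) x) := by
      rw [← hper (j.insertNth (a j) x)]
      congr 1
      funext l
      rcases eq_or_ne l j with rfl | hl
      · simp
      · obtain ⟨l, rfl⟩ := Fin.exists_succAbove_eq hl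
        simp
    simp [hface]
  · simp [hj]

variable {f : ℝ³ → ℝ}

theorem TorusPeriodic.partialDeriv (hf : TorusPeriodic f) (i : Fin 3) :
    TorusPeriodic (partialDeriv i f) := fun x j => by
  have hshift : (fun y => f (y + Pi.single j (2 * Real.pi))) = f := funext fun y => hf y j
  rw [MG.partialDeriv, MG.partialDeriv, ← fderiv_comp_add_right, hshift]

theorem contDiff_partialDeriv (hf : ContDiff ℝ ∞ f) (i : Fin 3) :
    ContDiff ℝ ∞ (partialDeriv i f) :=
  (hf.fderiv_right (by simp)).clm_apply contDiff_const

theorem fourierCoeffT3_eq_integral_expMode (f : ℝ³ → ℝ) (k : ℤ³) :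
    fourierCoeffT3 f k = ((2 * Real.pi : ℝ) : ℂ)⁻¹ ^ 3 *
      ∫ x in Set.Icc (0 : ℝ³) (fun _ => 2 * Real.pi), (f x : ℂ) * expMode (-k) x := by
  simp only [fourierCoeffT3, expMode, phase_neg, Complex.ofReal_neg, mul_neg]

theorem fourierCoeffT3_partialDeriv (hf : ContDiff ℝ ∞ f) (hper : TorusPeriodic f) (i : Fin 3)
    (k : ℤ³) : fourierCoeffT3 (partialDeriv i f) k = Complex.I * k i * fourierCoeffT3 f k := by
  have hfd (x : ℝ³) : HasFDerivAt (fun x => (f x : ℂ)) (Complex.ofRealCLM.comp (fderiv ℝ f x)) x :=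
    Complex.ofRealCLM.hasFDerivAt.comp x ((hf.differentiable (by simp)) x).hasFDerivAt
  have hcont_exp : Continuous (expMode (-k)) := (contDiff_expMode (-k) (n := 0)).continuous
  have hcont_f : Continuous fun x => (f x : ℂ) := Complex.continuous_ofReal.comp hf.continuous
  have hcont_pd : Continuous (partialDeriv i f) := (contDiff_partialDeriv hf i).continuous
  have hcont_fd : Continuous fun x => Complex.ofRealCLM.comp (fderiv ℝ f x) :=
    continuous_const.clm_comp (hf.continuous_fderiv (by simp))
  have hcont_expd : Continuous fun x => (phaseCLM (-k)).smulRight (Complex.I * expMode (-k) x) :=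
    (ContinuousLinearMap.smulRightL ℝ ℝ³ ℂ (phaseCLM (-k))).continuous.comp
      (continuous_const.mul hcont_exp)
  have hzero := integral_fderiv_single_eq_zero (a := 0) (b := fun _ => 2 * Real.pi)
    (fun _ => Real.two_pi_pos.le) (fun x => (hfd x).mul (hasFDerivAt_expMode (-k) x))
    ((hcont_f.smul hcont_expd).add (hcont_exp.smul hcont_fd)) i
    (fun x => by simp [hper x i, expMode_periodic])
  have hprod (x : ℝ³) : ((f x : ℂ) • (phaseCLM (-k)).smulRight (Complex.I * expMode (-k) x) +
      expMode (-k) x • Complex.ofRealCLM.comp (fderiv ℝ f x)) (Pi.single i 1) =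
      (partialDeriv i f x : ℂ) * expMode (-k) x
        - Complex.I * k i * ((f x : ℂ) * expMode (-k) x) := by
    simp [phaseCLM_apply, phase, Pi.single_apply, partialDeriv]
    ring
  simp only [hprod] at hzero
  rw [integral_sub, integral_const_mul, sub_eq_zero] at hzero
  · rw [fourierCoeffT3_eq_integral_expMode, fourierCoeffT3_eq_integral_expMode, hzero]
    ring
  all_goals exact Continuous.integrableOn_Icc (by fun_prop)

theorem iterate_partialDeriv (hf : ContDiff ℝ ∞ f) (i : Fin 3) (n : ℕ) :
    (partialDeriv i)^[n] f = fun x => iteratedFDeriv ℝ n f x fun _ => Pi.single i 1 := by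
  induction n with
  | zero => funext x; simp
  | succ n ih =>
    rw [Function.iterate_succ_apply', ih]
    funext x
    have hd : DifferentiableAt ℝ (iteratedFDeriv ℝ n f) x :=
      (hf.differentiable_iteratedFDeriv (by exact_mod_cast ENat.natCast_lt_top n)) x
    have h := (ContinuousMultilinearMap.apply ℝ (fun _ : Fin n => ℝ³) ℝ
      fun _ => Pi.single i 1).hasFDerivAt.comp x hd.hasFDerivAt
    rw [iteratedFDeriv_succ_apply_left, partialDeriv]
    exact DFunLike.congr_fun h.fderiv (Pi.single i 1)

theorem fourierCoeffT3_iterate_partialDeriv (hf : ContDiff ℝ ∞ f) (hper : TorusPeriodic f)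
    (i : Fin 3) (k : ℤ³) (n : ℕ) :
    fourierCoeffT3 ((partialDeriv i)^[n] f) k = (Complex.I * k i) ^ n * fourierCoeffT3 f k := by
  induction n generalizing f with
  | zero => simp
  | succ n ih =>
    rw [Function.iterate_succ_apply, ih (contDiff_partialDeriv hf i) (hper.partialDeriv i),
      fourierCoeffT3_partialDeriv hf hper]
    ring

end IntegrationByParts

theorem norm_fourierCoeffT3_le {f : ℝ³ → ℝ} {B : ℝ}
    (h : ∀ x ∈ Set.Icc (0 : ℝ³) (fun _ => 2 * Real.pi), |f x| ≤ B) (k : ℤ³) :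
    ‖fourierCoeffT3 f k‖ ≤ B := by
  have hvol : volume.real (Set.Icc (0 : ℝ³) fun _ => 2 * Real.pi) = (2 * Real.pi) ^ 3 := by
    have hle : (0 : ℝ³) ≤ fun _ => 2 * Real.pi := fun _ => Real.two_pi_pos.le
    simp [Measure.real, Real.volume_Icc_pi_toReal hle]
  have hbound := norm_setIntegral_le_of_norm_le_const (μ := volume)
    (f := fun x => (f x : ℂ) * expMode (-k) x) (C := B)
    (isCompact_Icc (a := (0 : ℝ³)) (b := fun _ => 2 * Real.pi)).measure_lt_top
    fun x hx => by simpa [norm_expMode] using h x hx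
  rw [hvol] at hbound
  rw [fourierCoeffT3_eq_integral_expMode, norm_mul, norm_pow, norm_inv, Complex.norm_real,
    Real.norm_of_nonneg Real.two_pi_pos.le, inv_pow, inv_mul_le_iff₀ (by positivity), mul_comm _ B]
  exact hbound

theorem exists_waveNorm_le_mul_abs (k : ℤ³) : ∃ i, waveNorm k ≤ 3 * |(k i : ℝ)| := by
  obtain ⟨i, -, hi⟩ := Finset.univ.exists_max_image (fun i => |(k i : ℝ)|) Finset.univ_nonempty
  refine ⟨i, (waveNorm_le_sum_abs k).trans ?_⟩
  simpa using Finset.sum_le_card_nsmul Finset.univ (fun j => |(k j : ℝ)|) _ hi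

theorem exists_hasDecay_of_analyticOnNhd {f : ℝ³ → ℝ} (hf : AnalyticOnNhd ℝ f Set.univ)
    (hper : TorusPeriodic f) : ∃ ρ K : ℝ, 0 < ρ ∧ HasDecay 1 ρ K (fourierCoeffT3 f) := by
  obtain ⟨C, A, -, hA, hCauchy⟩ := exists_cauchyEstimateOn_of_isCompact
    (isCompact_Icc (a := (0 : ℝ³)) (b := fun _ => 2 * Real.pi)) (hf.mono (Set.subset_univ _))
  have hpow (k : ℤ³) (i : Fin 3) (n : ℕ) :
      |(k i : ℝ)| ^ n * ‖fourierCoeffT3 f k‖ ≤ C * n.factorial * A ^ n := by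
    have hcoeff := fourierCoeffT3_iterate_partialDeriv hf.contDiff hper i k n
    rw [iterate_partialDeriv hf.contDiff] at hcoeff
    calc |(k i : ℝ)| ^ n * ‖fourierCoeffT3 f k‖ = ‖(Complex.I * k i) ^ n * fourierCoeffT3 f k‖ := by
          simp
      _ ≤ C * n.factorial * A ^ n := hcoeff ▸ norm_fourierCoeffT3_le
          (fun x hx => hCauchy x hx n _ (by simp [Pi.norm_single])) k
  refine ⟨1 / (6 * A), C * 2, by positivity, fun k => ?_⟩
  obtain ⟨i, hi⟩ := exists_waveNorm_le_mul_abs k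
  rw [expDecay, Real.exp_neg, Real.rpow_one, ← div_eq_mul_inv, le_div_iff₀ (Real.exp_pos _),
    mul_comm]
  calc Real.exp (1 / (6 * A) * waveNorm k) * ‖fourierCoeffT3 f k‖
      ≤ Real.exp (|(k i : ℝ)| / (2 * A)) * ‖fourierCoeffT3 f k‖ := by
        gcongr
        calc 1 / (6 * A) * waveNorm k ≤ 1 / (6 * A) * (3 * |(k i : ℝ)|) := by gcongr
          _ = |(k i : ℝ)| / (2 * A) := by ring
    _ ≤ C * 2 := exp_mul_le_of_pow_mul_le hA (hpow k i)

theorem exists_hasUniqueGevreySolution_symbolFracM {Ω η α s τ₀ K₀ : ℝ} (hΩ : 0 < Ω) (hη : 0 < η)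
    (β r : ℝ) (hs : 1 ≤ s) (hα : α + 1 ≤ 1 / s) (hτ₀ : 0 < τ₀) (hK₀ : 0 ≤ K₀) :
    ∃ T : ℝ, 0 < T ∧ ∀ θ₀ : ℝ³ → ℝ, SmoothMeanZero θ₀ →
      gevreyNorm r s τ₀ θ₀ ≤ ENNReal.ofReal K₀ →
        HasUniqueGevreySolution (symbolFracM α Ω β η) r s T θ₀ := by
  have hs0 : 0 < s := one_pos.trans_le hs
  obtain ⟨M, hm⟩ := exists_isTransportSymbol_symbolFracM (β := β) hΩ hη (one_div_pos.2 hs0)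
    ((div_le_one hs0).2 hs) hα
  obtain ⟨K, hK⟩ := exists_hasDecay_of_gevreyNorm_le hs0 (half_lt_self hτ₀) r hK₀
  obtain ⟨T, hT, hsol⟩ := hm.exists_hasUniqueGevreySolution hs0 r (half_pos hτ₀) K
  exact ⟨T, hT, fun θ₀ hθ₀ hnorm => hsol θ₀ hθ₀ (hK θ₀ hθ₀.mean_zero hnorm)⟩

theorem exists_hasUniqueGevreySolution_of_analyticOnNhd {Ω η : ℝ} (hΩ : 0 < Ω) (hη : 0 < η)
    (β r : ℝ) {θ₀ : ℝ³ → ℝ} (hper : TorusPeriodic θ₀) (hmean : MeanZero θ₀)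
    (han : AnalyticOnNhd ℝ θ₀ Set.univ) :
    ∃ T : ℝ, 0 < T ∧ HasUniqueGevreySolution (symbolM Ω β η) r 1 T θ₀ := by
  obtain ⟨ρ, K, hρ, hdecay⟩ := exists_hasDecay_of_analyticOnNhd han hper
  obtain ⟨M, hm⟩ := exists_isTransportSymbol_symbolFracM (β := β) (α := 0) (σ := 1 / 1) hΩ hη
    (by norm_num) (by norm_num) (by norm_num)
  rw [symbolFracM_zero_left] at hm
  obtain ⟨T, hT, hsol⟩ := hm.exists_hasUniqueGevreySolution one_pos r hρ K
  exact ⟨T, hT, hsol θ₀ ⟨han.contDiff, hper, hmean⟩ (by rwa [div_one])⟩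

theorem IsGevreySolution.analyticOnNhd {m : ℤ³ → Fin 3 → ℝ} {r T t : ℝ} {θ₀ : ℝ³ → ℝ}
    {θ : ℝ → ℝ³ → ℝ} (hθ : IsGevreySolution m r 1 T θ₀ θ) (ht : t ∈ Set.Ico 0 T) :
    AnalyticOnNhd ℝ (θ t) Set.univ := by
  obtain ⟨ρ, K, hρ, hdecay⟩ := hθ.exists_hasDecay one_pos ht
  have hd := hdecay t ⟨ht.1, le_rfl⟩
  rw [div_one] at hd
  rw [(hθ.smooth t ht).eq_re_fourierSeries (hd.summable_norm one_pos hρ)]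
  exact fun x _ => (Complex.reCLM.analyticAt _).comp (hd.analyticAt_fourierSeries hρ x)

end MG

end

theorem mainTheorem5_general (Ω β η : ℝ) (hΩ : 0 < Ω) (hη : 0 < η) (r : ℝ) :
    (∀ α s : ℝ, 1 ≤ s → α + 1 ≤ 1 / s →
      ∀ τ₀ : ℝ, 0 < τ₀ → ∀ K₀ : ℝ, 0 ≤ K₀ → ∃ T : ℝ, 0 < T ∧
        ∀ θ₀ : (Fin 3 → ℝ) → ℝ, MG.SmoothMeanZero θ₀ →
          MG.gevreyNorm r s τ₀ θ₀ ≤ ENNReal.ofReal K₀ →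
          MG.HasUniqueGevreySolution (MG.symbolFracM α Ω β η) r s T θ₀) ∧
    (∀ θ₀ : (Fin 3 → ℝ) → ℝ, MG.TorusPeriodic θ₀ → MG.MeanZero θ₀ →
      AnalyticOnNhd ℝ θ₀ Set.univ →
      ∃ T : ℝ, 0 < T ∧ MG.HasUniqueGevreySolution (MG.symbolM Ω β η) r 1 T θ₀ ∧
        ∀ θ : ℝ → (Fin 3 → ℝ) → ℝ, MG.IsGevreySolution (MG.symbolM Ω β η) r 1 T θ₀ θ →
          ∀ t ∈ Set.Ico 0 T, AnalyticOnNhd ℝ (θ t) Set.univ) := by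
  refine ⟨fun α s hs hα τ₀ hτ₀ K₀ hK₀ =>
    MG.exists_hasUniqueGevreySolution_symbolFracM hΩ hη β r hs hα hτ₀ hK₀,
    fun θ₀ hper hmean han => ?_⟩
  obtain ⟨T, hT, hsol⟩ :=
    MG.exists_hasUniqueGevreySolution_of_analyticOnNhd hΩ hη β r hper hmean han
  exact ⟨T, hT, hsol, fun θ hθ t ht => hθ.analyticOnNhd ht⟩

theorem mainTheorem5 (Ω β η : ℝ) (hΩ : 0 < Ω) (hβ : 0 < β) (hη : 0 < η)
    (r : ℝ) (hr : 3 < r) :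
    (∀ α : ℝ, -1 < α → α ≤ 0 → ∀ s : ℝ, 1 ≤ s → s ≤ 1 / (α + 1) →
      ∀ τ₀ : ℝ, 0 < τ₀ → ∀ K₀ : ℝ, 0 < K₀ → ∃ T : ℝ, 0 < T ∧
        ∀ θ₀ : (Fin 3 → ℝ) → ℝ, MG.SmoothMeanZero θ₀ →
          MG.gevreyNorm r s τ₀ θ₀ ≤ ENNReal.ofReal K₀ →
          MG.HasUniqueGevreySolution (MG.symbolFracM α Ω β η) r s T θ₀) ∧
    (∀ s : ℝ, 1 ≤ s →
      ∀ τ₀ : ℝ, 0 < τ₀ → ∀ K₀ : ℝ, 0 < K₀ → ∃ T : ℝ, 0 < T ∧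
        ∀ θ₀ : (Fin 3 → ℝ) → ℝ, MG.SmoothMeanZero θ₀ →
          MG.gevreyNorm r s τ₀ θ₀ ≤ ENNReal.ofReal K₀ →
          MG.HasUniqueGevreySolution (MG.symbolFracM (-1) Ω β η) r s T θ₀) ∧
    (∀ θ₀ : (Fin 3 → ℝ) → ℝ, MG.TorusPeriodic θ₀ → MG.MeanZero θ₀ →
      AnalyticOnNhd ℝ θ₀ Set.univ →
      ∃ T : ℝ, 0 < T ∧ MG.HasUniqueGevreySolution (MG.symbolM Ω β η) r 1 T θ₀ ∧
        ∀ θ : ℝ → (Fin 3 → ℝ) → ℝ, MG.IsGevreySolution (MG.symbolM Ω β η) r 1 T θ₀ θ →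
          ∀ t ∈ Set.Ico 0 T, AnalyticOnNhd ℝ (θ t) Set.univ) := by
  obtain ⟨hgevrey, hanalytic⟩ := mainTheorem5_general Ω β η hΩ hη r
  refine ⟨fun α hα1 _ s hs hsα τ₀ hτ₀ K₀ hK₀ => ?_, fun s hs τ₀ hτ₀ K₀ hK₀ => ?_, hanalytic⟩
  · exact hgevrey α s hs ((le_one_div (by linarith) (by linarith)).1 hsα) τ₀ hτ₀ K₀ hK₀.le
  · exact hgevrey (-1) s hs (by rw [neg_add_cancel]; positivity) τ₀ hτ₀ K₀ hK₀.le
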